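/- A boolean dynamical system consists of a finite simple undirected graph $G=(V,E)$ with $V=\{1,\dots,n\}$ and, for every vertex $i\in V$, a boolean function $f_i:\{0,1\}^{N^0_G(i)}\to\{0,1\}$, where $N^0_G(i)=\{i\}\cup\{j\in V\mid \{i,j\}\in E\}$. A configuration $x\in\{0,1\}^V$ is a fixed point of the system if $f_i\bigl((x_j)_{j\in N^0_G(i)}\bigr)=x_i$ for all $i\in V$. For a graph $X$, let $\mathrm{Forb}_\preceq(X)$ be the class of all finite graphs that do not have $X$ as a minor, where $X$ is a minor of $G$ if a graph isomorphic to $X$ arises from a subgraph of $G$ by contracting edges. Let $X$ be a finite graph that has a vertex cover of size one, i.e., there is a vertex of $X$ that is incident to every edge of $X$. Let $B$ be a finite logical basis, i.e., a finite set of gate types, each computing a fixed boolean function of some finite arity (for example, a basis from which all boolean functions can be built). Consider the following decision problem. Input: a boolean dynamical system whose graph $G$ belongs to $\mathrm{Forb}_\preceq(X)$ and whose local transition functions $f_i$ are arbitrary boolean functions, each given by a formula over $B$ whose variables are vertices in $N^0_G(i)$. Question: does the system have a fixed point? This problem is solvable in polynomial time. The same holds if the functions $f_i$ are given by circuits over $B$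 instead of formulas. That is, with systems written as strings over a finite alphabet (the adjacency matrix of $G$ together with the formulas or circuits, all vertex and gate numbers in unary), the set of all strings that describe a system with a graph in $\mathrm{Forb}_\preceq(X)$ that has a fixed point is decidable by a Turing machine in time polynomial in the length of the string, in each of the two cases. -/

import Mathlib

/-! ### Minors and forbidden-minor classes -/

/-- `X` arises from `H` by contracting edges (up to isomorphism): the vertex set of `H` is
partitioned into nonempty connected parts, one for each vertex of `X`, every part is contracted to
a single vertex, and two distinct vertices of `X` are adjacent iff `H` has an edge between the
corresponding parts. -/
def IsContractionOf {W U : Type*} (X : SimpleGraph W) (H : SimpleGraph U) : Prop :=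
  ∃ φ : U → W, (∀ w, (H.induce (φ ⁻¹' {w})).Connected) ∧
    ∀ a b, a ≠ b → (X.Adj a b ↔ ∃ u v, φ u = a ∧ φ v = b ∧ H.Adj u v)

/-- `X` is a minor of `Y`: it is obtained by contracting edges of a subgraph of `Y`. -/
def IsMinorOf {W V : Type*} (X : SimpleGraph W) (Y : SimpleGraph V) : Prop :=
  ∃ H : Y.Subgraph, IsContractionOf X H.coe

/-- A class of finite graphs, each on a vertex set `{0, …, n - 1}`. -/
abbrev GraphClass := (n : ℕ) → Set (SimpleGraph (Fin n))

/-- The class of all finite graphs that do not have `X` as a minor. -/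
def Forb {W : Type*} (X : SimpleGraph W) : GraphClass :=
  fun _ => {G | ¬ IsMinorOf X G}

/-! ### Boolean dynamical systems -/

/-- `N⁰(i)`: the vertex `i` together with its neighbors. -/
def closedNbhd {n : ℕ} (G : SimpleGraph (Fin n)) (i : Fin n) : Set (Fin n) :=
  insert i (G.neighborSet i)

/-- A boolean dynamical system with `n` vertices: a network, and for every vertex `i` a local
transition function, which takes the states of the vertices in `N⁰(i)`. -/
structure BooleanDynamicalSystem (n : ℕ) where
  graph : SimpleGraph (Fin n)
  f : (i : Fin n) → (closedNbhd graph i → Bool) → Bool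

namespace BooleanDynamicalSystem

open Classical in
/-- The activity function of the vertex `i` for a set `U` of vertices. -/
noncomputable def activity {n : ℕ} (S : BooleanDynamicalSystem n) (U : Set (Fin n))
    (x : Fin n → Bool) (i : Fin n) : Bool :=
  if i ∈ U then S.f i (fun j => x j) else x i

/-- The global transition function for a set `U` of vertices. -/
noncomputable def globalTransition {n : ℕ} (S : BooleanDynamicalSystem n) (U : Set (Fin n))
    (x : Fin n → Bool) : Fin n → Bool :=
  fun i => S.activity U x i

/-- `x` is a local fixed point for `U`. -/
def IsLocalFixedPoint {n : ℕ} (S : BooleanDynamicalSystem n) (U : Set (Fin n))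
    (x : Fin n → Bool) : Prop :=
  S.globalTransition U x = x

/-- `x` is a fixed point of `S`: a local fixed point for the set of all vertices. -/
def IsFixedPoint {n : ℕ} (S : BooleanDynamicalSystem n) (x : Fin n → Bool) : Prop :=
  S.IsLocalFixedPoint Set.univ x

end BooleanDynamicalSystem

/-! ### Formulas and circuits over a finite logical basis -/

/-- A finite logical basis: finitely many gate types, each computing a fixed boolean function
of some finite arity (constants have arity `0`). -/
structure LogicalBasis where
  numGates : ℕ
  arity : Fin numGates → ℕ
  eval : (g : Fin numGates) → (Fin (arity g) → Bool) → Bool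

/-- Formulas over the basis `B` with variables in `ι`. -/
inductive BoolFormula (B : LogicalBasis) (ι : Type) : Type
  | var (v : ι) : BoolFormula B ι
  | gate (g : Fin B.numGates) (args : Fin (B.arity g) → BoolFormula B ι) : BoolFormula B ι

/-- The boolean function computed by a formula. -/
def BoolFormula.eval {B : LogicalBasis} {ι : Type} (x : ι → Bool) : BoolFormula B ι → Bool
  | .var v => x v
  | .gate g args => B.eval g (fun a => (args a).eval x)

/-- The node number `k` of a circuit over the basis `B` with variables in `ι`: an input gate, or
a gate from the basis whose inputs are nodes with numbers smaller than `k`. -/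
inductive CircuitNode (B : LogicalBasis) (ι : Type) (k : ℕ) : Type
  | input (v : ι) : CircuitNode B ι k
  | gate (g : Fin B.numGates) (args : Fin (B.arity g) → Fin k) : CircuitNode B ι k

/-- Circuits over the basis `B` with variables in `ι`, the nodes being listed in a topological
order, with one node designated as the output. -/
structure BoolCircuit (B : LogicalBasis) (ι : Type) where
  size : ℕ
  node : (k : Fin size) → CircuitNode B ι k
  output : Fin size

/-- The value of a node of a circuit. -/
def BoolCircuit.value {B : LogicalBasis} {ι : Type} (C : BoolCircuit B ι) (x : ι → Bool)
    (k : Fin C.size) : Bool :=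
  match C.node k with
  | .input v => x v
  | .gate g args => B.eval g (fun a => C.value x ⟨args a, (args a).isLt.trans k.isLt⟩)
termination_by k.val
decreasing_by exact (args a).isLt

/-- The boolean function computed by a circuit. -/
def BoolCircuit.eval {B : LogicalBasis} {ι : Type} (x : ι → Bool) (C : BoolCircuit B ι) : Bool :=
  C.value x C.output

/-! ### Systems with local transition functions given by formulas or circuits -/

/-- A boolean dynamical system whose local transition functions are given by formulas. -/
structure FormulaSystem (B : LogicalBasis) (n : ℕ) where
  graph : SimpleGraph (Fin n)
  formula : (i : Fin n) → BoolFormula B (closedNbhd graph i)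

/-- The dynamical system described by a system of formulas. -/
def FormulaSystem.toSystem {B : LogicalBasis} {n : ℕ} (S : FormulaSystem B n) :
    BooleanDynamicalSystem n where
  graph := S.graph
  f i x := (S.formula i).eval x

/-- A boolean dynamical system whose local transition functions are given by circuits. -/
structure CircuitSystem (B : LogicalBasis) (n : ℕ) where
  graph : SimpleGraph (Fin n)
  circuit : (i : Fin n) → BoolCircuit B (closedNbhd graph i)

/-- The dynamical system described by a system of circuits. -/
def CircuitSystem.toSystem {B : LogicalBasis} {n : ℕ} (S : CircuitSystem B n) :
    BooleanDynamicalSystem n where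
  graph := S.graph
  f i x := (S.circuit i).eval x

/-! ### Encoding of systems as strings over a finite alphabet

A system is written as the list of its vertices, each with its row of the adjacency matrix and its
formula (in prefix notation) or circuit (as the list of its nodes). Vertices and circuit nodes are
referred to by their numbers in unary; as these numbers are smaller than the number of vertices of
the system resp. of nodes of the circuit, this keeps the length of the string polynomially related
to the sum of the number of vertices and the sizes of the formulas or circuits. -/

/-- The alphabet. -/
inductive Token (B : LogicalBasis) : Type
  /-- begin of the entry of a vertex -/
  | vertex : Token B
  /-- entry of the adjacency matrix -/
  | adj (b : Bool) : Token B
  /-- variable, followed by the number of the vertex -/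
  | var : Token B
  /-- gate from the basis -/
  | gate (g : Fin B.numGates) : Token B
  /-- reference to a node of a circuit, followed by the number of the node -/
  | ref : Token B
  /-- designation of the output node of a circuit, followed by the number of the node -/
  | out : Token B
  /-- unary digit -/
  | one : Token B

/-- Unary notation. -/
def encodeUnary {B : LogicalBasis} (k : ℕ) : List (Token B) :=
  List.replicate k .one

/-- Prefix notation of a formula whose variables are vertices. -/
def BoolFormula.encode {B : LogicalBasis} {n : ℕ} {A : Set (Fin n)} :
    BoolFormula B A → List (Token B)
  | .var v => .var :: encodeUnary v.1
  | .gate g args => .gate g :: (List.ofFn fun a => (args a).encode).flatten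

/-- Notation of a node of a circuit whose variables are vertices. -/
def CircuitNode.encode {B : LogicalBasis} {n : ℕ} {A : Set (Fin n)} {k : ℕ} :
    CircuitNode B A k → List (Token B)
  | .input v => .var :: encodeUnary v.1
  | .gate g args => .gate g :: (List.ofFn fun a => .ref :: encodeUnary (args a)).flatten

/-- Notation of a circuit whose variables are vertices: its nodes, and then its output. -/
def BoolCircuit.encode {B : LogicalBasis} {n : ℕ} {A : Set (Fin n)} (C : BoolCircuit B A) :
    List (Token B) :=
  (List.ofFn fun k => (C.node k).encode).flatten ++ .out :: encodeUnary C.output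

open Classical in
/-- The row of the vertex `i` in the adjacency matrix. -/
noncomputable def encodeRow {B : LogicalBasis} {n : ℕ} (G : SimpleGraph (Fin n)) (i : Fin n) :
    List (Token B) :=
  List.ofFn fun j => .adj (decide (G.Adj i j))

/-- The string that describes a system given by formulas. -/
noncomputable def FormulaSystem.encode {B : LogicalBasis} {n : ℕ} (S : FormulaSystem B n) :
    List (Token B) :=
  (List.ofFn fun i => .vertex :: (encodeRow S.graph i ++ (S.formula i).encode)).flatten

/-- The string that describes a system given by circuits. -/
noncomputable def CircuitSystem.encode {B : LogicalBasis} {n : ℕ} (S : CircuitSystem B n) :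
    List (Token B) :=
  (List.ofFn fun i => .vertex :: (encodeRow S.graph i ++ (S.circuit i).encode)).flatten

/-! ### The fixed-point existence problems -/

/-- Fixed-point existence for arbitrary boolean functions given by formulas over `B` on networks
in the class `𝒢`, as the language of all (strings describing) systems with a fixed point. -/
def FPEFormula (B : LogicalBasis) (𝒢 : GraphClass) : Language (Token B) :=
  {w | ∃ (n : ℕ) (S : FormulaSystem B n),
    S.encode = w ∧ S.graph ∈ 𝒢 n ∧ ∃ x, S.toSystem.IsFixedPoint x}

/-- Fixed-point existence for arbitrary boolean functions given by circuits over `B` on networks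
in the class `𝒢`, as the language of all (strings describing) systems with a fixed point. -/
def FPECircuit (B : LogicalBasis) (𝒢 : GraphClass) : Language (Token B) :=
  {w | ∃ (n : ℕ) (S : CircuitSystem B n),
    S.encode = w ∧ S.graph ∈ 𝒢 n ∧ ∃ x, S.toSystem.IsFixedPoint x}

/-- A language is decidable in polynomial time: some multi-stack Turing machine computes, on
every input string, the answer to membership within a number of steps bounded by a polynomial in
the length of the string. -/
def DecidableInPolyTime {Γ : Type} (L : Language Γ) : Prop :=
  ∃ f : List Γ → Bool, (∀ w, f w = true ↔ w ∈ L) ∧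
    Nonempty (Turing.TM2ComputableInPolyTime (id : List Γ → List Γ) Computability.encodeBool f)

/-!
Both problems are decided by evaluating, in polynomial time, a logical definition of the set of
strings in question.

*Definable languages.* The elements of a word `w` of length `N` are addressed by the positions
`0, …, N`. A list of *stages* defines relations on these positions, one after the other, each by
iterating a first-order definition `N + 1` times, starting from the empty relation. As the arities
are fixed, every such relation is a truth table of polynomial size, which is computed by a
structured program on boolean stacks (`StackProg.exec_runStages`), and such programs translate to
Turing machines with several stacks. So a language that is `Definable` can be decided in polynomial
time (`Definable.decidableInPolyTime`). Relations that are given by a recursion on a rank of at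
most `N` are definable by stages (`StageDefinable.of_recursion`); this covers the arithmetic of
positions, reachability, and the evaluation of formulas and circuits.

*Graphs without the minor.* If all edges of `X` are incident to one vertex, then `X` is a star with
additional isolated vertices, and `X` is a minor of `G` if and only if `G` contains a star whose
center is a connected set of vertices (`isMinorOf_iff_hasStar`). For fixed `X`, this is definable,
because only the boundedly many leaves have to be quantified. If `G` does not have `X` as a minor,
then all spheres of the distance from a vertex `r` have bounded size: otherwise the ball inside of a
large sphere could be contracted to the center of a star (`ncard_sphere_lt`). An edge connects
vertices of the same or of consecutive spheres. So a fixed point on the component of `r` can be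
found by a sweep over the spheres around `r`, which keeps only the restrictions of partial
solutions to three consecutive spheres (`IsPartialSolution`, `exists_forall_sat_iff`). These are
given by tuples of bounded length, hence the sweep is a definable recursion on the radius.

*Encodings.* For the strings that describe systems, all of this is carried out for an arbitrary
notation of functions, a `CodeScheme`, provided that it is definable which segments of the string
denote a function with a given value (`CodeScheme.HasDefinableCodes.decidableInPolyTime`). For
formulas, the latter is a recursion on the length of the segment
(`hasDefinableCodes_formulaScheme`), for circuits, one on the number of nodes
(`hasDefinableCodes_circuitScheme`). Both use that the notations are uniquely readable.
-/

/-! ### Structured programs on boolean stacks -/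

open Turing Function

/-- Structured programs that work on stacks of bits, named by `K`, and read an input over the
alphabet `Γ`, which is consumed from its front. -/
inductive StackProg (Γ K : Type) : Type
  /-- do nothing -/
  | skip : StackProg Γ K
  /-- push the bit `b` -/
  | push (k : K) (b : Bool) : StackProg Γ K
  /-- first `p`, then `q` -/
  | seq (p q : StackProg Γ K) : StackProg Γ K
  /-- pop a bit, and continue with `p` if it is `true`, with `q` if it is `false` -/
  | branch (k : K) (p q : StackProg Γ K) : StackProg Γ K
  /-- as long as the stack `k` is nonempty, pop a bit and do `p` or `q`, depending on it -/
  | loop (k : K) (p q : StackProg Γ K) : StackProg Γ K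
  /-- as long as there is input, take its first letter `a` and do `p a` -/
  | read (p : Γ → StackProg Γ K) : StackProg Γ K

namespace StackProg

variable {Γ K : Type}

section Semantics

variable [DecidableEq K]

/-- `Runs F p u s u' s' t`: started with remaining input `u` and stacks `s`, the program `p` stops
within `t` steps with remaining input `u'` and stacks `s'`. Only the contents of the stacks in `F`
are taken into account: by `congr`, those of all other stacks may change at will. -/
inductive Runs (F : Set K) : StackProg Γ K → List Γ → (K → List Bool) → List Γ →
    (K → List Bool) → ℕ → Prop
  | skip {u s} : Runs F skip u s u s 1
  | push {k b u s} : Runs F (push k b) u s u (update s k (b :: s k)) 1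
  | seq {p q u s u₁ s₁ u₂ s₂ t₁ t₂} : Runs F p u s u₁ s₁ t₁ → Runs F q u₁ s₁ u₂ s₂ t₂ →
      Runs F (seq p q) u s u₂ s₂ (t₁ + t₂)
  | branch {k p q u s b l u' s' t} : s k = b :: l →
      Runs F (bif b then p else q) u (update s k l) u' s' t →
      Runs F (branch k p q) u s u' s' (t + 1)
  | loop_nil {k p q u s} : s k = [] → Runs F (loop k p q) u s u s 1
  | loop_cons {k p q u s b l u₁ s₁ u₂ s₂ t₁ t₂} : s k = b :: l →
      Runs F (bif b then p else q) u (update s k l) u₁ s₁ t₁ →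
      Runs F (loop k p q) u₁ s₁ u₂ s₂ t₂ → Runs F (loop k p q) u s u₂ s₂ (t₁ + t₂ + 1)
  | read_nil {p s} : Runs F (read p) [] s [] s 1
  | read_cons {p a u s u₁ s₁ u₂ s₂ t₁ t₂} : Runs F (p a) u s u₁ s₁ t₁ →
      Runs F (read p) u₁ s₁ u₂ s₂ t₂ → Runs F (read p) (a :: u) s u₂ s₂ (t₁ + t₂ + 1)
  | weaken {p u s u' s' t t'} : Runs F p u s u' s' t → t ≤ t' → Runs F p u s u' s' t'
  | congr {p u s s₁ u' s' t} : Runs F p u s₁ u' s' t → (∀ k ∈ F, s k = s₁ k) → Runs F p u s u' s' t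

end Semantics

/-- The stacks that a program uses. -/
def used [DecidableEq K] [Fintype Γ] : StackProg Γ K → Finset K
  | skip => ∅
  | push k _ => {k}
  | seq p q => p.used ∪ q.used
  | branch k p q => {k} ∪ (p.used ∪ q.used)
  | loop k p q => {k} ∪ (p.used ∪ q.used)
  | read p => Finset.univ.biUnion fun a => (p a).used

/-! ### Translation to Turing machines with several stacks -/

/-- The labels of the machine code of a program. -/
def Lab : StackProg Γ K → Type
  | skip => Unit
  | push _ _ => Unit
  | seq p q => p.Lab ⊕ q.Lab
  | branch _ p q => Option (p.Lab ⊕ q.Lab)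
  | loop _ p q => Option (p.Lab ⊕ q.Lab)
  | read p => Option (Σ a, (p a).Lab)

/-- The label at which the machine code of a program starts. -/
def start : (p : StackProg Γ K) → p.Lab
  | skip => ()
  | push _ _ => ()
  | seq p _ => .inl p.start
  | branch _ _ _ => none
  | loop _ _ _ => none
  | read _ => none

theorem finite_lab [Finite Γ] (p : StackProg Γ K) : Finite p.Lab := by
  induction p with
  | skip => exact inferInstanceAs (Finite Unit)
  | push k b => exact inferInstanceAs (Finite Unit)
  | seq p q hp hq => exact inferInstanceAs (Finite (p.Lab ⊕ q.Lab))
  | branch k p q hp hq => exact inferInstanceAs (Finite (Option (p.Lab ⊕ q.Lab)))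
  | loop k p q hp hq => exact inferInstanceAs (Finite (Option (p.Lab ⊕ q.Lab)))
  | read p hp => exact inferInstanceAs (Finite (Option (Σ a, (p a).Lab)))

/-- The alphabets of the stacks of the machine: the input stack `none`, and the stacks in `F`. -/
def alphabet (Γ : Type) (F : Finset K) : Option F → Type
  | none => Γ
  | some _ => Bool

/-- The stacks of the machine for the input `u` and the stacks `s`. -/
def machineStacks (F : Finset K) (u : List Γ) (s : K → List Bool) : ∀ k, List (alphabet Γ F k)
  | none => u
  | some k => s k.1

variable [DecidableEq K]

theorem machineStacks_update (F : Finset K) (u : List Γ) (s : K → List Bool) (k : F)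
    (l : List Bool) : update (machineStacks F u s) (some k) l =
      machineStacks F u (update s k.1 l) := by
  funext k'
  rcases k' with _ | k'
  · exact update_of_ne (Option.some_ne_none k).symm _ _
  · by_cases h : k' = k
    · subst h
      exact (update_self (some k') _ _).trans (update_self (k' : K) l s).symm
    · have h₁ : some k' ≠ some k := fun h' => h (Option.some_injective _ h')
      have h₂ : (k' : K) ≠ k := fun h' => h (Subtype.ext h')
      refine (update_of_ne h₁ _ _).trans ?_
      change s k' = update s k l k'
      exact (update_of_ne h₂ l s).symm

theorem machineStacks_update_none (F : Finset K) (u u' : List Γ) (s : K → List Bool) :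
    update (machineStacks F u s) none u' = machineStacks F u' s := by
  funext k'
  rcases k' with _ | k'
  · exact update_self none _ _
  · exact update_of_ne (Option.some_ne_none k') _ _

/-- The internal state of the machine: the bit or the input letter that was popped last. -/
abbrev Register (Γ : Type) : Type := Option Bool × Option Γ

/-- A statement that pops a bit from the stack `k`, and jumps depending on the result. -/
def popStmt {Λ : Type} (F : Finset K) (k : K) (f : Option Bool → Λ) :
    TM2.Stmt (alphabet Γ F) Λ (Register Γ) :=
  if h : k ∈ F then
    .pop (some ⟨k, h⟩) (fun r o => (o, r.2)) (.goto fun r => f r.1)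
  else .goto fun _ => f none

/-- The label to jump to after the attempt to pop a bit. -/
def popTarget {Λ : Type} (next l₁ l₀ : Λ) : Option Bool → Λ
  | none => next
  | some true => l₁
  | some false => l₀

/-- The machine code of the program `p`, whose labels are included in those of the whole machine
by `emb`, and which leads to the label `next`. -/
def code {Λ : Type} (F : Finset K) : (p : StackProg Γ K) → (emb : p.Lab → Λ) → (next : Λ) →
    p.Lab → TM2.Stmt (alphabet Γ F) Λ (Register Γ)
  | skip, _, next, _ => .goto fun _ => next
  | push k b, _, next, _ =>
      if h : k ∈ F then .push (some ⟨k, h⟩) (fun _ => b) (.goto fun _ => next)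
      else .goto fun _ => next
  | seq p q, emb, next, l => match l with
      | .inl l => p.code F (fun l => emb (.inl l)) (emb (.inr q.start)) l
      | .inr l => q.code F (fun l => emb (.inr l)) next l
  | branch k p q, emb, next, l => match l with
      | none => popStmt F k
          (popTarget next (emb (some (.inl p.start))) (emb (some (.inr q.start))))
      | some (.inl l) => p.code F (fun l => emb (some (.inl l))) next l
      | some (.inr l) => q.code F (fun l => emb (some (.inr l))) next l
  | loop k p q, emb, next, l => match l with
      | none => popStmt F k
          (popTarget next (emb (some (.inl p.start))) (emb (some (.inr q.start))))
      | some (.inl l) => p.code F (fun l => emb (some (.inl l))) (emb none) l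
      | some (.inr l) => q.code F (fun l => emb (some (.inr l))) (emb none) l
  | read p, emb, next, l => match l with
      | none => .pop none (fun r o => (r.1, o)) (.goto fun r => match r.2 with
          | none => next
          | some a => emb (some ⟨a, (p a).start⟩))
      | some ⟨a, l⟩ => (p a).code F (fun l => emb (some ⟨a, l⟩)) (emb none) l

/-- `c` leads to `c'` in at most `t` steps of the machine `M`. -/
def ReachesIn {K Λ σ : Type} {G : K → Type} [DecidableEq K] (M : Λ → TM2.Stmt G Λ σ) (t : ℕ)
    (c c' : TM2.Cfg G Λ σ) : Prop :=
  ∃ n ≤ t, (flip bind (TM2.step M))^[n] (some c) = some c'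

section ReachesIn

variable {K Λ σ : Type} {G : K → Type} [DecidableEq K] {M : Λ → TM2.Stmt G Λ σ}

theorem ReachesIn.trans {t t' : ℕ} {c c' c'' : TM2.Cfg G Λ σ} (h : ReachesIn M t c c')
    (h' : ReachesIn M t' c' c'') : ReachesIn M (t + t') c c'' := by
  obtain ⟨n, hn, h⟩ := h
  obtain ⟨n', hn', h'⟩ := h'
  refine ⟨n' + n, by omega, ?_⟩
  rw [iterate_add_apply, h, h']

theorem ReachesIn.step {c c' : TM2.Cfg G Λ σ} (h : TM2.step M c = some c') :
    ReachesIn M 1 c c' :=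
  ⟨1, le_rfl, by simpa [flip] using h⟩

end ReachesIn

theorem step_popStmt {Λ : Type} {F : Finset K} {k : K} (hk : k ∈ F) {f : Option Bool → Λ}
    {M : Λ → TM2.Stmt (alphabet Γ F) Λ (Register Γ)} {l : Λ} (hl : M l = popStmt F k f)
    (r : Register Γ) (u : List Γ) (s : K → List Bool) :
    TM2.step M ⟨some l, r, machineStacks F u s⟩ =
      some ⟨some (f (s k).head?), ((s k).head?, r.2),
        machineStacks F u (update s k (s k).tail)⟩ := by
  simp only [TM2.step, hl, popStmt, dif_pos hk, TM2.stepAux]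
  have : machineStacks F u s (some ⟨k, hk⟩) = s k := rfl
  rw [← machineStacks_update F u s ⟨k, hk⟩]
  rfl

/-- The machine code of a program does what the program does. -/
theorem Runs.reachesIn {Λ : Type} [Fintype Γ] {F : Finset K}
    {M : Λ → TM2.Stmt (alphabet Γ F) Λ (Register Γ)}
    {p : StackProg Γ K} {u u' : List Γ} {s s' : K → List Bool} {t : ℕ}
    (h : Runs (F : Set K) p u s u' s' t) : p.used ⊆ F → ∀ (emb : p.Lab → Λ) (next : Λ),
      (∀ l, M (emb l) = p.code F emb next l) →
      ∀ r, ∃ r', ReachesIn M t ⟨some (emb p.start), r, machineStacks F u s⟩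
        ⟨some next, r', machineStacks F u' s'⟩ := by
  induction h with
  | skip =>
    intro _ emb next hM r
    refine ⟨r, .step ?_⟩
    simp [TM2.step, hM, code]
  | @push k b u s =>
    intro hF emb next hM r
    have hk : k ∈ F := by simpa [used] using hF
    refine ⟨r, .step ?_⟩
    simp only [TM2.step, hM, code, dif_pos hk, TM2.stepAux]
    have : machineStacks F u s (some ⟨k, hk⟩) = s k := rfl
    rw [← machineStacks_update F u s ⟨k, hk⟩]
    rfl
  | @seq p q _ _ _ _ _ _ _ _ _ _ ihp ihq =>
    intro hF emb next hM r
    simp only [used, Finset.union_subset_iff] at hF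
    obtain ⟨r₁, h₁⟩ := ihp hF.1 (fun l => emb (.inl l)) (emb (.inr q.start))
      (fun l => hM (.inl l)) r
    obtain ⟨r₂, h₂⟩ := ihq hF.2 (fun l => emb (.inr l)) next (fun l => hM (.inr l)) r₁
    exact ⟨r₂, h₁.trans h₂⟩
  | @branch k p q u s b l u' s' t hs _ ih =>
    intro hF emb next hM r
    simp only [used, Finset.union_subset_iff, Finset.singleton_subset_iff] at hF
    have h₁ := ReachesIn.step (step_popStmt (M := M) (l := emb none)
      (f := popTarget next (emb (some (.inl p.start))) (emb (some (.inr q.start)))) hF.1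
      (hM none) r u s)
    rw [hs] at h₁
    rw [Nat.add_comm]
    cases b with
    | true =>
      obtain ⟨r₂, h₂⟩ := ih hF.2.1 (fun l => emb (some (.inl l))) next
        (fun l => hM (some (.inl l))) (some true, r.2)
      exact ⟨r₂, h₁.trans h₂⟩
    | false =>
      obtain ⟨r₂, h₂⟩ := ih hF.2.2 (fun l => emb (some (.inr l))) next
        (fun l => hM (some (.inr l))) (some false, r.2)
      exact ⟨r₂, h₁.trans h₂⟩
  | @loop_nil k p q u s hs =>
    intro hF emb next hM r
    simp only [used, Finset.union_subset_iff, Finset.singleton_subset_iff] at hF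
    have h₁ := ReachesIn.step (step_popStmt (M := M) (l := emb none)
      (f := popTarget next (emb (some (.inl p.start))) (emb (some (.inr q.start)))) hF.1
      (hM none) r u s)
    have h₂ : update s k (s k).tail = s := by rw [hs, List.tail_nil, ← hs, update_eq_self]
    rw [h₂, hs] at h₁
    exact ⟨_, h₁⟩
  | @loop_cons k p q u s b l u₁ s₁ u₂ s₂ t₁ t₂ hs _ _ ih ih' =>
    intro hF emb next hM r
    have hF' := hF
    simp only [used, Finset.union_subset_iff, Finset.singleton_subset_iff] at hF
    have h₁ := ReachesIn.step (step_popStmt (M := M) (l := emb none)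
      (f := popTarget next (emb (some (.inl p.start))) (emb (some (.inr q.start)))) hF.1
      (hM none) r u s)
    rw [hs] at h₁
    rw [Nat.add_comm]
    cases b with
    | true =>
      obtain ⟨r₂, h₂⟩ := ih hF.2.1 (fun l => emb (some (.inl l))) (emb none)
        (fun l => hM (some (.inl l))) (some true, r.2)
      obtain ⟨r₃, h₃⟩ := ih' hF' emb next hM r₂
      exact ⟨r₃, h₁.trans (h₂.trans h₃)⟩
    | false =>
      obtain ⟨r₂, h₂⟩ := ih hF.2.2 (fun l => emb (some (.inr l))) (emb none)
        (fun l => hM (some (.inr l))) (some false, r.2)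
      obtain ⟨r₃, h₃⟩ := ih' hF' emb next hM r₂
      exact ⟨r₃, h₁.trans (h₂.trans h₃)⟩
  | @read_nil p s =>
    intro hF emb next hM r
    refine ⟨(r.1, none), .step ?_⟩
    have h₁ : M (emb (read p).start) = _ := hM none
    simp only [TM2.step, h₁, code, TM2.stepAux]
    have h₂ := machineStacks_update_none (Γ := Γ) F [] [] s
    exact congrArg (fun S => some (⟨some next, (r.1, none), S⟩ : TM2.Cfg _ _ _)) h₂
  | @read_cons p a u s u₁ s₁ u₂ s₂ t₁ t₂ _ _ ih ih' =>
    intro hF emb next hM r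
    have h₁ : ReachesIn M 1 ⟨some (emb (read p).start), r, machineStacks F (a :: u) s⟩
        ⟨some (emb (some ⟨a, (p a).start⟩)), (r.1, some a), machineStacks F u s⟩ := by
      refine .step ?_
      have h₁ : M (emb (read p).start) = _ := hM none
      simp only [TM2.step, h₁, code, TM2.stepAux]
      rw [← machineStacks_update_none F (a :: u) u s]
      rfl
    have hF' : (p a).used ⊆ F :=
      (Finset.subset_biUnion_of_mem (fun a => (p a).used) (Finset.mem_univ a)).trans hF
    obtain ⟨r₂, h₂⟩ := ih hF' (fun l => emb (some ⟨a, l⟩)) (emb none)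
      (fun l => hM (some ⟨a, l⟩)) (r.1, some a)
    obtain ⟨r₃, h₃⟩ := ih' hF emb next hM r₂
    rw [Nat.add_comm]
    exact ⟨r₃, h₁.trans (h₂.trans h₃)⟩
  | weaken _ h ih =>
    intro hF emb next hM r
    obtain ⟨r', n, hn, h'⟩ := ih hF emb next hM r
    exact ⟨r', n, hn.trans h, h'⟩
  | @congr p u s s₁ u' s' t _ h ih =>
    intro hF emb next hM r
    have h₁ : machineStacks F u s = machineStacks F u s₁ := by
      funext k
      rcases k with _ | k
      · rfl
      · exact h _ k.2
    rw [h₁]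
    exact ih hF emb next hM r

/-- A function is computable in polynomial time by a Turing machine with several stacks if it is
computed in polynomial time by a program. -/
theorem nonempty_tm2ComputableInPolyTime [Fintype Γ] (p : StackProg Γ K) (out : K)
    (hout : out ∈ p.used) (f : List Γ → Bool) (T : Polynomial ℕ)
    (h : ∀ w, ∃ s, Runs (p.used : Set K) p w (fun _ => []) [] s (T.eval w.length) ∧
      ∀ k ∈ p.used, s k = if k = out then [f w] else []) :
    Nonempty (TM2ComputableInPolyTime (id : List Γ → List Γ) Computability.encodeBool f) := by
  have := p.finite_lab
  have := Fintype.ofFinite p.Lab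
  let tm : FinTM2 :=
    { K := Option p.used
      k₀ := none
      k₁ := some ⟨out, hout⟩
      Γ := alphabet Γ p.used
      Λ := Option p.Lab
      main := some p.start
      σ := Register Γ
      initialState := (none, none)
      Γk₀Fin := inferInstanceAs (Fintype Γ)
      m := fun l => match l with
        -- The machine has to halt in its initial internal state.
        | none => .load (fun _ => (none, none)) .halt
        | some l => p.code p.used some none l }
  refine ⟨⟨⟨tm, Equiv.refl Γ, Equiv.refl Bool⟩, T + 1, fun w => ?_⟩⟩
  have hex : ∃ n ≤ T.eval w.length + 1, (flip bind tm.step)^[n]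
      (some (initList tm (List.map (Equiv.refl Γ).invFun w))) =
        some (haltList tm ((Computability.encodeBool (f w)).map (Equiv.refl Bool).invFun)) := by
    obtain ⟨s, hs, hs'⟩ := h w
    obtain ⟨r, hr⟩ := hs.reachesIn (M := tm.m) subset_rfl some none (fun _ => rfl) (none, none)
    have h₂ : ReachesIn tm.m 1 ⟨some none, r, machineStacks p.used [] s⟩
        ⟨none, (none, none), machineStacks p.used [] s⟩ := .step rfl
    obtain ⟨n, hn, h⟩ := hr.trans h₂
    refine ⟨n, hn, ?_⟩
    convert! h using 2
    · refine congrArg some ?_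
      refine congrArg (TM2.Cfg.mk (some (some p.start)) ((none, none) : Register Γ)) ?_
      funext k
      rcases k with _ | k
      · exact List.map_id w
      · rfl
    · refine congrArg (TM2.Cfg.mk (none : Option (Option p.Lab)) ((none, none) : Register Γ)) ?_
      funext k
      rcases k with _ | k
      · rfl
      · have h₁ := hs' k k.2
        by_cases hk : k = ⟨out, hout⟩
        · subst hk
          rw [if_pos rfl] at h₁
          refine Eq.trans ?_ h₁.symm
          exact dif_pos rfl
        · have hk' : (k : K) ≠ out := fun h => hk (Subtype.ext h)
          rw [if_neg hk'] at h₁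
          refine Eq.trans ?_ h₁.symm
          exact dif_neg fun h => hk (Option.some_injective _ h)
  exact ⟨⟨hex.choose, hex.choose_spec.2⟩, by simpa using hex.choose_spec.1⟩

end StackProg

/-! ### Programs that evaluate first-order formulas -/

/-- The names of the stacks of the programs below: for every variable `i`, a pair of stacks
`cntL i` and `cntR i` that hold its value `a` and the difference `N - a` to the maximal value in
unary; for every relation symbol `r`, a stack with its truth table; a stack of truth values
of subformulas; and auxiliary stacks. -/
inductive Stk : Type
  | cntL (i : ℕ)
  | cntR (i : ℕ)
  | tab (r : ℕ)
  | bits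
  | aux
  | idx
  | tmp
  | emit
  | out
  deriving DecidableEq

/-- The contents of the stacks apart from the counters. -/
structure Mem where
  tab : ℕ → List Bool
  bits : List Bool
  aux : List Bool
  idx : List Bool
  emit : List Bool

/-- The stacks when the maximal value of the variables is `N`, the variables have the values `l`
(and all further variables the value `0`), and the other stacks are as given by `m`. -/
def Mem.stacks (N : ℕ) (l : List ℕ) (m : Mem) : Stk → List Bool
  | .cntL i => List.replicate (l.getD i 0) true
  | .cntR i => List.replicate (N - l.getD i 0) true
  | .tab r => m.tab r
  | .bits => m.bits
  | .aux => m.aux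
  | .idx => m.idx
  | .tmp => []
  | .emit => m.emit
  | .out => []

namespace StackProg

section General

variable {Γ K : Type} [DecidableEq K] {F : Set K} {u : List Γ}

theorem Runs.push' {k : K} {b : Bool} {s s' : K → List Bool} (h : update s k (b :: s k) = s') :
    Runs F (StackProg.push k b) u s u s' 1 :=
  h ▸ .push

theorem Runs.branch' {k : K} {b : Bool} {l : List Bool} {p q : StackProg Γ K}
    {s s₁ s' : K → List Bool} {t : ℕ}
    (hs : s k = b :: l) (hs₁ : update s k l = s₁) (h : Runs F (bif b then p else q) u s₁ u s' t) :
    Runs F (StackProg.branch k p q) u s u s' (t + 1) :=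
  .branch hs (hs₁ ▸ h)

/-- A loop controlled by a stack with a number in unary. -/
theorem Runs.count {k : K} {p q : StackProg Γ K} (n t : ℕ) (st : ℕ → K → List Bool)
    (hk : ∀ i ≤ n, st i k = List.replicate (n - i) true)
    (h : ∀ i < n, Runs F p u (update (st i) k (List.replicate (n - (i + 1)) true)) u
      (st (i + 1)) t) :
    Runs F (loop k p q) u (st 0) u (st n) (n * (t + 1) + 1) := by
  suffices H : ∀ j i, i + j = n → Runs F (loop k p q) u (st i) u (st n) (j * (t + 1) + 1) from
    H n 0 (Nat.zero_add n)
  intro j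
  induction j with
  | zero =>
    intro i hi
    obtain rfl : i = n := hi
    have h₁ := hk i le_rfl
    rw [Nat.sub_self] at h₁
    exact (Runs.loop_nil h₁).weaken (by omega)
  | succ j ih =>
    intro i hi
    have h₁ := hk i (by omega)
    rw [show n - i = (n - (i + 1)) + 1 by omega, List.replicate_succ] at h₁
    exact (Runs.loop_cons h₁ (h i (by omega)) (ih (i + 1) (by omega))).weaken
      (by rw [Nat.succ_mul]; omega)

/-- Move the contents of the stack `k` to the stack `k'`, which reverses its order. -/
def move (k k' : K) : StackProg Γ K :=
  loop k (push k' true) (push k' false)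

theorem runs_move {k k' : K} (hk : k ≠ k') {s s' : K → List Bool}
    (h : update (update s k []) k' ((s k).reverse ++ s k') = s') :
    Runs F (move k k') u s u s' (2 * (s k).length + 1) := by
  subst h
  generalize hl : s k = l
  induction l generalizing s with
  | nil =>
    have : update (update s k []) k' (([] : List Bool).reverse ++ s k') = s := by
      rw [← hl, update_eq_self, hl]; simp
    rw [this]
    exact .loop_nil hl
  | cons b l ih =>
    have h₁ : Runs F (bif b then push k' true else push k' false) u (update s k l) u
        (update (update s k l) k' (b :: s k')) 1 := by
      cases b
      · exact .push' (by simp [update_of_ne hk.symm])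
      · exact .push' (by simp [update_of_ne hk.symm])
    have h₂ := ih (s := update (update s k l) k' (b :: s k')) (by simp [update_of_ne hk])
    have h₃ : update (update (update (update s k l) k' (b :: s k')) k []) k'
        (l.reverse ++ update (update s k l) k' (b :: s k') k') =
        update (update s k []) k' ((b :: l).reverse ++ s k') := by
      funext x
      by_cases hx : x = k'
      · subst hx; simp
      · by_cases hx' : x = k
        · subst hx'; simp [hx]
        · simp [hx, hx']
    rw [h₃] at h₂
    exact (Runs.loop_cons hl h₁ h₂).weaken (by simp only [List.length_cons]; omega)

/-- Clear the stack `k`. -/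
def clear (k : K) : StackProg Γ K :=
  loop k skip skip

theorem runs_clear {k : K} {s s' : K → List Bool} (h : update s k [] = s') :
    Runs F (clear k) u s u s' (2 * (s k).length + 1) := by
  subst h
  generalize hl : s k = l
  induction l generalizing s with
  | nil =>
    rw [← hl, update_eq_self, hl]
    exact .loop_nil hl
  | cons b l ih =>
    have h₂ := ih (s := update s k l) (by simp)
    rw [update_idem] at h₂
    exact (Runs.loop_cons hl (by cases b <;> exact .skip) h₂).weaken
      (by simp only [List.length_cons]; omega)

end General

variable {Γ : Type} {F : Set Stk} {N : ℕ} {l : List ℕ} {m m' : Mem} {t : ℕ}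

/-- The program `p` turns the stacks given by `m` into those given by `m'`, when the variables
have the values `l`. -/
abbrev Exec (F : Set Stk) (N : ℕ) (p : StackProg Γ Stk) (l : List ℕ) (m m' : Mem) (t : ℕ) : Prop :=
  Runs F p [] (m.stacks N l) [] (m'.stacks N l) t

theorem update_bits (b : List Bool) :
    update (m.stacks N l) .bits b = Mem.stacks N l { m with bits := b } := by
  funext k; cases k <;> simp [Mem.stacks]

theorem update_aux (b : List Bool) :
    update (m.stacks N l) .aux b = Mem.stacks N l { m with aux := b } := by
  funext k; cases k <;> simp [Mem.stacks]

theorem update_idx (b : List Bool) :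
    update (m.stacks N l) .idx b = Mem.stacks N l { m with idx := b } := by
  funext k; cases k <;> simp [Mem.stacks]

theorem update_emit (b : List Bool) :
    update (m.stacks N l) .emit b = Mem.stacks N l { m with emit := b } := by
  funext k; cases k <;> simp [Mem.stacks]

theorem update_tab (r : ℕ) (b : List Bool) :
    update (m.stacks N l) (.tab r) b = Mem.stacks N l { m with tab := update m.tab r b } := by
  funext k; cases k with
  | tab r' => by_cases h : r' = r <;> simp [Mem.stacks, h]
  | _ => simp [Mem.stacks]

theorem exec_push_bits (b : Bool) :
    Exec F N (push .bits b : StackProg Γ Stk) l m { m with bits := b :: m.bits } 1 :=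
  .push' (update_bits _)

theorem exec_push_aux (b : Bool) :
    Exec F N (push .aux b : StackProg Γ Stk) l m { m with aux := b :: m.aux } 1 :=
  .push' (update_aux _)

theorem exec_push_emit (b : Bool) :
    Exec F N (push .emit b : StackProg Γ Stk) l m { m with emit := b :: m.emit } 1 :=
  .push' (update_emit _)

theorem exec_push_tab (r : ℕ) (b : Bool) :
    Exec F N (push (.tab r) b : StackProg Γ Stk) l m
      { m with tab := update m.tab r (b :: m.tab r) } 1 :=
  .push' (update_tab _ _)

/-- The stacks after a change of the value of the last variable. -/
theorem stacks_append (N : ℕ) (l : List ℕ) (m : Mem) (a b : ℕ) :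
    m.stacks N (l ++ [b]) = update (update (m.stacks N (l ++ [a])) (.cntL l.length)
      (List.replicate b true)) (.cntR l.length) (List.replicate (N - b) true) := by
  funext k
  cases k with
  | cntL i =>
    by_cases h : i = l.length
    · subst h; simp [Mem.stacks]
    · simp only [ne_eq, reduceCtorEq, not_false_eq_true, update_of_ne, Stk.cntL.injEq, h,
        Mem.stacks]
      rcases lt_or_gt_of_ne h with h | h
      · simp [List.getElem?_append_left h]
      · simp [List.getElem?_eq_none (show (l ++ [a]).length ≤ i by simp; omega),
          List.getElem?_eq_none (show (l ++ [b]).length ≤ i by simp; omega)]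
  | cntR i =>
    by_cases h : i = l.length
    · subst h; simp [Mem.stacks]
    · simp only [ne_eq, reduceCtorEq, not_false_eq_true, update_of_ne, Stk.cntR.injEq, h,
        Mem.stacks]
      rcases lt_or_gt_of_ne h with h | h
      · simp [List.getElem?_append_left h]
      · simp [List.getElem?_eq_none (show (l ++ [a]).length ≤ i by simp; omega),
          List.getElem?_eq_none (show (l ++ [b]).length ≤ i by simp; omega)]
  | _ => simp [Mem.stacks]

theorem stacks_append_zero (N : ℕ) (l : List ℕ) (m : Mem) :
    m.stacks N (l ++ [0]) = m.stacks N l := by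
  have : ∀ i, (l ++ [0]).getD i 0 = l.getD i 0 := by
    intro i
    rcases lt_trichotomy i l.length with h | h | h
    · simp [List.getElem?_append_left h]
    · subst h; simp
    · simp [List.getElem?_eq_none (show (l ++ [0]).length ≤ i by simp; omega),
        List.getElem?_eq_none (show l.length ≤ i by omega)]
  funext k
  cases k <;> simp only [Mem.stacks, this]

/-- Do `p` for all values from `0` to `N` of the variable `d`. The program does not need to know
`N`: it counts until the difference on the stack `cntR d` is used up, and resets the counter
afterwards. -/
def forAll (d : ℕ) (p : StackProg Γ Stk) : StackProg Γ Stk :=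
  seq p (seq (loop (.cntR d) (seq (push (.cntL d) true) p) skip)
    (loop (.cntL d) (push (.cntR d) true) skip))

theorem exec_forAll {d : ℕ} {p : StackProg Γ Stk} (hd : l.length = d) (Y : ℕ → Mem)
    (h : ∀ a ≤ N, Exec F N p (l ++ [a]) (Y a) (Y (a + 1)) t) :
    Exec F N (forAll d p) l (Y 0) (Y (N + 1)) ((N + 1) * (t + 4) + 2) := by
  subst hd
  have h₀ := h 0 (Nat.zero_le _)
  have h₁ : Runs F (loop (.cntR l.length) (seq (push (.cntL l.length) true) p) skip)
      [] ((Y 1).stacks N (l ++ [0])) [] ((Y (N + 1)).stacks N (l ++ [N]))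
      (N * (1 + t + 1) + 1) := by
    refine Runs.count N (1 + t) (fun i => (Y (i + 1)).stacks N (l ++ [i])) ?_ ?_
    · intro i _
      simp [Mem.stacks]
    · intro i hi
      refine .seq (.push' ?_) (h (i + 1) hi)
      rw [stacks_append N l _ i (i + 1)]
      rw [update_comm (by simp), show N - (i + 1) = N - i - 1 by omega]
      simp [Mem.stacks, List.replicate_succ, Nat.sub_sub]
  have h₂ : Runs F (loop (.cntL l.length) (push (.cntR l.length) true) skip : StackProg Γ Stk)
      [] ((Y (N + 1)).stacks N (l ++ [N - 0])) [] ((Y (N + 1)).stacks N (l ++ [N - N]))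
      (N * (1 + 1) + 1) := by
    refine Runs.count N 1 (fun i => (Y (N + 1)).stacks N (l ++ [N - i])) ?_ ?_
    · intro i _
      simp [Mem.stacks]
    · intro i hi
      refine .push' ?_
      rw [stacks_append N l _ (N - i) (N - (i + 1))]
      simp only [ne_eq, reduceCtorEq, not_false_eq_true, update_of_ne]
      congr 1
      simp only [Mem.stacks]
      rw [show N - (N - (i + 1)) = (N - (N - i)) + 1 by omega]
      simp [List.replicate_succ]
  rw [Nat.sub_zero, Nat.sub_self, stacks_append_zero] at h₂
  simp only [Exec, stacks_append_zero] at h₀ h₁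
  exact (h₀.seq (h₁.seq h₂)).weaken (by ring_nf; omega)

/-! ### Truth tables -/

/-- The truth table of a relation on `{0, …, N}` with `k` arguments, in lexicographic order. -/
def truthTable (N : ℕ) : (k : ℕ) → (List ℕ → Bool) → List Bool
  | 0, R => [R []]
  | k + 1, R => (List.range (N + 1)).flatMap fun x => truthTable N k fun l => R (x :: l)

theorem length_truthTable (N k : ℕ) (R : List ℕ → Bool) :
    (truthTable N k R).length = (N + 1) ^ k := by
  induction k generalizing R with
  | zero => simp [truthTable]
  | succ k ih => simp [truthTable, List.length_flatMap, ih, pow_succ, mul_comm]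

/-- Move `(N + 1) ^ j` bits from the truth table `r` to the stack `aux`; the variables from `d` on
serve as loop counters. -/
def movePow (r : ℕ) : (d j : ℕ) → StackProg Γ Stk
  | _, 0 => branch (.tab r) (push .aux true) (push .aux false)
  | d, j + 1 => forAll d (movePow r (d + 1) j)

theorem exec_movePow (r j : ℕ) : ∃ T : Polynomial ℕ, ∀ (N : ℕ) (l : List ℕ) (m : Mem)
    (l₁ l₂ : List Bool), m.tab r = l₁ ++ l₂ → l₁.length = (N + 1) ^ j →
    Exec F N (movePow r l.length j : StackProg Γ Stk) l m
      { m with tab := update m.tab r l₂, aux := l₁.reverse ++ m.aux } (T.eval N) := by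
  induction j with
  | zero =>
    refine ⟨2, fun N l m l₁ l₂ h h₁ => ?_⟩
    obtain ⟨b, rfl⟩ := List.length_eq_one_iff.1 (by simpa using h₁)
    refine Runs.weaken (t := 1 + 1) (.branch' (b := b) (l := l₂) (by simpa [Mem.stacks] using h)
      (update_tab r l₂) ?_) (by simp)
    cases b
    · exact exec_push_aux false
    · exact exec_push_aux true
  | succ j ih =>
    obtain ⟨T, hT⟩ := ih
    refine ⟨(Polynomial.X + 1) * (T + 4) + 2, fun N l m l₁ l₂ h h₁ => ?_⟩
    let P := (N + 1) ^ j
    let Y : ℕ → Mem := fun a =>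
      { m with tab := update m.tab r (l₁.drop (a * P) ++ l₂),
               aux := (l₁.take (a * P)).reverse ++ m.aux }
    have := exec_forAll (F := F) (N := N) (l := l) (p := (movePow r (l.length + 1) j :
      StackProg Γ Stk)) (t := T.eval N) rfl Y ?_
    · simp only [Y, zero_mul, List.drop_zero, List.take_zero, List.reverse_nil, List.nil_append,
        ← h, update_eq_self] at this
      have h₂ : (N + 1) * P = l₁.length := by rw [h₁, pow_succ, mul_comm]
      rw [h₂, List.drop_length, List.take_length, List.nil_append] at this
      simpa [movePow] using this
    · intro a ha
      have h₂ : a * P + P ≤ l₁.length := by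
        rw [h₁, pow_succ, mul_comm _ (N + 1), ← Nat.succ_mul]
        exact Nat.mul_le_mul_right _ (by omega)
      have h₃ := hT N (l ++ [a]) (Y a)
        ((l₁.drop (a * P)).take P) (l₁.drop ((a + 1) * P) ++ l₂) ?_ ?_
      · simp only [List.length_append, List.length_singleton] at h₃
        have e : Y (a + 1) = { Y a with
            tab := update (Y a).tab r (l₁.drop ((a + 1) * P) ++ l₂)
            aux := ((l₁.drop (a * P)).take P).reverse ++ (Y a).aux } := by
          simp only [Y, update_idem]
          rw [Nat.succ_mul, List.take_add]
          simp
        rw [e]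
        exact h₃
      · simp only [Y, update_self]
        rw [← List.append_assoc, Nat.succ_mul, ← List.drop_drop, List.take_append_drop]
      · rw [List.length_take, List.length_drop]
        omega

/-- Push the value of the variable `x` in unary onto the stack `idx`. -/
def copyCount (x : ℕ) : StackProg Γ Stk :=
  seq (loop (.cntL x) (seq (push .idx true) (push .tmp true)) skip)
    (loop .tmp (push (.cntL x) true) skip)

theorem exec_copyCount (x : ℕ) : Exec F N (copyCount x : StackProg Γ Stk) l m
      { m with idx := List.replicate (l.getD x 0) true ++ m.idx } (l.getD x 0 * 5 + 2) := by
  generalize ha : l.getD x 0 = a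
  let st : ℕ → Stk → List Bool := fun i =>
    update (update (Mem.stacks N l { m with idx := List.replicate i true ++ m.idx }) .tmp
      (List.replicate i true)) (.cntL x) (List.replicate (a - i) true)
  let st' : ℕ → Stk → List Bool := fun i => update (update
      (Mem.stacks N l { m with idx := List.replicate a true ++ m.idx }) .tmp
      (List.replicate (a - i) true)) (.cntL x) (List.replicate i true)
  have h₁ : Runs F (loop (.cntL x) (seq (push .idx true) (push .tmp true)) skip :
      StackProg Γ Stk) [] (st 0) [] (st a) (a * (2 + 1) + 1) := by
    refine Runs.count a 2 st (by intro i _; simp [st]) fun i hi => ?_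
    refine Runs.seq (t₁ := 1) (t₂ := 1) .push (.push' ?_)
    funext k
    cases k with
    | cntL i' => by_cases h : i' = x <;> simp [st, Mem.stacks, h]
    | _ => simp [st, Mem.stacks, List.replicate_succ]
  have h₂ : Runs F (loop .tmp (push (.cntL x) true) skip :
      StackProg Γ Stk) [] (st' 0) [] (st' a) (a * (1 + 1) + 1) := by
    refine Runs.count a 1 st' (by intro i _; simp [st']) fun i hi => ?_
    refine .push' ?_
    funext k
    cases k with
    | cntL i' => by_cases h : i' = x <;> simp [st', Mem.stacks, h, List.replicate_succ]
    | _ => simp [st', Mem.stacks]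
  have h₃ : st 0 = m.stacks N l := by
    funext k
    cases k with
    | cntL i' => by_cases h : i' = x <;> simp [st, Mem.stacks, h, ← ha]
    | _ => simp [st, Mem.stacks]
  have h₄ : st a = st' 0 := by simp [st, st']
  have h₅ : st' a = Mem.stacks N l { m with idx := List.replicate a true ++ m.idx } := by
    funext k
    cases k with
    | cntL i' => by_cases h : i' = x <;> simp [st', Mem.stacks, h, ← ha]
    | _ => simp [st', Mem.stacks]
  rw [h₃, h₄] at h₁
  rw [h₅] at h₂
  exact (h₁.seq h₂).weaken (by ring_nf; omega)

/-- Go to the entry of the truth table `r` for the values of the variables `xs`, by moving all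
entries before it to the stack `aux`: for a value `a` of the first variable, `a` blocks are skipped,
each of which is a truth table for the remaining variables. -/
def seek (r d : ℕ) : List ℕ → StackProg Γ Stk
  | [] => skip
  | x :: xs => seq (copyCount x) (seq (loop .idx (movePow r d xs.length) skip) (seek r d xs))

theorem exec_seek (r : ℕ) (xs : List ℕ) : ∃ T : Polynomial ℕ, ∀ (N : ℕ) (l : List ℕ) (m : Mem)
    (R : List ℕ → Bool) (rest : List Bool), m.tab r = truthTable N xs.length R ++ rest →
    m.idx = [] → (∀ a ∈ l, a ≤ N) →
    ∃ pre post, m.tab r = pre ++ R (xs.map fun x => l.getD x 0) :: post ∧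
    Exec F N (seek r l.length xs : StackProg Γ Stk) l m
      { m with tab := update m.tab r (R (xs.map fun x => l.getD x 0) :: post),
               aux := pre.reverse ++ m.aux } (T.eval N) := by
  induction xs with
  | nil =>
    refine ⟨1, fun N l m R rest h hidx hl => ⟨[], rest, by simpa [truthTable] using h, ?_⟩⟩
    simp only [truthTable, List.length_nil, List.cons_append, List.nil_append] at h
    simp only [List.map_nil, ← h, update_eq_self, List.reverse_nil, List.nil_append,
      Polynomial.eval_one]
    exact .skip
  | cons x xs ih =>
    obtain ⟨T, hT⟩ := ih
    obtain ⟨T', hT'⟩ := exec_movePow (F := F) (Γ := Γ) r xs.length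
    refine ⟨(5 * Polynomial.X + 2) + (Polynomial.X * (T' + 1) + 1 + T), ?_⟩
    intro N l m R rest h hidx hl
    set a := l.getD x 0 with ha
    have haN : a ≤ N := by
      rw [ha, List.getD_eq_getElem?_getD]
      rcases Nat.lt_or_ge x l.length with hx | hx
      · simpa [hx] using hl _ (List.getElem_mem hx)
      · simp [hx]
    let tt : ℕ → List Bool := fun x => truthTable N xs.length fun l => R (x :: l)
    have hlen : ∀ i, ((List.range i).flatMap tt).length = i * (N + 1) ^ xs.length := by
      intro i
      simp [List.length_flatMap, tt, length_truthTable]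
    -- The part of the truth table from block `i` on.
    let tail : ℕ → List Bool := fun i => (m.tab r).drop (i * (N + 1) ^ xs.length)
    have htail : ∀ i ≤ N, tail i = tt i ++ tail (i + 1) := by
      intro i hi
      have h₁ : m.tab r = (List.range i).flatMap tt ++ (tt i ++
          (((List.range (N - i)).map (· + (i + 1))).flatMap tt ++ rest)) := by
        rw [h]
        have h₂ : List.range (N + 1) =
            List.range i ++ (i :: (List.range (N - i)).map (· + (i + 1))) := by
          have := List.range_add (n := i) (m := N - i + 1)
          rw [show i + (N - i + 1) = N + 1 by omega] at this
          rw [this, List.range_succ_eq_map]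
          simp only [List.map_cons, List.map_map, add_zero]
          congr 3
          funext x
          simp only [comp_apply]
          omega
        simp only [List.length_cons, truthTable]
        rw [h₂, List.flatMap_append, List.flatMap_cons]
        simp [tt]
      have h₃ : tail i = tt i ++
          (((List.range (N - i)).map (· + (i + 1))).flatMap tt ++ rest) := by
        simp only [tail]
        rw [h₁, ← hlen i, List.drop_left]
      have h₄ : (tt i).length = (N + 1) ^ xs.length := length_truthTable _ _ _
      have h₅ : tail (i + 1) = (tail i).drop ((N + 1) ^ xs.length) := by
        simp only [tail]
        rw [List.drop_drop, Nat.succ_mul]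
      rw [h₅]
      rw [h₃, ← h₄, List.drop_left]
    have hbd : ∀ i ≤ N, (i + 1) * (N + 1) ^ xs.length ≤ (m.tab r).length := by
      intro i hi
      rw [h, List.length_append, length_truthTable, List.length_cons, pow_succ, mul_comm _ (N + 1)]
      exact (Nat.mul_le_mul_right _ (by omega)).trans (Nat.le_add_right _ _)
    let Y : ℕ → Mem := fun i =>
      { m with idx := List.replicate (a - i) true,
               tab := update m.tab r (tail i),
               aux := ((m.tab r).take (i * (N + 1) ^ xs.length)).reverse ++ m.aux }
    have h₁ : Exec F N (copyCount x : StackProg Γ Stk) l m (Y 0) (a * 5 + 2) := by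
      have := exec_copyCount (Γ := Γ) (F := F) (N := N) (l := l) (m := m) x
      rw [← ha, hidx, List.append_nil] at this
      simpa [Y, tail] using this
    have h₂ : Exec F N (loop .idx (movePow r l.length xs.length) skip : StackProg Γ Stk) l
        (Y 0) (Y a) (a * (T'.eval N + 1) + 1) := by
      refine Runs.count a (T'.eval N) (fun i => (Y i).stacks N l)
        (by intro i _; simp [Y, Mem.stacks]) fun i hi => ?_
      simp only [update_idx]
      have := hT' N l { (Y i) with idx := List.replicate (a - (i + 1)) true } (tt i) (tail (i + 1))
        (by simp [Y, htail i (by omega)]) (length_truthTable _ _ _)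
      have e : Y (i + 1) = { Y i with
          idx := List.replicate (a - (i + 1)) true
          tab := update (Y i).tab r (tail (i + 1))
          aux := (tt i).reverse ++ (Y i).aux } := by
        have : List.take ((N + 1) ^ xs.length) (tail i) = tt i := by
          rw [htail i (by omega), ← length_truthTable N xs.length (fun l => R (i :: l)),
            List.take_left]
        simp only [tail] at this
        simp only [Y, update_idem]
        rw [Nat.succ_mul, List.take_add, this]
        simp
      rw [e]
      exact this
    obtain ⟨pre, post, h₃, h₄⟩ := hT N l (Y a) (fun l => R (a :: l)) (tail (a + 1))
      (by simp [Y, htail a haN, tt]) (by simp [Y]) hl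
    refine ⟨(m.tab r).take (a * (N + 1) ^ xs.length) ++ pre, post, ?_, ?_⟩
    · simp only [Y, update_self] at h₃
      rw [List.append_assoc, List.map_cons, ← ha, ← h₃]
      simp only [tail]
      rw [List.take_append_drop]
    · have h₅ := (h₁.seq (h₂.seq h₄))
      refine Runs.weaken (t := _) ?_ (?_ : a * 5 + 2 + (a * (T'.eval N + 1) + 1 + T.eval N) ≤ _)
      · rw [List.map_cons, ← ha]
        have e : ({ Y a with
            tab := update (Y a).tab r (R (a :: xs.map fun x => l.getD x 0) :: post)
            aux := pre.reverse ++ (Y a).aux } : Mem) = { m with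
            tab := update m.tab r (R (a :: xs.map fun x => l.getD x 0) :: post)
            aux := ((m.tab r).take (a * (N + 1) ^ xs.length) ++ pre).reverse ++ m.aux } := by
          simp [Y, hidx]
        rw [e] at h₅
        exact h₅
      · simp only [Polynomial.eval_add, Polynomial.eval_mul, Polynomial.eval_X,
          Polynomial.eval_one, Polynomial.eval_ofNat]
        gcongr ?_ + 2 + (?_ + 1 + _)
        · omega
        · exact Nat.mul_le_mul_right _ haN

/-- Push the truth value of the relation `r` for the values of the variables `xs` onto the stack
`bits`. -/
def lookup (r d : ℕ) (xs : List ℕ) : StackProg Γ Stk :=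
  seq (seek r d xs) (seq (branch (.tab r) (seq (push .bits true) (push (.tab r) true))
    (seq (push .bits false) (push (.tab r) false))) (move .aux (.tab r)))

theorem exec_lookup (r : ℕ) (xs : List ℕ) : ∃ T : Polynomial ℕ, ∀ (N : ℕ) (l : List ℕ) (m : Mem)
    (R : List ℕ → Bool), m.tab r = truthTable N xs.length R → m.idx = [] → m.aux = [] →
    (∀ a ∈ l, a ≤ N) →
    Exec F N (lookup r l.length xs : StackProg Γ Stk) l m
      { m with bits := R (xs.map fun x => l.getD x 0) :: m.bits } (T.eval N) := by
  obtain ⟨T, hT⟩ := exec_seek (Γ := Γ) (F := F) r xs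
  refine ⟨T + (3 + (2 * (Polynomial.X + 1) ^ xs.length + 1)), ?_⟩
  intro N l m R h hidx haux hl
  obtain ⟨pre, post, h₁, h₂⟩ := hT N l m R [] (by simpa using h) hidx hl
  generalize R (xs.map fun x => l.getD x 0) = b at h₁ h₂ ⊢
  rw [haux, List.append_nil] at h₂
  have h₃ : Exec F N (branch (.tab r) (seq (push .bits true) (push (.tab r) true))
      (seq (push .bits false) (push (.tab r) false)) : StackProg Γ Stk) l
      { m with tab := update m.tab r (b :: post), aux := pre.reverse }
      { m with tab := update m.tab r (b :: post), aux := pre.reverse, bits := b :: m.bits } 3 := by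
    refine Runs.branch' (b := b) (l := post) (by simp [Mem.stacks]) (update_tab _ _) ?_
    have h₄ := (exec_push_bits (Γ := Γ) (F := F) (N := N) (l := l)
      (m := { m with tab := update m.tab r post, aux := pre.reverse }) b).seq
        (exec_push_tab r b)
    simp only [update_self, update_idem] at h₄ ⊢
    cases b
    · exact h₄
    · exact h₄
  have h₄ : Exec F N (move .aux (.tab r) : StackProg Γ Stk) l
      { m with tab := update m.tab r (b :: post), aux := pre.reverse, bits := b :: m.bits }
      { m with bits := b :: m.bits } (2 * pre.length + 1) := by
    have := runs_move (Γ := Γ) (F := F) (u := []) (k := .aux) (k' := .tab r) (by simp)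
      (s := Mem.stacks N l { m with tab := update m.tab r (b :: post), aux := pre.reverse,
                                    bits := b :: m.bits })
      (s' := Mem.stacks N l { m with bits := b :: m.bits }) (by
        rw [update_aux, update_tab]
        simp only [Mem.stacks, List.reverse_reverse, update_self, update_idem]
        rw [← h₁, update_eq_self, ← haux])
    simpa [Mem.stacks] using this
  refine (h₂.seq (h₃.seq h₄)).weaken ?_
  have h₅ : pre.length ≤ (N + 1) ^ xs.length := by
    rw [← length_truthTable N xs.length R, ← h, h₁]
    simp
  simp only [Polynomial.eval_add, Polynomial.eval_mul, Polynomial.eval_X, Polynomial.eval_pow,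
          Polynomial.eval_one, Polynomial.eval_ofNat]
  gcongr
end StackProg

/-! ### First-order formulas -/

/-- First-order formulas whose atoms are given relations `rel r`, and one further relation `orc`
(the *oracle*). Variables are numbered by the depth of their quantifiers, so that `ex` binds the
variable `d` in the scope of the variables `0, …, d - 1`. -/
inductive Fml : Type
  | tt
  | rel (r : ℕ) (args : List ℕ)
  | orc (args : List ℕ)
  | nand (φ ψ : Fml)
  | ex (φ : Fml)

namespace Fml

/-- The truth value of a formula over the domain `{0, …, N}` for the values `l` of the variables,
with the relations `ρ` and the oracle `A`. -/
def eval (N : ℕ) (ρ : List (List ℕ → Bool)) (A : List ℕ → Bool) : Fml → List ℕ → Bool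
  | tt, _ => true
  | rel r args, l => ρ.getD r (fun _ => false) (args.map fun x => l.getD x 0)
  | orc args, l => A (args.map fun x => l.getD x 0)
  | nand φ ψ, l => !(φ.eval N ρ A l && ψ.eval N ρ A l)
  | ex φ, l => (List.range (N + 1)).any fun x => φ.eval N ρ A (l ++ [x])

/-- All atoms of a formula in the scope of `d` variables use the relations with the arities `ars`
and an oracle of arity `o` properly. -/
def WF (ars : List ℕ) (o : ℕ) : Fml → ℕ → Prop
  | tt, _ => True
  | rel r args, d => ars[r]? = some args.length ∧ ∀ x ∈ args, x < d
  | orc args, d => args.length = o ∧ ∀ x ∈ args, x < d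
  | nand φ ψ, d => φ.WF ars o d ∧ ψ.WF ars o d
  | ex φ, d => φ.WF ars o (d + 1)

end Fml

namespace StackProg

variable {Γ : Type} {F : Set Stk}

/-- The program that pushes the truth value of a formula with `d` variables onto the stack `bits`.
The truth table of the oracle is on the stack `tab j`. The counter `0` is left aside, and the
counter `i + 1` holds the variable `i`. -/
def evalFml (j : ℕ) : Fml → ℕ → StackProg Γ Stk
  | .tt, _ => push .bits true
  | .rel r args, d => lookup r (d + 1) (args.map (· + 1))
  | .orc args, d => lookup j (d + 1) (args.map (· + 1))
  | .nand φ ψ, d => seq (evalFml j φ d) (seq (evalFml j ψ d)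
      (branch .bits (branch .bits (push .bits false) (push .bits true))
        (branch .bits (push .bits true) (push .bits true))))
  | .ex φ, d => seq (push .bits false) (forAll (d + 1) (seq (evalFml j φ (d + 1))
      (branch .bits (branch .bits (push .bits true) (push .bits true)) skip)))

/-- The stacks of `m` hold the truth tables of the relations `ρ` with the arities `ars`. -/
def Holds (N : ℕ) (ars : List ℕ) (ρ : List (List ℕ → Bool)) (m : Mem) : Prop :=
  ∀ r k, ars[r]? = some k → m.tab r = truthTable N k (ρ.getD r fun _ => false)

theorem exec_branch_bits {N : ℕ} {l : List ℕ} {m m' : Mem} {t : ℕ} {b : Bool} {bs : List Bool}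
    {p q : StackProg Γ Stk}
    (h : Exec F N (bif b then p else q) l { m with bits := bs } m' t) :
    Exec F N (branch .bits p q) l { m with bits := b :: bs } m' (t + 1) :=
  .branch' (b := b) (l := bs) rfl (update_bits bs) h

theorem exec_evalFml (ars : List ℕ) (o j : ℕ) (φ : Fml) (d : ℕ) (hφ : φ.WF ars o d) :
    ∃ T : Polynomial ℕ, ∀ (N : ℕ) (ρ : List (List ℕ → Bool)) (A : List ℕ → Bool) (i : ℕ)
      (l : List ℕ) (m : Mem), l.length = d → i ≤ N → (∀ x ∈ l, x ≤ N) → Holds N ars ρ m →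
      m.tab j = truthTable N o A → m.idx = [] → m.aux = [] →
      Exec F N (evalFml j φ d : StackProg Γ Stk) (i :: l) m
        { m with bits := φ.eval N ρ A l :: m.bits } (T.eval N) := by
  induction φ generalizing d with
  | tt => exact ⟨1, fun N ρ A i l m _ _ _ _ _ _ _ => by
    simpa [evalFml, Fml.eval] using exec_push_bits true⟩
  | rel r args =>
    obtain ⟨T, hT⟩ := exec_lookup (Γ := Γ) (F := F) r (args.map (· + 1))
    refine ⟨T, fun N ρ A i l m hd hi hl hρ hA hidx haux => ?_⟩
    have := hT N (i :: l) m (ρ.getD r fun _ => false) (by simpa using hρ r _ hφ.1) hidx haux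
      (by simpa using ⟨hi, hl⟩)
    simpa [Fml.eval, evalFml, hd, comp_def] using this
  | orc args =>
    obtain ⟨T, hT⟩ := exec_lookup (Γ := Γ) (F := F) j (args.map (· + 1))
    refine ⟨T, fun N ρ A i l m hd hi hl hρ hA hidx haux => ?_⟩
    have := hT N (i :: l) m A (by simpa [hφ.1] using hA) hidx haux
      (by simpa using ⟨hi, hl⟩)
    simpa [Fml.eval, evalFml, hd, comp_def] using this
  | nand φ ψ ihφ ihψ =>
    obtain ⟨T₁, h₁⟩ := ihφ d hφ.1
    obtain ⟨T₂, h₂⟩ := ihψ d hφ.2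
    refine ⟨T₁ + (T₂ + 3), fun N ρ A i l m hd hi hl hρ hA hidx haux => ?_⟩
    have h₁ := h₁ N ρ A i l m hd hi hl hρ hA hidx haux
    have h₂ := h₂ N ρ A i l { m with bits := φ.eval N ρ A l :: m.bits } hd hi hl hρ hA hidx haux
    have h₃ : Exec F N (branch .bits (branch .bits (push .bits false) (push .bits true))
        (branch .bits (push .bits true) (push .bits true)) : StackProg Γ Stk) (i :: l)
        { m with bits := ψ.eval N ρ A l :: φ.eval N ρ A l :: m.bits }
        { m with bits := (Fml.nand φ ψ).eval N ρ A l :: m.bits } (1 + 1 + 1) := by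
      refine exec_branch_bits ?_
      simp only [Fml.eval]
      cases ψ.eval N ρ A l <;> refine exec_branch_bits ?_ <;> cases φ.eval N ρ A l <;>
        exact exec_push_bits _
    have := h₁.seq (h₂.seq h₃)
    simp only [evalFml, Polynomial.eval_add, Polynomial.eval_ofNat]
    exact this
  | ex φ ih =>
    obtain ⟨T, hT⟩ := ih (d + 1) hφ
    refine ⟨1 + ((Polynomial.X + 1) * (T + 3 + 4) + 2),
      fun N ρ A i l m hd hi hl hρ hA hidx haux => ?_⟩
    have h₁ := exec_forAll (Γ := Γ) (F := F) (N := N) (l := i :: l) (d := d + 1)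
      (p := seq (evalFml j φ (d + 1))
        (branch .bits (branch .bits (push .bits true) (push .bits true)) skip))
      (t := T.eval N + 3) (by simp [hd])
      (fun a => { m with bits := ((List.range a).any fun x => φ.eval N ρ A (l ++ [x])) :: m.bits })
      ?_
    · have := (exec_push_bits (Γ := Γ) (F := F) (N := N) (l := i :: l) (m := m) false).seq h₁
      simpa [Fml.eval, evalFml] using this
    · intro a ha
      have h₂ := hT N ρ A i (l ++ [a])
        { m with bits := ((List.range a).any fun x => φ.eval N ρ A (l ++ [x])) :: m.bits }
        (by simp [hd]) hi (by simpa [or_imp, forall_and] using ⟨hl, ha⟩) hρ hA hidx haux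
      refine Runs.seq h₂ ?_
      refine Runs.weaken (t := 1 + 1 + 1) (exec_branch_bits ?_) le_rfl
      rw [List.range_succ]
      simp only [List.any_append, List.any_cons, List.any_nil, Bool.or_false]
      cases φ.eval N ρ A (l ++ [a])
      · simp only [Bool.or_false, cond_false]
        exact Runs.skip.weaken (by omega)
      · simp only [Bool.or_true, cond_true]
        refine exec_branch_bits ?_
        cases ((List.range a).any fun x => φ.eval N ρ A (l ++ [x])) <;> exact exec_push_bits _

/-- Do `p` for all values of `k` variables, the first of which has the number `d`. -/
def forAlls : (d k : ℕ) → StackProg Γ Stk → StackProg Γ Stk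
  | _, 0, p => p
  | d, k + 1, p => forAll d (forAlls (d + 1) k p)

theorem exec_forAlls (d k : ℕ) (p : StackProg Γ Stk) (T : Polynomial ℕ) :
    ∃ T' : Polynomial ℕ, ∀ (N : ℕ) (R : List ℕ → Bool) (l : List ℕ) (m : Mem),
      l.length = d → (∀ l' : List ℕ, l'.length = k → (∀ x ∈ l', x ≤ N) → ∀ e,
        Exec F N p (l ++ l') { m with emit := e } { m with emit := R l' :: e } (T.eval N)) →
      Exec F N (forAlls d k p) l m
        { m with emit := (truthTable N k R).reverse ++ m.emit } (T'.eval N) := by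
  induction k generalizing d with
  | zero =>
    refine ⟨T, fun N R l m hd h => ?_⟩
    simpa [truthTable, forAlls] using h [] rfl (by simp) m.emit
  | succ k ih =>
    obtain ⟨T', hT'⟩ := ih (d + 1)
    refine ⟨(Polynomial.X + 1) * (T' + 4) + 2, fun N R l m hd h => ?_⟩
    have := exec_forAll (Γ := Γ) (F := F) (N := N) (l := l) (d := d)
      (p := forAlls (d + 1) k p) (t := T'.eval N) hd
      (fun a => { m with emit := ((List.range a).flatMap fun x =>
        truthTable N k fun l => R (x :: l)).reverse ++ m.emit }) ?_
    · simpa [truthTable, forAlls] using this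
    · intro a ha
      have := hT' N (fun l => R (a :: l)) (l ++ [a])
        { m with emit := ((List.range a).flatMap fun x =>
          truthTable N k fun l => R (x :: l)).reverse ++ m.emit } (by simp [hd]) ?_
      · rw [List.range_succ]
        simpa using this
      · intro l' hl' hl'' e
        simpa using h (a :: l') (by simp [hl']) (by simpa using ⟨ha, hl''⟩) e

/-- Replace the contents of `tab j` by those of `emit`. -/
def store (j : ℕ) : StackProg Γ Stk :=
  seq (clear (.tab j)) (move .emit (.tab j))

theorem exec_store {N : ℕ} {l : List ℕ} {m : Mem} (j : ℕ) (b : List Bool) (hm : m.emit = []) :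
    Exec F N (store j : StackProg Γ Stk) l { m with emit := b.reverse }
      { m with tab := update m.tab j b } (2 * (m.tab j).length + 1 + (2 * b.length + 1)) := by
  have h₁ := runs_clear (Γ := Γ) (F := F) (u := []) (k := .tab j)
    (s := Mem.stacks N l { m with emit := b.reverse }) (update_tab j [])
  have h₂ := runs_move (Γ := Γ) (F := F) (u := []) (k := .emit) (k' := .tab j) (by simp)
    (s := Mem.stacks N l { m with emit := b.reverse, tab := update m.tab j [] })
    (s' := Mem.stacks N l { m with tab := update m.tab j b }) (by
      rw [update_emit, update_tab]
      simp [Mem.stacks, hm])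
  have := h₁.seq h₂
  simpa [Mem.stacks, store] using this

/-! ### Programs that compute iterations of first-order definitions -/

/-- The definition of a new relation with `arity` arguments: starting from the empty relation, the
first-order definition `fml`, in which the oracle stands for the relation so far, is iterated. -/
structure Stage where
  arity : ℕ
  fml : Fml

/-- One step of the iteration. -/
def Stage.next (S : Stage) (N : ℕ) (ρ : List (List ℕ → Bool)) (A : List ℕ → Bool) : List ℕ → Bool :=
  fun l => S.fml.eval N ρ A l

/-- The relation that a stage defines: the iteration is stopped after `N + 1` steps. -/
def Stage.rel (S : Stage) (N : ℕ) (ρ : List (List ℕ → Bool)) : List ℕ → Bool :=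
  (S.next N ρ)^[N + 1] fun _ => false

/-- The program that computes the truth table of the relation defined by a stage. The counter `0`,
which `evalFml` leaves aside, counts the steps of the iteration. -/
def runStage (j : ℕ) (S : Stage) : StackProg Γ Stk :=
  seq (seq (forAlls 0 S.arity (push .emit false)) (store j))
    (forAll 0 (seq (forAlls 1 S.arity (seq (evalFml j S.fml S.arity)
      (branch .bits (push .emit true) (push .emit false)))) (store j)))

theorem exec_runStage (ars : List ℕ) (j : ℕ) (hj : ars.length ≤ j) (S : Stage)
    (hS : S.fml.WF ars S.arity S.arity) :
    ∃ T : Polynomial ℕ, ∀ (N : ℕ) (ρ : List (List ℕ → Bool)) (m : Mem), Holds N ars ρ m →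
      m.tab j = [] → m.idx = [] → m.aux = [] → m.emit = [] →
      Exec F N (runStage j S : StackProg Γ Stk) [] m
        { m with tab := update m.tab j (truthTable N S.arity (S.rel N ρ)) } (T.eval N) := by
  obtain ⟨T₁, h₁⟩ := exec_forAlls (F := F) 0 S.arity (push .emit false : StackProg Γ Stk) 1
  obtain ⟨T₂, h₂⟩ := exec_evalFml (F := F) (Γ := Γ) ars S.arity j S.fml S.arity hS
  obtain ⟨T₃, h₃⟩ := exec_forAlls (F := F) 1 S.arity (seq (evalFml j S.fml S.arity)
      (branch .bits (push .emit true) (push .emit false)) : StackProg Γ Stk) (T₂ + 2)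
  let P : Polynomial ℕ := (Polynomial.X + 1) ^ S.arity
  have hP : ∀ (N : ℕ) R, (truthTable N S.arity R).length = P.eval N := by
    intro N R
    simp [length_truthTable, P]
  refine ⟨(T₁ + (2 * P + 2)) + ((Polynomial.X + 1) * ((T₃ + (2 * P + 1 + (2 * P + 1))) + 4) + 2),
    fun N ρ m hρ htab hidx haux hemit => ?_⟩
  let A : ℕ → List ℕ → Bool := fun i => (S.next N ρ)^[i] fun _ => false
  let Y : ℕ → Mem := fun i => { m with tab := update m.tab j (truthTable N S.arity (A i)) }
  have h₄ : Exec F N (seq (forAlls 0 S.arity (push .emit false)) (store j) : StackProg Γ Stk) []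
      m (Y 0) ((T₁ + (2 * P + 2)).eval N) := by
    have h₅ := h₁ N (A 0) [] m rfl (fun l' _ _ e => by
      simpa [A] using exec_push_emit (Γ := Γ) (F := F) (m := { m with emit := e }) false)
    rw [hemit, List.append_nil] at h₅
    refine (h₅.seq (exec_store j _ hemit)).weaken ?_
    rw [hP, htab]
    simp only [Polynomial.eval_add, Polynomial.eval_mul, Polynomial.eval_ofNat, List.length_nil]
    omega
  have h₅ := exec_forAll (F := F) (N := N) (l := []) (d := 0)
    (p := (seq (forAlls 1 S.arity (seq (evalFml j S.fml S.arity)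
      (branch .bits (push .emit true) (push .emit false)))) (store j) : StackProg Γ Stk))
    (t := (T₃ + (2 * P + 1 + (2 * P + 1))).eval N) rfl Y ?_
  · refine (h₄.seq h₅).weaken ?_
    simp only [Polynomial.eval_add, Polynomial.eval_mul, Polynomial.eval_ofNat,
      Polynomial.eval_X, Polynomial.eval_one]
    exact le_rfl
  · intro a ha
    have hρ' : Holds N ars ρ (Y a) := by
      intro r k hr
      have hr' : r ≠ j := by
        rintro rfl
        rw [List.getElem?_eq_none hj] at hr
        simp at hr
      simpa [Y, hr'] using hρ r k hr
    have h₆ := h₃ N (A (a + 1)) [a] (Y a) rfl (fun l' hl' hl'' e => by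
      have h₇ := h₂ N ρ (A a) a l' { Y a with emit := e } hl' ha hl'' hρ' (by simp [Y]) hidx haux
      have h₈ : Exec F N (branch .bits (push .emit true) (push .emit false) : StackProg Γ Stk)
          (a :: l') { Y a with emit := e, bits := S.fml.eval N ρ (A a) l' :: m.bits }
          { Y a with emit := S.fml.eval N ρ (A a) l' :: e } (1 + 1) := by
        refine exec_branch_bits (m := { Y a with emit := e }) (bs := m.bits) ?_
        cases S.fml.eval N ρ (A a) l' <;> exact exec_push_emit _
      have h₉ : A (a + 1) l' = S.fml.eval N ρ (A a) l' := by
        simp only [A, iterate_succ_apply', Stage.next]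
      rw [h₉]
      simpa using h₇.seq h₈)
    have h₈ : (Y a).emit = [] := hemit
    rw [h₈, List.append_nil] at h₆
    have h₇ := h₆.seq (exec_store (Γ := Γ) (F := F) (N := N) (l := [a]) (m := Y a) j
      (truthTable N S.arity (A (a + 1))) hemit)
    have h₉ : ({ Y a with tab := update (Y a).tab j (truthTable N S.arity (A (a + 1))) } : Mem) =
        Y (a + 1) := by simp [Y]
    simp only [h₉] at h₇
    refine h₇.weaken ?_
    simp only [Y, update_self, hP, Polynomial.eval_add, Polynomial.eval_mul, Polynomial.eval_ofNat,
      Polynomial.eval_one]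
    exact le_rfl

/-- The relations defined by a list of stages, one after the other, together with the given
relations. -/
def runRels (N : ℕ) : List Stage → List (List ℕ → Bool) → List (List ℕ → Bool)
  | [], ρ => ρ
  | S :: Ss, ρ => runRels N Ss (ρ ++ [S.rel N ρ])

/-- All relation symbols are used properly in a list of stages that extends relations with the
arities `ars`. -/
def StagesWF : List ℕ → List Stage → Prop
  | _, [] => True
  | ars, S :: Ss => S.fml.WF ars S.arity S.arity ∧ StagesWF (ars ++ [S.arity]) Ss

/-- The program that computes all relations defined by a list of stages. -/
def runStages : ℕ → List Stage → StackProg Γ Stk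
  | _, [] => skip
  | j, S :: Ss => seq (runStage j S) (runStages (j + 1) Ss)

theorem exec_runStages (ars : List ℕ) (Ss : List Stage) (hS : StagesWF ars Ss) :
    ∃ T : Polynomial ℕ, ∀ (N : ℕ) (ρ : List (List ℕ → Bool)) (m : Mem), ρ.length = ars.length →
      Holds N ars ρ m →
      (∀ r, ars.length ≤ r → m.tab r = []) → m.idx = [] → m.aux = [] → m.emit = [] →
      ∃ tab, Exec F N (runStages ars.length Ss : StackProg Γ Stk) [] m { m with tab := tab }
          (T.eval N) ∧
        Holds N (ars ++ Ss.map Stage.arity) (runRels N Ss ρ) { m with tab := tab } := by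
  induction Ss generalizing ars with
  | nil =>
    refine ⟨1, fun N ρ m hlen hρ htab hidx haux hemit => ⟨m.tab, ?_, ?_⟩⟩
    · simpa [runStages] using Runs.skip
    · simpa [runRels] using hρ
  | cons S Ss ih =>
    obtain ⟨T₁, h₁⟩ := exec_runStage (Γ := Γ) (F := F) ars ars.length le_rfl S hS.1
    obtain ⟨T₂, h₂⟩ := ih _ hS.2
    refine ⟨T₁ + T₂, fun N ρ m hlen hρ htab hidx haux hemit => ?_⟩
    have h₃ := h₁ N ρ m hρ (htab _ le_rfl) hidx haux hemit
    have h₆ : Holds N (ars ++ [S.arity]) (ρ ++ [S.rel N ρ])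
        { m with tab := update m.tab ars.length (truthTable N S.arity (S.rel N ρ)) } := by
      intro r k hr
      rcases lt_trichotomy r ars.length with h | h | h
      · rw [List.getElem?_append_left h] at hr
        have h₆ := hρ r k hr
        simp only [List.getD_eq_getElem?_getD] at h₆ ⊢
        rw [List.getElem?_append_left (by omega), ← h₆]
        simp [h.ne]
      · subst h
        simp only [List.getElem?_concat_length, Option.some.injEq] at hr
        subst hr
        simp [List.getD_eq_getElem?_getD, ← hlen]
      · rw [List.getElem?_eq_none (by simp; omega)] at hr
        simp at hr
    have h₇ : ∀ r, (ars ++ [S.arity]).length ≤ r →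
        update m.tab ars.length (truthTable N S.arity (S.rel N ρ)) r = [] := by
      intro r hr
      simp only [List.length_append, List.length_singleton] at hr
      simp [show r ≠ ars.length by omega, htab r (by omega)]
    obtain ⟨tab, h₄, h₅⟩ := h₂ N (ρ ++ [S.rel N ρ])
      { m with tab := update m.tab ars.length (truthTable N S.arity (S.rel N ρ)) }
      (by simp [hlen]) h₆ h₇ hidx haux hemit
    refine ⟨tab, ?_, ?_⟩
    · simp only [List.length_append, List.length_singleton] at h₄
      simpa [Polynomial.eval_add, runStages] using h₃.seq h₄
    · simpa [runRels] using h₅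

end StackProg

namespace StackProg

/-! ### From definitions by stages to Turing machines -/

section General

variable {Γ K : Type} [DecidableEq K] {F : Set K}

/-- In `t` steps, no stack grows by more than `t` bits. -/
theorem Runs.length_le {p : StackProg Γ K} {u u' : List Γ} {s s' : K → List Bool} {t : ℕ}
    (h : Runs F p u s u' s' t) : ∀ k ∈ F, (s' k).length ≤ (s k).length + t := by
  have pop : ∀ {s : K → List Bool} {k k' : K} {b : Bool} {l : List Bool}, s k = b :: l →
      (update s k l k').length ≤ (s k').length := by
    intro s k k' b l hs
    by_cases hk : k' = k
    · subst hk; simp [hs]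
    · simp [hk]
  induction h with
  | skip => intro k _; omega
  | @push k' b u s =>
    intro k _
    by_cases hk : k = k'
    · subst hk; simp
    · simp [hk]
  | seq _ _ ih ih' => intro k hk; have := ih k hk; have := ih' k hk; omega
  | branch hs _ ih => intro k hk; have := ih k hk; have := pop hs (k' := k); omega
  | loop_nil _ => intro k _; omega
  | loop_cons hs _ _ ih ih' =>
    intro k hk; have := ih k hk; have := ih' k hk; have := pop hs (k' := k); omega
  | read_nil => intro k _; omega
  | read_cons _ _ ih ih' => intro k hk; have := ih k hk; have := ih' k hk; omega
  | weaken _ h ih => intro k hk; have := ih k hk; omega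
  | congr _ h ih => intro k hk; rw [h k hk]; exact ih k hk

/-- Do all programs of a list, one after the other. -/
def seqs : List (StackProg Γ K) → StackProg Γ K
  | [] => skip
  | p :: ps => seq p (seqs ps)

theorem runs_seqs_push {u : List Γ} (b : K → Bool) (ks : List K) (hks : ks.Nodup)
    (s : K → List Bool) : Runs F (seqs (ks.map fun k => push k (b k))) u s u
      (fun k => if k ∈ ks then b k :: s k else s k) (ks.length + 1) := by
  induction ks generalizing s with
  | nil => simpa [seqs] using Runs.skip
  | cons k ks ih =>
    rw [List.nodup_cons] at hks
    have : (fun x => if x ∈ ks then b x :: update s k (b k :: s k) x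
        else update s k (b k :: s k) x) = fun x => if x ∈ k :: ks then b x :: s x else s x := by
      funext x
      by_cases hx : x = k
      · subst hx; simp [hks.1]
      · simp [hx]
    rw [← this]
    exact (Runs.seq (.push (k := k) (b := b k)) (ih hks.2 _)).weaken (by simp; omega)

theorem runs_read_push {ks : List K} (hks : ks.Nodup) (b : Γ → K → Bool) (w : List Γ)
    (s : K → List Bool) : Runs F (read fun a => seqs (ks.map fun k => push k (b a k))) w s []
      (fun k => if k ∈ ks then (w.map fun a => b a k).reverse ++ s k else s k)
      (w.length * (ks.length + 2) + 1) := by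
  induction w generalizing s with
  | nil => simpa using Runs.read_nil
  | cons a w ih =>
    have h := (runs_seqs_push (F := F) (u := w) (b a) ks hks s).read_cons
      (p := fun a => seqs (ks.map fun k => push k (b a k))) (ih _)
    have : (fun k => if k ∈ ks then (w.map fun a => b a k).reverse ++
        (if k ∈ ks then b a k :: s k else s k) else if k ∈ ks then b a k :: s k else s k) =
        fun k => if k ∈ ks then ((a :: w).map fun a => b a k).reverse ++ s k else s k := by
      funext k
      by_cases hk : k ∈ ks <;> simp [hk]
    rw [← this]
    exact (h.weaken (by simp only [List.length_cons]; ring_nf; omega))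

/-- Clear all stacks of a list except for `out`. -/
def clearAll (out : K) (ks : List K) : StackProg Γ K :=
  seqs (ks.map fun k => if k = out then skip else clear k)

theorem runs_clearAll (out : K) (ks : List K) {u : List Γ} (s : K → List Bool) (t : ℕ)
    (ht : ∀ k ∈ ks, (s k).length ≤ t) : Runs F (clearAll out ks) u s u
      (fun k => if k ∈ ks ∧ k ≠ out then [] else s k) (ks.length * (2 * t + 1) + 1) := by
  induction ks generalizing s with
  | nil => simpa [clearAll, seqs] using Runs.skip
  | cons k ks ih =>
    let s₁ : K → List Bool := if k = out then s else update s k []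
    have h₁ : Runs F (if k = out then skip else clear k : StackProg Γ K) u s u s₁ (2 * t + 1) := by
      by_cases hk : k = out
      · simp only [hk, if_true, s₁]
        exact Runs.skip.weaken (by omega)
      · simp only [hk, if_false, s₁]
        refine (runs_clear rfl).weaken ?_
        have := ht k (by simp)
        omega
    have h₂ := ih s₁ (by
      intro x hx
      refine le_trans ?_ (ht x (by simp [hx]))
      simp only [s₁]
      split_ifs
      · rfl
      · by_cases hx' : x = k
        · subst hx'; simp
        · simp [hx'])
    have h₃ : (fun x => if x ∈ ks ∧ x ≠ out then [] else s₁ x) =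
        fun x => if x ∈ k :: ks ∧ x ≠ out then [] else s x := by
      funext x
      simp only [s₁]
      by_cases hk : k = out
      · by_cases hx : x = k
        · subst hx; simp [hk]
        · subst hk; simp [hx]
      · by_cases hx : x = k
        · subst hx; simp [hk]
        · simp [hx, hk]
    rw [← h₃]
    exact (h₁.seq h₂).weaken (by simp only [List.length_cons]; ring_nf; omega)

end General

/-! ### The truth table of the order relation -/

/-- The program that computes the truth table of the relation `≤`. For every `x`, the stack `idx`
is filled with `x` bits `true` above a bit `false`; for `y = 0, 1, …`, one bit is popped each time,
and once `false` is reached, which is then restored each time, all entries are `true`. -/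
def computeLe {Γ : Type} : StackProg Γ Stk :=
  seq (forAll 0 (seq (push .idx false) (seq (copyCount 0)
    (seq (forAll 1 (branch .idx (push .emit false) (seq (push .idx false) (push .emit true))))
      (clear .idx))))) (store 0)

/-- The relation `≤`, as a relation on lists of arguments. -/
def leRel (l : List ℕ) : Bool := decide (l.getD 0 0 ≤ l.getD 1 0)

variable {Γ : Type} {F : Set Stk}

theorem truthTable_one (N : ℕ) (R : List ℕ → Bool) :
    truthTable N 1 R = (List.range (N + 1)).map fun x => R [x] := by
  simp [truthTable, List.map_eq_flatMap]

theorem exec_computeLe : ∃ T : Polynomial ℕ, ∀ (N : ℕ) (m : Mem), m.tab 0 = [] → m.idx = [] →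
    m.emit = [] → Exec F N (computeLe : StackProg Γ Stk) [] m
      { m with tab := update m.tab 0 (truthTable N 2 leRel) } (T.eval N) := by
  refine ⟨(Polynomial.X + 1) * ((1 + ((5 * Polynomial.X + 2) + (((Polynomial.X + 1) * (3 + 4) + 2) +
    3))) + 4) + 2 + (2 * (Polynomial.X + 1) ^ 2 + 2), fun N m htab hidx hemit => ?_⟩
  let tt : ℕ → List Bool := fun x => truthTable N 1 fun l => leRel (x :: l)
  let Y : ℕ → Mem := fun x => { m with emit := ((List.range x).flatMap tt).reverse }
  have h := exec_forAll (Γ := Γ) (F := F) (N := N) (l := []) (d := 0) (p :=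
    seq (push .idx false) (seq (copyCount 0)
      (seq (forAll 1 (branch .idx (push .emit false) (seq (push .idx false) (push .emit true))))
        (clear .idx))))
    (t := 1 + ((N * 5 + 2) + (((N + 1) * (3 + 4) + 2) + 3))) rfl Y ?_
  · have h₁ : Y 0 = m := by
      obtain ⟨_, _, _, _, _⟩ := m
      simpa [Y] using hemit.symm
    have h₂ : Y (N + 1) = { m with emit := (truthTable N 2 leRel).reverse } := by
      simp [Y, truthTable, tt]
    rw [h₁, h₂] at h
    refine (h.seq (exec_store 0 (truthTable N 2 leRel) hemit)).weaken ?_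
    rw [htab, length_truthTable]
    simp only [Polynomial.eval_add, Polynomial.eval_mul, Polynomial.eval_ofNat, List.length_nil,
      Polynomial.eval_X, Polynomial.eval_one, Polynomial.eval_pow]
    ring_nf
    omega
  · intro x hx
    let Z : ℕ → Mem := fun y => { m with
      idx := List.replicate (x - y) true ++ [false]
      emit := ((List.range y).map fun y => leRel [x, y]).reverse ++ (Y x).emit }
    have h₁ : Exec F N (push .idx false : StackProg Γ Stk) ([] ++ [x]) (Y x)
        { Y x with idx := [false] } 1 := by
      refine .push' ?_
      simp [update_idx, Y, hidx, Mem.stacks]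
    have h₂ : Exec F N (copyCount 0 : StackProg Γ Stk) ([] ++ [x]) { Y x with idx := [false] }
        (Z 0) (N * 5 + 2) := by
      have := exec_copyCount (Γ := Γ) (F := F) (N := N) (l := [x])
        (m := { Y x with idx := [false] }) 0
      refine Runs.weaken (t := x * 5 + 2) ?_ (by omega)
      simpa [Z, Y] using this
    have h₃ : Exec F N (forAll 1 (branch .idx (push .emit false)
        (seq (push .idx false) (push .emit true))) : StackProg Γ Stk) ([] ++ [x])
        (Z 0) (Z (N + 1)) ((N + 1) * (3 + 4) + 2) := by
      refine exec_forAll (l := [] ++ [x]) rfl Z fun y hy => ?_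
      have hr : Z (y + 1) = { Z y with
          idx := List.replicate (x - (y + 1)) true ++ [false]
          emit := leRel [x, y] :: (Z y).emit } := by
        simp [Z, List.range_succ]
      rw [hr]
      rcases Nat.lt_or_ge y x with hxy | hxy
      · have h₄ : leRel [x, y] = false := by simp [leRel, hxy]
        have h₅ : (Z y).idx = true :: (List.replicate (x - (y + 1)) true ++ [false]) := by
          simp only [Z]
          rw [show x - y = (x - (y + 1)) + 1 by omega, List.replicate_succ, List.cons_append]
        rw [h₄]
        exact Runs.weaken (.branch' (b := true) h₅ (update_idx _)
          (exec_push_emit (m := { Z y with idx := _ }) false)) (by omega)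
      · have h₄ : leRel [x, y] = true := by simp [leRel, hxy]
        have h₅ : (Z y).idx = false :: [] := by
          simp [Z, Nat.sub_eq_zero_of_le hxy]
        have h₆ : (List.replicate (x - (y + 1)) true ++ [false]) = [false] := by
          simp [Nat.sub_eq_zero_of_le (show x ≤ y + 1 by omega)]
        rw [h₄, h₆]
        refine .branch' (b := false) h₅ (update_idx _) (.seq (t₁ := 1) (t₂ := 1) (.push' ?_)
          (exec_push_emit (m := { Z y with idx := [false] }) true))
        rw [update_idx]
        rfl
    have h₄ : Exec F N (clear .idx : StackProg Γ Stk) ([] ++ [x]) (Z (N + 1)) (Y (x + 1)) 3 := by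
      have h₅ : (Z (N + 1)).idx = [false] := by
        simp [Z, Nat.sub_eq_zero_of_le (show x ≤ N + 1 by omega)]
      have h₆ : Y (x + 1) = { Z (N + 1) with idx := [] } := by
        simp [Y, Z, List.range_succ, tt, truthTable_one, hidx, -List.map_append]
      have := runs_clear (Γ := Γ) (F := F) (u := []) (s := (Z (N + 1)).stacks N ([] ++ [x]))
        (k := .idx) (update_idx [])
      rw [h₆]
      refine this.weaken ?_
      simp [Mem.stacks, h₅]
    exact h₁.seq (h₂.seq (h₃.seq h₄))

/-! ### The truth tables of the letters of the input -/

/-- The stacks that are filled while the input is read: `D` counters, and the truth tables of `g`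
letters. -/
def inputStacks (D g : ℕ) : List Stk :=
  (List.range D).map .cntR ++ (List.range g).map fun j => .tab (j + 1)

/-- The bit that is pushed onto one of these stacks when the letter `a` is read. -/
def inputBit [DecidableEq Γ] (letters : List Γ) (a : Γ) : Stk → Bool
  | .tab r => decide (letters[r - 1]? = some a)
  | _ => true

/-- The program that reads the input. -/
def readInput [DecidableEq Γ] (D : ℕ) (letters : List Γ) : StackProg Γ Stk :=
  read fun a => seqs ((inputStacks D letters.length).map fun k => push k (inputBit letters a k))

theorem nodup_inputStacks (D g : ℕ) : (inputStacks D g).Nodup := by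
  refine List.Nodup.append (List.nodup_range.map fun _ _ h => by simpa using h)
    (List.nodup_range.map fun _ _ h => by simpa using h) ?_
  intro k hk hk'
  simp only [List.mem_map] at hk hk'
  obtain ⟨_, _, rfl⟩ := hk
  obtain ⟨_, _, h⟩ := hk'
  simp at h

/-- The relation that holds for the positions of the input `w` with the letter number `j`. -/
def letterRel [DecidableEq Γ] (letters : List Γ) (w : List Γ) (j : ℕ) (l : List ℕ) : Bool :=
  (decide (w[l.getD 0 0]? = letters[j]?) && decide (l.getD 0 0 < w.length))

/-- The stacks after the input was read. -/
def inputMem [DecidableEq Γ] (letters : List Γ) (w : List Γ) : Mem where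
  tab r := if 1 ≤ r ∧ r ≤ letters.length then
    (w.map fun a => decide (letters[r - 1]? = some a)).reverse else []
  bits := []
  aux := []
  idx := []
  emit := []

theorem runs_readInput [DecidableEq Γ] (D : ℕ) (letters w : List Γ)
    (hD : ∀ i, .cntR i ∈ F → i < D) :
    ∃ s, Runs F (readInput D letters) w (fun _ => []) [] s
      (w.length * ((inputStacks D letters.length).length + 2) + 1) ∧
      ∀ k ∈ F, s k = (inputMem letters w).stacks w.length [] k := by
  refine ⟨_, runs_read_push (nodup_inputStacks _ _) _ _ _, fun k hk => ?_⟩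
  cases k with
  | cntR i =>
    have := hD i hk
    simp [inputStacks, inputBit, this, Mem.stacks, List.map_const', List.reverse_replicate]
  | tab r =>
    by_cases hr : 1 ≤ r ∧ r ≤ letters.length
    · have : ∃ a < letters.length, a + 1 = r := ⟨r - 1, by omega, by omega⟩
      simp [inputStacks, inputBit, this, Mem.stacks, inputMem, hr]
    · have : ¬ ∃ a < letters.length, a + 1 = r := by rintro ⟨a, h, rfl⟩; exact hr (by omega)
      simp [inputStacks, this, Mem.stacks, inputMem, hr]
  | _ => simp [inputStacks, Mem.stacks, inputMem]

/-- The program that brings the truth table number `r` in order after the input was read: it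
is in reverse order, and lacks the entry of the position after the last letter, which is
`false`. -/
def finishTable (r : ℕ) : StackProg Γ Stk :=
  seq (push (.tab r) false) (seq (move (.tab r) .emit) (seq (move .emit .aux) (move .aux (.tab r))))

theorem exec_finishTable {N : ℕ} {m : Mem} (r : ℕ) (b : List Bool) (hm : m.emit = [])
    (hm' : m.aux = []) (hr : m.tab r = b.reverse) :
    Exec F N (finishTable r : StackProg Γ Stk) [] m { m with tab := update m.tab r (b ++ [false]) }
      (6 * b.length + 10) := by
  have h₁ := exec_push_tab (Γ := Γ) (F := F) (N := N) (l := []) (m := m) r false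
  have h₂ := runs_move (Γ := Γ) (F := F) (u := []) (k := .tab r) (k' := .emit) (by simp)
    (s := Mem.stacks N [] { m with tab := update m.tab r (false :: m.tab r) })
    (s' := Mem.stacks N [] { m with tab := update m.tab r [], emit := b ++ [false] }) (by
      rw [update_tab, update_emit]
      simp [Mem.stacks, hm, hr])
  have h₃ := runs_move (Γ := Γ) (F := F) (u := []) (k := .emit) (k' := .aux) (by simp)
    (s := Mem.stacks N [] { m with tab := update m.tab r [], emit := b ++ [false] })
    (s' := Mem.stacks N [] { m with tab := update m.tab r [], aux := (b ++ [false]).reverse }) (by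
      rw [update_emit, update_aux]
      simp [Mem.stacks, hm, hm'])
  have h₄ := runs_move (Γ := Γ) (F := F) (u := []) (k := .aux) (k' := .tab r) (by simp)
    (s := Mem.stacks N [] { m with tab := update m.tab r [], aux := (b ++ [false]).reverse })
    (s' := Mem.stacks N [] { m with tab := update m.tab r (b ++ [false]) }) (by
      rw [update_aux, update_tab]
      simp [Mem.stacks, hm'])
  refine (h₁.seq (h₂.seq (h₃.seq h₄))).weaken ?_
  simp [Mem.stacks, hr]
  omega

/-- The relations that are given at the beginning: the order of the positions of the input `w`, and
the sets of positions of the letters. -/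
def baseRels [DecidableEq Γ] (letters w : List Γ) : List (List ℕ → Bool) :=
  leRel :: (List.range letters.length).map fun j => letterRel letters w j

/-- The arities of the relations that are given at the beginning. -/
def baseArities (g : ℕ) : List ℕ := 2 :: List.replicate g 1

/-- The program that brings the truth tables of the first `g` letters in order. -/
def finishTables : ℕ → StackProg Γ Stk
  | 0 => skip
  | g + 1 => seq (finishTables g) (finishTable (g + 1))

/-- The stacks when the truth tables of the first `g` letters are in order. -/
def letterMem [DecidableEq Γ] (letters w : List Γ) (g : ℕ) : Mem :=
  { inputMem letters w with
    tab := fun r => if 1 ≤ r ∧ r ≤ g then truthTable w.length 1 (letterRel letters w (r - 1))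
      else (inputMem letters w).tab r }

theorem exec_finishTables [DecidableEq Γ] (letters w : List Γ) (g : ℕ) (hg : g ≤ letters.length) :
    Exec F w.length (finishTables g : StackProg Γ Stk) [] (inputMem letters w)
      (letterMem letters w g) (g * (6 * w.length + 10) + 1) := by
  induction g with
  | zero =>
    have : letterMem letters w 0 = inputMem letters w := by
      simp only [letterMem, show ∀ r, ¬ (1 ≤ r ∧ r ≤ 0) by omega, if_false]
    rw [this]
    simpa [finishTables] using Runs.skip
  | succ g ih =>
    have h := exec_finishTable (Γ := Γ) (F := F) (N := w.length) (m := letterMem letters w g)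
      (g + 1) (w.map fun a => decide (letters[g]? = some a)) rfl rfl
      (by simp [letterMem, inputMem, hg])
    have h' : ({ letterMem letters w g with
        tab := update (letterMem letters w g).tab (g + 1)
          ((w.map fun a => decide (letters[g]? = some a)) ++ [false]) } : Mem) =
        letterMem letters w (g + 1) := by
      simp only [letterMem, Mem.mk.injEq, and_self, and_true]
      funext r
      by_cases hr : r = g + 1
      · subst hr
        rw [update_self, if_pos (by omega), truthTable_one, List.range_succ, List.map_append]
        congr 1
        · refine List.ext_getElem (by simp) fun i hi hi' => ?_
          have hi : i < w.length := by simpa using hi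
          simp only [List.getElem_map, List.getElem_range, letterRel, List.getD_cons_zero, hi,
            decide_true, Bool.and_true, List.getElem?_eq_getElem, add_tsub_cancel_right]
          exact decide_eq_decide.2 eq_comm
        · simp [letterRel]
      · rw [update_of_ne hr]
        by_cases hr' : 1 ≤ r ∧ r ≤ g
        · rw [if_pos hr', if_pos (by omega)]
        · rw [if_neg hr', if_neg (by omega)]
    rw [h'] at h
    refine ((ih (by omega)).seq h).weaken ?_
    simp only [List.length_map]
    ring_nf
    omega

theorem exists_bound (s : Finset Stk) : ∃ D, ∀ i, Stk.cntR i ∈ s → i < D := by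
  refine ⟨s.sup (fun k => match k with | .cntR i => i + 1 | _ => 0), fun i hi => ?_⟩
  exact Finset.le_sup (f := fun k => match k with | .cntR i => i + 1 | _ => 0) hi

theorem mem_used_seqs {K : Type} [DecidableEq K] [Fintype Γ] {k : K} {ps : List (StackProg Γ K)} :
    k ∈ (seqs ps).used ↔ ∃ p ∈ ps, k ∈ p.used := by
  induction ps with
  | nil => simp [seqs, used]
  | cons p ps ih => simp [seqs, used, ih]

theorem used_clearAll_subset {K : Type} [DecidableEq K] [Fintype Γ] (out : K) (ks : Finset K) :
    (clearAll out ks.toList : StackProg Γ K).used ⊆ ks := by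
  intro k hk
  obtain ⟨p, hp, hk⟩ := mem_used_seqs.1 hk
  obtain ⟨k', hk', rfl⟩ := List.mem_map.1 hp
  split_ifs at hk
  · simp [used] at hk
  · simp only [clear, used, Finset.union_empty, Finset.mem_singleton] at hk
    exact hk ▸ Finset.mem_toList.1 hk'

theorem lt_of_mem_used_readInput [Fintype Γ] [DecidableEq Γ] {D : ℕ} {letters : List Γ} {i : ℕ}
    (h : .cntR i ∈ (readInput D letters).used) : i < D := by
  simp only [readInput, used, Finset.mem_biUnion, Finset.mem_univ, true_and] at h
  obtain ⟨a, h⟩ := h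
  obtain ⟨p, hp, h⟩ := mem_used_seqs.1 h
  obtain ⟨k, hk, rfl⟩ := List.mem_map.1 hp
  simp only [used, Finset.mem_singleton] at h
  subst h
  simpa [inputStacks] using hk

theorem holds_base [DecidableEq Γ] (letters w : List Γ) :
    Holds w.length (baseArities letters.length) (baseRels letters w)
      { letterMem letters w letters.length with
        tab := update (letterMem letters w letters.length).tab 0
          (truthTable w.length 2 leRel) } := by
  intro r k hr
  rcases r with _ | r
  · obtain rfl : 2 = k := by simpa [baseArities] using hr
    simp [baseRels]
  · have hr' : r < letters.length := by
      by_contra hr'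
      simp [baseArities, List.getElem?_eq_none (show (List.replicate letters.length 1).length ≤ r
        by simpa using hr')] at hr
    obtain rfl : 1 = k := by simpa [baseArities, hr'] using hr
    simp only [baseRels, ne_eq, Nat.add_eq_zero_iff, one_ne_zero, and_false, not_false_eq_true,
      update_of_ne, letterMem]
    rw [if_pos (by omega)]
    simp [hr']

/-- Whatever can be defined by iterations of first-order definitions can be decided in polynomial
time. -/
theorem nonempty_tm2ComputableInPolyTime_of_stages [Fintype Γ] [DecidableEq Γ] (letters : List Γ)
    (f : List Γ → Bool) (Ss : List Stage) (hSs : StagesWF (baseArities letters.length) Ss) (r : ℕ)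
    (hr : (baseArities letters.length ++ Ss.map Stage.arity)[r]? = some 0)
    (hf : ∀ w, f w = (runRels w.length Ss (baseRels letters w)).getD r (fun _ => false) []) :
    Nonempty
      (Turing.TM2ComputableInPolyTime (id : List Γ → List Γ) Computability.encodeBool f) := by
  let main : StackProg Γ Stk := seq (finishTables letters.length) (seq computeLe
    (seq (runStages (baseArities letters.length).length Ss) (move (.tab r) .out)))
  obtain ⟨D, hD⟩ := exists_bound main.used
  let rd : StackProg Γ Stk := readInput D letters
  let pre : StackProg Γ Stk := seq rd main
  -- At the end, all stacks other than the output have to be empty.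
  let p : StackProg Γ Stk := seq pre (clearAll .out pre.used.toList)
  have hp : p.used = pre.used := by
    simp only [p, used]
    exact Finset.union_eq_left.2 (used_clearAll_subset _ _)
  have hout : Stk.out ∈ pre.used := by
    simp [pre, main, used, move]
  obtain ⟨T₁, h₁⟩ := exec_computeLe (Γ := Γ) (F := (p.used : Set Stk))
  obtain ⟨T₂, h₂⟩ := exec_runStages (Γ := Γ) (F := (p.used : Set Stk)) _ _ hSs
  let c : Polynomial ℕ := ((inputStacks D letters.length).length : Polynomial ℕ)
  let T₃ : Polynomial ℕ := (Polynomial.X * (c + 2) + 1) +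
    (((letters.length : Polynomial ℕ) * (6 * Polynomial.X + 10) + 1) + (T₁ + (T₂ + 3)))
  refine nonempty_tm2ComputableInPolyTime p .out (hp ▸ hout) f
    (T₃ + ((pre.used.toList.length : Polynomial ℕ) * (2 * T₃ + 1) + 1)) fun w => ?_
  obtain ⟨s, hs, hs'⟩ := runs_readInput (F := (p.used : Set Stk)) D letters w (by
    intro i hi
    rw [Finset.mem_coe, hp] at hi
    simp only [pre, used, Finset.mem_union] at hi
    exact hi.elim lt_of_mem_used_readInput (hD i))
  have h₃ := exec_finishTables (F := (p.used : Set Stk)) letters w letters.length le_rfl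
  have h₄ := h₁ w.length (letterMem letters w letters.length) (by simp [letterMem, inputMem])
    rfl rfl
  obtain ⟨tab, h₅, h₆⟩ := h₂ w.length (baseRels letters w) _ (by simp [baseRels, baseArities])
    (holds_base letters w) (by
      intro r hr
      have hr : letters.length + 1 ≤ r := by simpa [baseArities] using hr
      have hr' : ¬ r ≤ letters.length := by omega
      simp [show r ≠ 0 by omega, letterMem, inputMem, hr']) rfl rfl rfl
  have h₇ : tab r = [f w] := by
    rw [hf w]
    exact h₆ r 0 hr
  let s₂ := Mem.stacks w.length [] { letterMem letters w letters.length with tab := tab }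
  let s₃ := update (update s₂ (.tab r) []) .out ((s₂ (.tab r)).reverse ++ s₂ .out)
  have h₈ := runs_move (Γ := Γ) (F := (p.used : Set Stk)) (u := []) (k := .tab r) (k' := .out)
    (by simp) (s := s₂) (s' := s₃) rfl
  have h₉ : Runs (p.used : Set Stk) pre w (fun _ => []) [] s₃ (T₃.eval w.length) := by
    refine Runs.weaken (hs.seq ((h₃.seq (h₄.seq (h₅.seq h₈))).congr hs')) ?_
    simp [s₂, Mem.stacks, h₇, T₃, c]
  have h₁₀ := runs_clearAll (Γ := Γ) (F := (p.used : Set Stk)) (u := []) .out pre.used.toList _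
    (T₃.eval w.length) (fun k hk => by
      have := h₉.length_le k (by simpa [hp] using hk)
      simpa using this)
  refine ⟨_, (h₉.seq h₁₀).weaken (by simp), fun k hk => ?_⟩
  rw [hp] at hk
  by_cases hk' : k = .out
  · subst hk'
    simp [s₃, s₂, Mem.stacks, h₇]
  · simp [hk', hk]

end StackProg

/-! ### Relations definable by iterations of first-order definitions -/

/-- Types whose elements are tuples of natural numbers. -/
class NatTuple (C : Type) where
  /-- the number of entries -/
  dim : ℕ
  /-- the list of the entries -/
  entries : C → List ℕ
  length_entries : ∀ c, (entries c).length = dim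

namespace NatTuple

instance : NatTuple Unit := ⟨0, fun _ => [], fun _ => rfl⟩

instance : NatTuple ℕ := ⟨1, fun x => [x], fun _ => rfl⟩

instance {C D : Type} [NatTuple C] [NatTuple D] : NatTuple (C × D) :=
  ⟨dim C + dim D, fun c => entries c.1 ++ entries c.2, fun c => by simp [length_entries]⟩

instance {k : ℕ} : NatTuple (Fin k → ℕ) := ⟨k, List.ofFn, fun _ => List.length_ofFn⟩

/-- All entries of a tuple are at most `N`. -/
def Bounded {C : Type} [NatTuple C] (N : ℕ) (c : C) : Prop := ∀ x ∈ entries c, x ≤ N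

variable {C D E : Type} [NatTuple C] [NatTuple D] [NatTuple E] {N : ℕ}

@[simp] theorem bounded_unit (c : Unit) : Bounded N c := by simp [Bounded, entries]

@[simp] theorem bounded_nat (x : ℕ) : Bounded N x ↔ x ≤ N := by simp [Bounded, entries]

@[simp] theorem bounded_prod (c : C × D) : Bounded N c ↔ Bounded N c.1 ∧ Bounded N c.2 := by
  simp [Bounded, entries, or_imp, forall_and]

@[simp] theorem bounded_fin {k : ℕ} (a : Fin k → ℕ) : Bounded N a ↔ ∀ j, a j ≤ N := by
  simp [Bounded, entries, List.mem_ofFn]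

/-- A function between types of tuples that selects and rearranges entries. -/
@[fun_prop]
def IsSelection (f : C → D) : Prop :=
  ∃ args : List ℕ, (∀ i ∈ args, i < dim C) ∧
    ∀ c, entries (f c) = args.map fun i => (entries c).getD i 0

theorem _root_.List.map_getD_range (l : List ℕ) :
    (List.range l.length).map (fun i => l.getD i 0) = l := by
  refine List.ext_getElem (by simp) fun i h h' => ?_
  simp [h']

@[fun_prop]
theorem isSelection_id : IsSelection (fun c : C => c) := by
  refine ⟨List.range (dim C), by simp, fun c => ?_⟩
  rw [← length_entries c, List.map_getD_range]

@[fun_prop]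
theorem isSelection_comp {f : C → D} {g : D → E} (hg : IsSelection g) (hf : IsSelection f) :
    IsSelection (fun c => g (f c)) := by
  obtain ⟨a, ha, ha'⟩ := hf
  obtain ⟨b, hb, hb'⟩ := hg
  by_cases hC : Nonempty C
  swap
  · exact ⟨[], by simp, fun c => (hC ⟨c⟩).elim⟩
  obtain ⟨c₀⟩ := hC
  have hlen : a.length = dim D := by
    rw [← length_entries (f c₀), ha', List.length_map]
  refine ⟨b.map fun i => a.getD i 0, ?_, fun c => ?_⟩
  · intro i hi
    obtain ⟨j, hj, rfl⟩ := List.mem_map.1 hi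
    have := hb j hj
    rw [← hlen] at this
    simpa [this] using ha _ (List.getElem_mem this)
  · rw [hb', List.map_map]
    refine List.map_congr_left fun i hi => ?_
    have : i < a.length := hlen ▸ hb i hi
    simp [ha', this]

@[fun_prop]
theorem isSelection_fst : IsSelection (Prod.fst : C × D → C) := by
  refine ⟨List.range (dim C), ?_, fun c => ?_⟩
  · intro i hi
    exact (List.mem_range.1 hi).trans_le (Nat.le_add_right _ _)
  · conv_lhs => rw [← List.map_getD_range (entries c.1), length_entries]
    refine List.map_congr_left fun i hi => ?_
    have : i < (entries c.1).length := by rw [length_entries]; exact List.mem_range.1 hi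
    simp [entries, List.getElem?_append_left this]

@[fun_prop]
theorem isSelection_snd : IsSelection (Prod.snd : C × D → D) := by
  refine ⟨(List.range (dim D)).map (dim C + ·), ?_, fun c => ?_⟩
  · intro i hi
    obtain ⟨j, hj, rfl⟩ := List.mem_map.1 hi
    exact Nat.add_lt_add_left (List.mem_range.1 hj) _
  · conv_lhs => rw [← List.map_getD_range (entries c.2), length_entries]
    rw [List.map_map]
    refine List.map_congr_left fun i hi => ?_
    simp [entries, ← length_entries c.1, List.getElem?_append_right]

@[fun_prop]
theorem isSelection_prodMk {f : C → D} {g : C → E} (hf : IsSelection f) (hg : IsSelection g) :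
    IsSelection (fun c => (f c, g c)) := by
  obtain ⟨a, ha, ha'⟩ := hf
  obtain ⟨b, hb, hb'⟩ := hg
  refine ⟨a ++ b, ?_, fun c => ?_⟩
  · intro i hi
    exact (List.mem_append.1 hi).elim (ha i) (hb i)
  · simp only [entries, List.map_append, ← ha', ← hb']

@[fun_prop]
theorem isSelection_apply {k : ℕ} (j : Fin k) : IsSelection (fun a : Fin k → ℕ => a j) := by
  refine ⟨[j], ?_, fun a => ?_⟩
  · intro i hi
    simp only [List.mem_singleton] at hi
    exact hi ▸ j.2
  · simp [entries]

@[fun_prop]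
theorem isSelection_unit : IsSelection (fun _ : C => ()) := ⟨[], by simp, fun _ => rfl⟩

end NatTuple

/-! ### Extending lists of stages -/

namespace Fml

theorem WF.mono {ars ars' : List ℕ} {o : ℕ} {φ : Fml} {d : ℕ} (h : φ.WF ars o d) :
    φ.WF (ars ++ ars') o d := by
  induction φ generalizing d with
  | tt => trivial
  | rel r args =>
    refine ⟨?_, h.2⟩
    rw [List.getElem?_append_left (List.getElem?_eq_some_iff.1 h.1).1]
    exact h.1
  | orc args => exact h
  | nand φ ψ ihφ ihψ => exact ⟨ihφ h.1, ihψ h.2⟩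
  | ex φ ih => exact ih h

theorem eval_append {N : ℕ} {ars : List ℕ} {o : ℕ} {φ : Fml} {d : ℕ} (h : φ.WF ars o d)
    {ρ ρ' : List (List ℕ → Bool)} (hρ : ρ.length = ars.length) (A : List ℕ → Bool) (l : List ℕ) :
    φ.eval N (ρ ++ ρ') A l = φ.eval N ρ A l := by
  induction φ generalizing d l with
  | tt => rfl
  | rel r args =>
    have := (List.getElem?_eq_some_iff.1 h.1).1
    simp [eval, List.getElem?_append_left (hρ ▸ this)]
  | orc args => rfl
  | nand φ ψ ihφ ihψ => simp only [eval, ihφ h.1, ihψ h.2]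
  | ex φ ih => simp only [eval, ih h]

end Fml

namespace StackProg

theorem stagesWF_append {ars : List ℕ} {Ss Ss' : List Stage} :
    StagesWF ars (Ss ++ Ss') ↔ StagesWF ars Ss ∧ StagesWF (ars ++ Ss.map Stage.arity) Ss' := by
  induction Ss generalizing ars with
  | nil => simp [StagesWF]
  | cons S Ss ih => simp [StagesWF, ih, and_assoc]

theorem runRels_append (N : ℕ) (Ss Ss' : List Stage) (ρ : List (List ℕ → Bool)) :
    runRels N (Ss ++ Ss') ρ = runRels N Ss' (runRels N Ss ρ) := by
  induction Ss generalizing ρ with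
  | nil => rfl
  | cons S Ss ih => exact ih _

theorem length_runRels (N : ℕ) (Ss : List Stage) (ρ : List (List ℕ → Bool)) :
    (runRels N Ss ρ).length = ρ.length + Ss.length := by
  induction Ss generalizing ρ with
  | nil => rfl
  | cons S Ss ih => simp [runRels, ih]; omega

theorem exists_runRels_eq_append (N : ℕ) (Ss : List Stage) (ρ : List (List ℕ → Bool)) :
    ∃ ρ', runRels N Ss ρ = ρ ++ ρ' := by
  induction Ss generalizing ρ with
  | nil => exact ⟨[], by simp [runRels]⟩
  | cons S Ss ih =>
    obtain ⟨ρ', h⟩ := ih (ρ ++ [S.rel N ρ])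
    exact ⟨S.rel N ρ :: ρ', by simp [runRels, h]⟩

end StackProg

open StackProg NatTuple

section Definable

variable {Γ : Type} [Fintype Γ]

/-- All letters of the alphabet. -/
noncomputable def allLetters (Γ : Type) [Fintype Γ] : List Γ := Finset.univ.toList

/-- The arities of the relations given at the beginning and those defined by stages. -/
noncomputable def arities (Γ : Type) [Fintype Γ] (Ss : List Stage) : List ℕ :=
  baseArities (allLetters Γ).length ++ Ss.map Stage.arity

/-- The relation symbols are used properly in a list of stages. -/
def Proper (Γ : Type) [Fintype Γ] (Ss : List Stage) : Prop :=
  StagesWF (baseArities (allLetters Γ).length) Ss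

theorem Fml.WF.append {o d : ℕ} {φ : Fml} {Ss : List Stage} (h : φ.WF (arities Γ Ss) o d)
    (Ss' : List Stage) : φ.WF (arities Γ (Ss ++ Ss')) o d := by
  rw [arities, List.map_append, ← List.append_assoc]
  exact h.mono

variable [DecidableEq Γ]

/-- The relations for the input `w` given at the beginning and those defined by stages. -/
noncomputable def relations (Ss : List Stage) (w : List Γ) : List (List ℕ → Bool) :=
  runRels w.length Ss (baseRels (allLetters Γ) w)

theorem length_relations (Ss : List Stage) (w : List Γ) :
    (relations Ss w).length = (arities Γ Ss).length := by
  simp [relations, arities, length_runRels, baseRels, baseArities]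
  omega

theorem exists_relations_append (Ss Ss' : List Stage) (w : List Γ) :
    ∃ ρ', relations (Ss ++ Ss') w = relations Ss w ++ ρ' := by
  simp only [relations, runRels_append]
  exact exists_runRels_eq_append _ _ _

theorem eval_relations_append {o d : ℕ} {φ : Fml} {Ss : List Stage} (h : φ.WF (arities Γ Ss) o d)
    (Ss' : List Stage) (w : List Γ) (A : List ℕ → Bool) (l : List ℕ) :
    φ.eval w.length (relations (Ss ++ Ss') w) A l = φ.eval w.length (relations Ss w) A l := by
  obtain ⟨ρ', h'⟩ := exists_relations_append Ss Ss' w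
  rw [h', Fml.eval_append h (length_relations Ss w)]

variable {C D : Type} [NatTuple C] [NatTuple D]

/-- A property of a word `w`, a relation `A` with `o` arguments, and a tuple of natural numbers is
*definable* if for tuples with entries at most `w.length`, it is given by a first-order formula
that uses `A`, the order, the sets of positions of the letters in `w`, and relations that are
defined by stages. (That any given list of stages can be extended for this purpose makes it easy
to combine definitions.) -/
def Definable (o : ℕ) (P : List Γ → (List ℕ → Bool) → C → Prop) : Prop :=
  ∀ Ss, Proper Γ Ss → ∃ (Ss' : List Stage) (φ : Fml), Proper Γ (Ss ++ Ss') ∧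
    φ.WF (arities Γ (Ss ++ Ss')) o (dim C) ∧
    ∀ w A c, Bounded w.length c →
      (P w A c ↔ φ.eval w.length (relations (Ss ++ Ss') w) A (entries c) = true)

/-- A relation on the positions of words is *definable by stages* if it occurs among the
relations that are defined by a list of stages. -/
def StageDefinable (R : List Γ → C → Prop) : Prop :=
  ∀ Ss, Proper Γ Ss → ∃ (Ss' : List Stage) (r : ℕ), Proper Γ (Ss ++ Ss') ∧
    (arities Γ (Ss ++ Ss'))[r]? = some (dim C) ∧
    ∀ w c, Bounded w.length c →
      (R w c ↔ (relations (Ss ++ Ss') w).getD r (fun _ => false) (entries c) = true)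

namespace Definable

variable {o : ℕ} {P Q : List Γ → (List ℕ → Bool) → C → Prop}

theorem congr (hP : Definable o P) (h : ∀ w A c, Bounded w.length c → (P w A c ↔ Q w A c)) :
    Definable o Q := by
  intro Ss hSs
  obtain ⟨Ss', φ, h₁, h₂, h₃⟩ := hP Ss hSs
  exact ⟨Ss', φ, h₁, h₂, fun w A c hc => (h w A c hc).symm.trans (h₃ w A c hc)⟩

theorem nand (hP : Definable o P) (hQ : Definable o Q) :
    Definable o fun w A c => ¬ (P w A c ∧ Q w A c) := by
  intro Ss hSs
  obtain ⟨Ss₁, φ, h₁, h₂, h₃⟩ := hP Ss hSs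
  obtain ⟨Ss₂, ψ, h₄, h₅, h₆⟩ := hQ _ h₁
  rw [List.append_assoc] at h₄ h₅
  refine ⟨Ss₁ ++ Ss₂, .nand φ ψ, h₄, ⟨?_, h₅⟩, fun w A c hc => ?_⟩
  · rw [← List.append_assoc]
    exact h₂.append Ss₂
  · beta_reduce
    rw [h₃ w A c hc, h₆ w A c hc, Fml.eval, List.append_assoc, ← List.append_assoc Ss Ss₁,
      eval_relations_append h₂]
    simp [imp_iff_not_or]

theorem not (hP : Definable o P) : Definable o fun w A c => ¬ P w A c :=
  (hP.nand hP).congr fun w A c _ => by simp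

theorem and (hP : Definable o P) (hQ : Definable o Q) :
    Definable o fun w A c => P w A c ∧ Q w A c :=
  (hP.nand hQ).not.congr fun w A c _ => by simp

theorem or (hP : Definable o P) (hQ : Definable o Q) :
    Definable o fun w A c => P w A c ∨ Q w A c :=
  (hP.not.nand hQ.not).congr fun w A c _ => by tauto

theorem imp (hP : Definable o P) (hQ : Definable o Q) :
    Definable o fun w A c => P w A c → Q w A c :=
  (hP.nand hQ.not).congr fun w A c _ => by tauto

theorem iff (hP : Definable o P) (hQ : Definable o Q) :
    Definable o fun w A c => P w A c ↔ Q w A c :=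
  ((hP.imp hQ).and (hQ.imp hP)).congr fun w A c _ => by tauto

theorem true : Definable o fun (_ : List Γ) _ (_ : C) => True := fun Ss hSs =>
  ⟨[], .tt, by simpa using hSs, trivial, fun w A c _ => by simp [Fml.eval]⟩

theorem const (p : Prop) : Definable o fun (_ : List Γ) _ (_ : C) => p := by
  by_cases hp : p
  · exact true.congr fun _ _ _ _ => by simp [hp]
  · exact true.not.congr fun _ _ _ _ => by simp [hp]

theorem ex {P : List Γ → (List ℕ → Bool) → C → ℕ → Prop}
    (hP : Definable o fun w A (c : C × ℕ) => P w A c.1 c.2) :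
    Definable o fun w A c => ∃ x ≤ w.length, P w A c x := by
  intro Ss hSs
  obtain ⟨Ss', φ, h₁, h₂, h₃⟩ := hP Ss hSs
  refine ⟨Ss', .ex φ, h₁, h₂, fun w A c hc => ?_⟩
  simp only [Fml.eval, List.any_eq_true, List.mem_range, Nat.lt_succ_iff]
  refine exists_congr fun x => and_congr_right fun hx => ?_
  exact h₃ w A (c, x) (by simp [hc, hx])

theorem all {P : List Γ → (List ℕ → Bool) → C → ℕ → Prop}
    (hP : Definable o fun w A (c : C × ℕ) => P w A c.1 c.2) :
    Definable o fun w A c => ∀ x ≤ w.length, P w A c x :=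
  (ex (P := fun w A c x => ¬ P w A c x) hP.not).not.congr fun w A c _ => by
    push Not; rfl

theorem exTuple {k : ℕ} {P : List Γ → (List ℕ → Bool) → C → (Fin k → ℕ) → Prop}
    (hP : Definable o fun w A (c : C × (Fin k → ℕ)) => P w A c.1 c.2) :
    Definable o fun w A c => ∃ a : Fin k → ℕ, (∀ j, a j ≤ w.length) ∧ P w A c a := by
  intro Ss hSs
  obtain ⟨Ss', φ, h₁, h₂, h₃⟩ := hP Ss hSs
  have key : ∀ (k d : ℕ) (φ : Fml), φ.WF (arities Γ (Ss ++ Ss')) o (d + k) →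
      ∃ ψ : Fml, ψ.WF (arities Γ (Ss ++ Ss')) o d ∧ ∀ (w : List Γ) A l,
        (ψ.eval w.length (relations (Ss ++ Ss') w) A l = Bool.true ↔
          ∃ l' : List ℕ, l'.length = k ∧ (∀ x ∈ l', x ≤ w.length) ∧
            φ.eval w.length (relations (Ss ++ Ss') w) A (l ++ l') = Bool.true) := by
    intro k
    induction k with
    | zero =>
      intro d φ hφ
      refine ⟨φ, hφ, fun w A l => ⟨fun h => ⟨[], by simpa using h⟩, ?_⟩⟩
      rintro ⟨l', h, _, h'⟩
      rw [List.length_eq_zero_iff] at h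
      subst h
      simpa using h'
    | succ k ih =>
      intro d φ hφ
      obtain ⟨ψ, hψ, hψ'⟩ := ih (d + 1) φ (by rwa [Nat.add_right_comm, Nat.add_assoc] )
      refine ⟨.ex ψ, hψ, fun w A l => ?_⟩
      simp only [Fml.eval, List.any_eq_true, List.mem_range, Nat.lt_succ_iff, hψ']
      constructor
      · rintro ⟨x, hx, l', h, h', h''⟩
        exact ⟨x :: l', by simp [h], by simpa using ⟨hx, h'⟩, by simpa using h''⟩
      · rintro ⟨l', h, h', h''⟩
        obtain ⟨x, l', rfl⟩ := List.exists_cons_of_length_eq_add_one h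
        simp only [List.mem_cons, forall_eq_or_imp] at h'
        exact ⟨x, h'.1, l', by simpa using h, h'.2, by simpa using h''⟩
  obtain ⟨ψ, hψ, hψ'⟩ := key k (dim C) φ h₂
  refine ⟨Ss', ψ, h₁, hψ, fun w A c hc => ?_⟩
  rw [hψ']
  constructor
  · rintro ⟨a, ha, h⟩
    refine ⟨List.ofFn a, by simp, by simpa [List.mem_ofFn] using ha, ?_⟩
    exact (h₃ w A (c, a) (by simpa [hc] using ha)).1 h
  · rintro ⟨l', h, h', h''⟩
    subst h
    refine ⟨l'.get, fun j => h' _ (List.get_mem _ _), (h₃ w A (c, l'.get) ?_).2 ?_⟩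
    · simpa [hc] using fun j : Fin l'.length => h' _ (List.getElem_mem j.2)
    · simpa [entries] using h''

theorem exists_finset {ι : Type*} {P : ι → List Γ → (List ℕ → Bool) → C → Prop}
    (h : ∀ i, Definable o (P i)) (s : Finset ι) : Definable o fun w A c => ∃ i ∈ s, P i w A c := by
  classical
  induction s using Finset.induction with
  | empty => exact (const False).congr fun _ _ _ _ => by simp
  | insert i s hi ih => exact ((h i).or ih).congr fun _ _ _ _ => by simp

theorem exists_finite {ι : Type*} [Finite ι] {P : ι → List Γ → (List ℕ → Bool) → C → Prop}
    (h : ∀ i, Definable o (P i)) : Definable o fun w A c => ∃ i, P i w A c := by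
  have := Fintype.ofFinite ι
  exact (exists_finset h Finset.univ).congr fun _ _ _ _ => by simp

theorem forall_finite {ι : Type*} [Finite ι] {P : ι → List Γ → (List ℕ → Bool) → C → Prop}
    (h : ∀ i, Definable o (P i)) : Definable o fun w A c => ∀ i, P i w A c :=
  (exists_finite fun i => (h i).not).not.congr fun _ _ _ _ => by simp

/-- The auxiliary relation `A` is definable. -/
theorem oracle {f : C → D} (hf : IsSelection f := by fun_prop) :
    Definable (dim D) fun (_ : List Γ) A c => A (entries (f c)) = Bool.true := by
  intro Ss hSs
  obtain ⟨args, h, h'⟩ := hf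
  by_cases hC : Nonempty C
  · obtain ⟨c₀⟩ := hC
    refine ⟨[], .orc args, by simpa using hSs, ⟨?_, h⟩, fun w A c _ => ?_⟩
    · rw [← length_entries (f c₀), h', List.length_map]
    · beta_reduce
      rw [Fml.eval, h']
  · exact ⟨[], .tt, by simpa using hSs, trivial, fun w A c _ => (hC ⟨c⟩).elim⟩

end Definable

namespace StageDefinable

variable {R : List Γ → D → Prop}

theorem definable {o : ℕ} (hR : StageDefinable R) {f : C → D} (hf : IsSelection f := by fun_prop) :
    Definable o fun w _ c => R w (f c) := by
  intro Ss hSs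
  obtain ⟨Ss', r, h₁, h₂, h₃⟩ := hR Ss hSs
  obtain ⟨args, h, h'⟩ := hf
  by_cases hC : Nonempty C
  swap
  · exact ⟨[], .tt, by simpa using hSs, trivial, fun w A c _ => (hC ⟨c⟩).elim⟩
  obtain ⟨c₀⟩ := hC
  have hlen : args.length = dim D := by
    rw [← length_entries (f c₀), h', List.length_map]
  refine ⟨Ss', .rel r args, h₁, ⟨by rw [h₂, hlen], h⟩, fun w A c hc => ?_⟩
  beta_reduce
  rw [h₃ w (f c), Fml.eval, h']
  intro x hx
  rw [h'] at hx
  obtain ⟨i, hi, rfl⟩ := List.mem_map.1 hx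
  have : i < (entries c).length := by rw [length_entries]; exact h i hi
  simpa [this] using hc _ (List.getElem_mem this)

/-- A relation `R` is definable by stages if it can be defined by recursion: there is a rank of
tuples, bounded by the length of the word, such that `R` is defined in terms of its restriction to
tuples of smaller rank. -/
theorem of_recursion {Φ : List Γ → (List ℕ → Bool) → D → Prop} (hΦ : Definable (dim D) Φ)
    (rank : List Γ → D → ℕ) (hrank : ∀ w d, Bounded w.length d → rank w d ≤ w.length)
    (h : ∀ w A d, Bounded w.length d →
      (∀ d', Bounded w.length d' → rank w d' < rank w d → (A (entries d') = true ↔ R w d')) →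
      (Φ w A d ↔ R w d)) : StageDefinable R := by
  intro Ss hSs
  obtain ⟨Ss', φ, h₁, h₂, h₃⟩ := hΦ Ss hSs
  refine ⟨Ss' ++ [⟨dim D, φ⟩], (arities Γ (Ss ++ Ss')).length, ?_, ?_, fun w d hd => ?_⟩
  · rw [Proper, ← List.append_assoc, stagesWF_append]
    exact ⟨h₁, h₂, trivial⟩
  · rw [← List.append_assoc, arities, List.map_append, ← List.append_assoc]
    simp [arities]
  · have h₄ : relations (Ss ++ (Ss' ++ [⟨dim D, φ⟩])) w = relations (Ss ++ Ss') w ++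
        [Stage.rel ⟨dim D, φ⟩ w.length (relations (Ss ++ Ss') w)] := by
      rw [← List.append_assoc, relations, runRels_append]
      rfl
    rw [h₄, ← length_relations _ w]
    simp only [List.getD_eq_getElem?_getD, List.getElem?_concat_length, Option.getD_some]
    -- After `i` steps of the iteration, the relation is correct for tuples of rank less than `i`.
    have h₅ : ∀ i d, Bounded w.length d → rank w d < i → (R w d ↔
        ((Stage.next ⟨dim D, φ⟩ w.length (relations (Ss ++ Ss') w))^[i] fun _ => false)
          (entries d) = true) := by
      intro i
      induction i with
      | zero => intro d _ hd; omega
      | succ i ih =>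
        intro d hd hdi
        rw [iterate_succ_apply', Stage.next, ← h₃ w _ d hd, h w _ d hd]
        intro d' hd' hdd'
        exact (ih d' hd' (by omega)).symm
    exact h₅ _ d hd (Nat.lt_succ_of_le (hrank w d hd))

theorem of_definable (h : Definable (dim D) fun w _ d => R w d) : StageDefinable R :=
  of_recursion h (fun _ _ => 0) (fun _ _ _ => Nat.zero_le _) fun _ _ _ _ _ => Iff.rfl

theorem le : StageDefinable fun (_ : List Γ) (d : ℕ × ℕ) => d.1 ≤ d.2 := fun Ss hSs =>
  ⟨[], 0, by simpa using hSs, by simp [arities, baseArities]; rfl, fun w c _ => by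
    obtain ⟨ρ', h'⟩ := exists_runRels_eq_append w.length Ss (baseRels (allLetters Γ) w)
    rw [List.append_nil, relations, h']
    simp [baseRels, leRel, entries]⟩

theorem letter (a : Γ) : StageDefinable fun (w : List Γ) (p : ℕ) => w[p]? = some a := by
  intro Ss hSs
  obtain ⟨j, hj⟩ := List.mem_iff_getElem?.1 (Finset.mem_toList.2 (Finset.mem_univ a))
  change (allLetters Γ)[j]? = some a at hj
  have hj' := (List.getElem?_eq_some_iff.1 hj).1
  refine ⟨[], j + 1, by simpa using hSs, ?_, fun w p _ => ?_⟩
  · simp [arities, baseArities, List.getElem?_append_left, hj']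
    rfl
  · obtain ⟨ρ', h'⟩ := exists_runRels_eq_append w.length Ss (baseRels (allLetters Γ) w)
    rw [List.append_nil, relations, h']
    simp only [baseRels, entries, List.cons_append, List.getD_cons_succ]
    rw [List.getD_append _ _ _ _ (by simpa using hj')]
    simp only [List.getD_eq_getElem?_getD, List.getElem?_map, List.getElem?_range hj',
      Option.map_some, Option.getD_some, letterRel, hj, Bool.and_eq_true, decide_eq_true_eq]
    simp only [List.getElem?_cons_zero, Option.getD_some]
    exact ⟨fun h => ⟨h, (List.getElem?_eq_some_iff.1 h).1⟩, And.left⟩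

end StageDefinable

/-- A language that is definable can be decided in polynomial time. -/
theorem Definable.decidableInPolyTime {L : Language Γ}
    (h : Definable 0 fun w _ (_ : Unit) => w ∈ L) : DecidableInPolyTime L := by
  classical
  obtain ⟨Ss, r, h₁, h₂, h₃⟩ := StageDefinable.of_definable h [] trivial
  refine ⟨fun w => decide (w ∈ L), fun w => by simp, ?_⟩
  refine nonempty_tm2ComputableInPolyTime_of_stages (allLetters Γ) _ Ss h₁ r h₂ fun w => ?_
  have := h₃ w () (by simp)
  rw [Bool.eq_iff_iff, decide_eq_true_iff]
  exact this

end Definable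

/-! ### Arithmetic on positions -/

namespace StageDefinable

variable {Γ : Type} [Fintype Γ] [DecidableEq Γ] {C D₁ D₂ D₃ D₄ D₅ : Type} [NatTuple C] [NatTuple D₁]
  [NatTuple D₂] [NatTuple D₃] [NatTuple D₄] [NatTuple D₅] {o : ℕ}

theorem definable₂ {R : List Γ → D₁ → D₂ → Prop}
    (hR : StageDefinable fun w (d : D₁ × D₂) => R w d.1 d.2) {x : C → D₁} {y : C → D₂}
    (hx : IsSelection x := by fun_prop) (hy : IsSelection y := by fun_prop) :
    Definable o fun w _ c => R w (x c) (y c) :=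
  hR.definable (f := fun c => (x c, y c))

theorem definable₃ {R : List Γ → D₁ → D₂ → D₃ → Prop}
    (hR : StageDefinable fun w (d : D₁ × D₂ × D₃) => R w d.1 d.2.1 d.2.2) {x : C → D₁} {y : C → D₂}
    {z : C → D₃} (hx : IsSelection x := by fun_prop) (hy : IsSelection y := by fun_prop)
    (hz : IsSelection z := by fun_prop) :
    Definable o fun w _ c => R w (x c) (y c) (z c) :=
  hR.definable (f := fun c => (x c, y c, z c))

theorem definable₄ {R : List Γ → D₁ → D₂ → D₃ → D₄ → Prop}
    (hR : StageDefinable fun w (d : D₁ × D₂ × D₃ × D₄) => R w d.1 d.2.1 d.2.2.1 d.2.2.2)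
    {x : C → D₁} {y : C → D₂} {z : C → D₃} {u : C → D₄} (hx : IsSelection x := by fun_prop)
    (hy : IsSelection y := by fun_prop) (hz : IsSelection z := by fun_prop)
    (hu : IsSelection u := by fun_prop) :
    Definable o fun w _ c => R w (x c) (y c) (z c) (u c) :=
  hR.definable (f := fun c => (x c, y c, z c, u c))

theorem definable₅ {R : List Γ → D₁ → D₂ → D₃ → D₄ → D₅ → Prop}
    (hR : StageDefinable fun w (d : D₁ × D₂ × D₃ × D₄ × D₅) =>
      R w d.1 d.2.1 d.2.2.1 d.2.2.2.1 d.2.2.2.2)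
    {x : C → D₁} {y : C → D₂} {z : C → D₃} {u : C → D₄} {v : C → D₅}
    (hx : IsSelection x := by fun_prop) (hy : IsSelection y := by fun_prop)
    (hz : IsSelection z := by fun_prop) (hu : IsSelection u := by fun_prop)
    (hv : IsSelection v := by fun_prop) :
    Definable o fun w _ c => R w (x c) (y c) (z c) (u c) (v c) :=
  hR.definable (f := fun c => (x c, y c, z c, u c, v c))

end StageDefinable

namespace Definable

variable {Γ : Type} [Fintype Γ] [DecidableEq Γ] {C : Type} [NatTuple C] {o : ℕ} {x y z : C → ℕ}

theorem le (hx : IsSelection x := by fun_prop) (hy : IsSelection y := by fun_prop) :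
    Definable o fun (_ : List Γ) _ c => x c ≤ y c :=
  StageDefinable.le.definable (f := fun c => (x c, y c))

theorem lt (hx : IsSelection x := by fun_prop) (hy : IsSelection y := by fun_prop) :
    Definable o fun (_ : List Γ) _ c => x c < y c :=
  (le hy hx).not.congr fun _ _ _ _ => not_le

theorem eq (hx : IsSelection x := by fun_prop) (hy : IsSelection y := by fun_prop) :
    Definable o fun (_ : List Γ) _ c => x c = y c :=
  ((le hx hy).and (le hy hx)).congr fun _ _ _ _ => le_antisymm_iff.symm

theorem letter (a : Γ) (hx : IsSelection x := by fun_prop) :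
    Definable o fun (w : List Γ) _ c => w[x c]? = some a :=
  (StageDefinable.letter a).definable

theorem zero (hx : IsSelection x := by fun_prop) :
    Definable o fun (_ : List Γ) _ c => x c = 0 :=
  (all (P := fun _ _ c z => x c ≤ z) .le).congr fun _ _ _ _ =>
    ⟨fun h => Nat.le_zero.1 (h 0 (Nat.zero_le _)), fun h _ _ => h ▸ Nat.zero_le _⟩

end Definable

namespace NatTuple.IsSelection

theorem le_length {C : Type} [NatTuple C] {x : C → ℕ} (hx : IsSelection x) {N : ℕ} {c : C}
    (hc : Bounded N c) : x c ≤ N := by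
  obtain ⟨args, h, h'⟩ := hx
  have h₁ : x c ∈ entries (x c) := List.mem_singleton_self _
  rw [h' c] at h₁
  obtain ⟨i, hi, h₂⟩ := List.mem_map.1 h₁
  have : i < (entries c).length := by rw [length_entries]; exact h i hi
  rw [← h₂, List.getD_eq_getElem _ _ this]
  exact hc _ (List.getElem_mem this)

end NatTuple.IsSelection

namespace Definable

variable {Γ : Type} [Fintype Γ] [DecidableEq Γ] {C : Type} [NatTuple C] {o : ℕ} {x y z : C → ℕ}

theorem length (hx : IsSelection x := by fun_prop) :
    Definable o fun (w : List Γ) _ c => x c = w.length :=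
  (all (P := fun _ _ c z => z ≤ x c) .le).congr fun w _ _ hc =>
    ⟨fun h => le_antisymm (hx.le_length hc) (h _ le_rfl), fun h _ h' => h ▸ h'⟩

theorem succ (hx : IsSelection x := by fun_prop) (hy : IsSelection y := by fun_prop) :
    Definable o fun (_ : List Γ) _ c => x c + 1 = y c :=
  ((lt hx hy).and (all (P := fun _ _ c z => z ≤ x c ∨ y c ≤ z) (.or .le .le))).congr
    fun w _ c hc => by
      constructor
      · rintro ⟨h₁, h₂⟩
        have := hy.le_length hc
        have := h₂ (x c + 1) (by omega)
        omega
      · intro h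
        exact ⟨by omega, fun z _ => by omega⟩

theorem add (hx : IsSelection x := by fun_prop) (hy : IsSelection y := by fun_prop)
    (hz : IsSelection z := by fun_prop) :
    Definable o fun (_ : List Γ) _ c => x c + y c = z c := by
  have hΦ : Definable (Γ := Γ) (dim (ℕ × ℕ × ℕ)) fun w A (d : ℕ × ℕ × ℕ) =>
      (d.2.1 = 0 ∧ d.1 = d.2.2) ∨ ∃ y ≤ w.length, y + 1 = d.2.1 ∧
        ∃ z ≤ w.length, z + 1 = d.2.2 ∧ A (entries (d.1, y, z)) = Bool.true :=
    .or (.and .zero .eq) (.ex (.and .succ (.ex (.and .succ .oracle))))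
  have h : StageDefinable fun (_ : List Γ) (d : ℕ × ℕ × ℕ) => d.1 + d.2.1 = d.2.2 := by
    refine .of_recursion hΦ (fun _ d => d.2.1) (fun w d hd => ?_) fun w A ⟨x, y, z⟩ hd ih => ?_
    · simp only [bounded_prod, bounded_nat] at hd
      exact hd.2.1
    · simp only [bounded_prod, bounded_nat] at hd ih ⊢
      constructor
      · rintro (h | ⟨y', h₁, h₂, z', h₃, h₄, h₅⟩)
        · omega
        · have := (ih (x, y', z') ⟨hd.1, h₁, h₃⟩ (by simp; omega)).1 h₅
          simp only at this
          omega
      · intro h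
        rcases y with _ | y
        · left
          simpa using h
        · exact .inr ⟨y, by omega, rfl, z - 1, by omega, by omega,
            (ih (x, y, z - 1) ⟨hd.1, by dsimp only; omega, by dsimp only; omega⟩ (by simp)).2
              (by simp; omega)⟩
  exact h.definable (f := fun c => (x c, y c, z c))

end Definable

/-! ### Segments of words -/

section Segments

variable {Γ : Type}

/-- The word `l` occurs in `w` at the positions from `p` up to (and excluding) `q`. -/
def IsSegment (w : List Γ) (p q : ℕ) : List Γ → Prop
  | [] => p = q
  | a :: l => w[p]? = some a ∧ IsSegment w (p + 1) q l

namespace IsSegment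

variable {w : List Γ} {p q : ℕ} {l l' : List Γ}

theorem length_eq (h : IsSegment w p q l) : p + l.length = q := by
  induction l generalizing p with
  | nil => exact h
  | cons a l ih => have := ih h.2; simp; omega

theorem le (h : IsSegment w p q l) : p ≤ q := by have := h.length_eq; omega

theorem append_iff : IsSegment w p q (l ++ l') ↔ ∃ m, IsSegment w p m l ∧ IsSegment w m q l' := by
  induction l generalizing p with
  | nil => simp [IsSegment]
  | cons a l ih => simp [IsSegment, ih, and_assoc]

theorem iff_take_drop : IsSegment w p q l ↔ p + l.length = q ∧ l <+: w.drop p := by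
  induction l generalizing p with
  | nil => simp [IsSegment]
  | cons a l ih =>
    simp only [IsSegment, ih, List.length_cons]
    by_cases hp : p < w.length
    · rw [List.drop_eq_getElem_cons hp, List.getElem?_eq_getElem hp, List.cons_prefix_cons]
      simp only [Option.some.injEq]
      constructor
      · rintro ⟨h, h', h''⟩
        exact ⟨by omega, h.symm, h''⟩
      · rintro ⟨h, h', h''⟩
        exact ⟨h'.symm, by omega, h''⟩
    · simp [List.drop_eq_nil_of_le (not_lt.1 hp), not_lt.1 hp]

theorem zero_length_iff : IsSegment w 0 w.length l ↔ l = w := by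
  rw [iff_take_drop, List.drop_zero, Nat.zero_add]
  exact ⟨fun h => h.2.eq_of_length h.1, fun h => h ▸ ⟨rfl, List.prefix_rfl⟩⟩

theorem unique (h : IsSegment w p q l) (h' : IsSegment w p q l') : l = l' := by
  have h₁ := h.length_eq
  have h₂ := h'.length_eq
  rw [iff_take_drop] at h h'
  exact (List.prefix_of_prefix_length_le h.2 h'.2 (by omega)).eq_of_length (by omega)

/-- Decomposition of `w` into the part before the segment, the segment, and the remainder. -/
theorem drop_eq (h : IsSegment w p q l) : w.drop p = l ++ w.drop q := by
  obtain ⟨h, t, h'⟩ := iff_take_drop.1 h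
  rw [← h, ← List.drop_drop, ← h', List.drop_left]

theorem flatten_ofFn_iff {n : ℕ} {f : Fin n → List Γ} :
    IsSegment w p q (List.ofFn f).flatten ↔
      ∃ s : Fin (n + 1) → ℕ, s 0 = p ∧ s (Fin.last n) = q ∧
        ∀ i, IsSegment w (s i.castSucc) (s i.succ) (f i) := by
  induction n generalizing p with
  | zero =>
    simp only [List.ofFn_zero, List.flatten_nil, IsSegment, IsEmpty.forall_iff, and_true]
    exact ⟨fun h => ⟨fun _ => p, rfl, h⟩, fun ⟨s, h, h'⟩ => h.symm.trans h'⟩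
  | succ n ih =>
    simp only [List.ofFn_succ, List.flatten_cons, append_iff, ih]
    constructor
    · rintro ⟨m, h, s, h₁, h₂, h₃⟩
      refine ⟨Fin.cons p s, rfl, h₂, fun i => ?_⟩
      refine i.cases ?_ fun i => h₃ i
      simpa [h₁] using h
    · rintro ⟨s, rfl, rfl, h⟩
      exact ⟨s 1, h 0, Fin.tail s, rfl, rfl, fun i => h i.succ⟩

theorem ofFn_iff {n : ℕ} {f : Fin n → Γ} :
    IsSegment w p q (List.ofFn f) ↔ p + n = q ∧ ∀ i : Fin n, w[p + i]? = some (f i) := by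
  induction n generalizing p with
  | zero => simp [IsSegment]
  | succ n ih =>
    simp only [List.ofFn_succ, IsSegment, ih, Fin.forall_fin_succ, Fin.val_zero, Fin.val_succ,
      Nat.add_zero, ← Nat.add_assoc, Nat.add_right_comm p 1]
    tauto

theorem count_take [DecidableEq Γ] (h : IsSegment w p q l) (a : Γ) :
    (w.take q).count a = (w.take p).count a + l.count a := by
  obtain ⟨h, t, h'⟩ := iff_take_drop.1 h
  rw [← h, List.take_add, List.count_append, ← h', List.take_left]

end IsSegment

end Segments

/-! ### Blocks of words -/

section Blocks

variable {Γ : Type} [DecidableEq Γ]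

/-- The `i`-th block of `w` begins at the position `p`, where every occurrence of the letter `a`
is the beginning of a block. The end of `w` is regarded as the beginning of a last, empty block. -/
def IsBlockStart (a : Γ) (w : List Γ) (i p : ℕ) : Prop :=
  (w.take p).count a = i ∧ (p = w.length ∨ w[p]? = some a)

namespace IsBlockStart

variable {a : Γ} {w : List Γ} {i p q : ℕ}

theorem le_length (h : IsBlockStart a w i p) : p ≤ w.length := by
  rcases h.2 with h | h
  · exact h.le
  · exact (List.getElem?_eq_some_iff.1 h).1.le

theorem not_lt (hp : IsBlockStart a w i p) (hq : IsBlockStart a w i q) : ¬ p < q := fun h => by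
  have h₁ := hq.le_length
  have h₂ : w[p]? = some a := hp.2.resolve_left (by omega)
  have h₃ : IsSegment w p (p + 1) [a] := ⟨h₂, rfl⟩
  have h₄ := h₃.count_take a
  have h₅ : (w.take (p + 1)).count a ≤ (w.take q).count a :=
    (List.take_prefix_take_left (by omega)).sublist.count_le a
  rw [hp.1] at h₄
  rw [hq.1] at h₅
  simp at h₄
  omega

theorem unique (hp : IsBlockStart a w i p) (hq : IsBlockStart a w i q) : p = q :=
  le_antisymm (Nat.not_lt.1 (hq.not_lt hp)) (Nat.not_lt.1 (hp.not_lt hq))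

theorem length (a : Γ) (w : List Γ) : IsBlockStart a w (w.count a) w.length :=
  ⟨by simp, .inl rfl⟩

end IsBlockStart

/-- A word that is written as a sequence of blocks is given by the segments between the
beginnings of the blocks. -/
theorem flatten_ofFn_blocks {a : Γ} {n : ℕ} {f : Fin n → List Γ} {w : List Γ}
    (hf : ∀ i, a ∉ f i) (h : (List.ofFn fun i => a :: f i).flatten = w) :
    w.count a = n ∧ IsBlockStart a w 0 0 ∧
      ∀ i : Fin n, ∃ p q, IsBlockStart a w i p ∧ IsBlockStart a w (i + 1) q ∧
        IsSegment w p q (a :: f i) := by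
  obtain ⟨s, h₁, h₂, h₃⟩ := IsSegment.flatten_ofFn_iff.1 (IsSegment.zero_length_iff.2 h)
  have h₄ : ∀ i : Fin (n + 1), (w.take (s i)).count a = i := by
    intro i
    induction i using Fin.induction with
    | zero => simp [h₁]
    | succ i ih => simp [(h₃ i).count_take a, ih, List.count_eq_zero.2 (hf i)]
  have h₅ : ∀ i : Fin (n + 1), IsBlockStart a w i (s i) := fun i => by
    refine ⟨h₄ i, ?_⟩
    refine i.lastCases (.inl h₂) fun i => .inr (h₃ i).1
  refine ⟨?_, ?_, fun i => ⟨_, _, h₅ i.castSucc, h₅ i.succ, h₃ i⟩⟩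
  · have := h₄ (Fin.last n)
    rw [h₂] at this
    simpa using this
  · have := h₅ 0
    rwa [h₁] at this

theorem flatten_ofFn_of_blocks {a : Γ} {w : List Γ} (f : Fin (w.count a) → List Γ)
    (h₀ : IsBlockStart a w 0 0)
    (h : ∀ i : Fin (w.count a), ∃ p q, IsBlockStart a w i p ∧ IsBlockStart a w (i + 1) q ∧
        IsSegment w p q (a :: f i)) :
    (List.ofFn fun i => a :: f i).flatten = w := by
  rw [← IsSegment.zero_length_iff, IsSegment.flatten_ofFn_iff]
  choose p q hp hq hpq using h
  have hp' : ∀ i, ∃ p, IsBlockStart a w (i : Fin (w.count a + 1)) p := fun i =>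
    i.lastCases ⟨_, .length a w⟩ fun i => ⟨_, hp i⟩
  choose s hs using hp'
  refine ⟨s, (hs 0).unique h₀, (hs _).unique (.length a w), fun i => ?_⟩
  rw [(hs i.castSucc).unique (hp i), (hs i.succ).unique (hq i)]
  exact hpq i

end Blocks

namespace Definable

variable {Γ : Type} [Fintype Γ] [DecidableEq Γ] {C : Type} [NatTuple C] {o : ℕ} {x y z : C → ℕ}

theorem count_take (a : Γ) (hx : IsSelection x := by fun_prop) (hy : IsSelection y := by fun_prop) :
    Definable o fun (w : List Γ) _ c => (w.take (x c)).count a = y c := by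
  have hΦ : Definable (Γ := Γ) (dim (ℕ × ℕ)) fun w A (d : ℕ × ℕ) =>
      (d.1 = 0 ∧ d.2 = 0) ∨ ∃ x ≤ w.length, x + 1 = d.1 ∧
        ((w[x]? = some a ∧ ∃ y ≤ w.length, y + 1 = d.2 ∧ A (entries (x, y)) = Bool.true) ∨
          (¬ w[x]? = some a ∧ A (entries (x, d.2)) = Bool.true)) :=
    .or (.and .zero .zero) (.ex (.and .succ (.or (.and (.letter a) (.ex (.and .succ .oracle)))
      (.and (.not (.letter a)) .oracle))))
  have h : StageDefinable fun (w : List Γ) (d : ℕ × ℕ) => (w.take d.1).count a = d.2 := by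
    refine .of_recursion hΦ (fun _ d => d.1) (fun w d hd => ?_) fun w A ⟨x, y⟩ hd ih => ?_
    · simp only [bounded_prod, bounded_nat] at hd
      exact hd.1
    · simp only [bounded_prod, bounded_nat, Prod.forall] at hd ih ⊢
      rcases x with _ | x
      · simp only [List.take_zero, List.count_nil, Nat.add_one_ne_zero, false_and, and_false,
          exists_false, or_false, true_and]
        exact eq_comm
      · have h₁ : (w.take (x + 1)).count a =
            (w.take x).count a + if w[x]? = some a then 1 else 0 := by
          rw [List.take_succ_eq_append_getElem (by omega), List.count_append,
            List.getElem?_eq_getElem (by omega)]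
          by_cases h : w[x] = a <;> simp [h]
        rw [h₁]
        constructor
        · rintro (h | ⟨x', h₃, h₂, h | h⟩)
          · omega
          · obtain rfl : x' = x := by omega
            obtain ⟨h, y', h₆, h₄, h₅⟩ := h
            rw [ih _ _ ⟨h₃, h₆⟩ (by omega)] at h₅
            simp [h, ← h₄, h₅]
          · obtain rfl : x' = x := by omega
            rw [ih _ _ ⟨h₃, hd.2⟩ (by omega)] at h
            simp [h]
        · intro h
          refine .inr ⟨x, by omega, rfl, ?_⟩
          by_cases h₂ : w[x]? = some a
          · rw [if_pos h₂] at h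
            exact .inl ⟨h₂, _, by omega, h, (ih _ _ ⟨by omega, by omega⟩ (by omega)).2 rfl⟩
          · rw [if_neg h₂] at h
            exact .inr ⟨h₂, (ih _ _ ⟨by omega, by omega⟩ (by omega)).2 h⟩
  exact h.definable (f := fun c => (x c, y c))

theorem count (a : Γ) (hx : IsSelection x := by fun_prop) :
    Definable o fun (w : List Γ) _ c => w.count a = x c :=
  (Definable.ex (P := fun w _ c y => y = w.length ∧ (w.take y).count a = x c)
    (.and .length (.count_take a))).congr fun w _ c _ => by simp

theorem isBlockStart (a : Γ) (hx : IsSelection x := by fun_prop)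
    (hy : IsSelection y := by fun_prop) :
    Definable o fun (w : List Γ) _ c => IsBlockStart a w (x c) (y c) :=
  .and (.count_take a) (.or .length (.letter a))

theorem isSegment_replicate (a : Γ) (hx : IsSelection x := by fun_prop)
    (hy : IsSelection y := by fun_prop) (hz : IsSelection z := by fun_prop) :
    Definable o fun (w : List Γ) _ c => IsSegment w (x c) (y c) (List.replicate (z c) a) :=
  ((add hx hz hy).and (all (P := fun w _ c u => x c ≤ u ∧ u < y c → w[u]? = some a)
    (.imp (.and .le .lt) (.letter a)))).congr fun w _ c hc => by
      rw [← List.ofFn_const, IsSegment.ofFn_iff]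
      refine and_congr_right fun h =>
        ⟨fun h' i => h' _ ?_ ⟨by omega, by omega⟩, fun h' u _ hu => ?_⟩
      · have := hy.le_length hc
        omega
      · have := h' ⟨u - x c, by omega⟩
        rwa [show x c + (u - x c) = u by omega] at this

end Definable

/-! ### Balls and spheres -/

section Balls

variable {V : Type*}

/-- The set of all elements that can be reached from `r` in at most `t` steps of the relation
`E`. -/
def ball (E : V → V → Prop) (r : V) : ℕ → Set V
  | 0 => {r}
  | t + 1 => {v | v ∈ ball E r t ∨ ∃ u ∈ ball E r t, E u v}

/-- The set of all elements that can be reached from `r` in `t`, but not in fewer steps of the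
relation `E`. -/
def sphere (E : V → V → Prop) (r : V) (t : ℕ) : Set V :=
  {v | v ∈ ball E r t ∧ ∀ s < t, v ∉ ball E r s}

variable {E : V → V → Prop} {r u v : V} {s t : ℕ} {S : Set V}

theorem ball_mono (h : s ≤ t) : ball E r s ⊆ ball E r t :=
  monotone_nat_of_le_succ (f := ball E r) (fun _ _ h => .inl h) h

theorem ball_succ_of_rel (hu : u ∈ ball E r t) (h : E u v) : v ∈ ball E r (t + 1) := .inr ⟨u, hu, h⟩

theorem exists_mem_ball_iff : (∃ t, v ∈ ball E r t) ↔ Relation.ReflTransGen E r v := by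
  constructor
  · rintro ⟨t, h⟩
    induction t generalizing v with
    | zero => exact h ▸ .refl
    | succ t ih =>
      rcases h with h | ⟨u, h, h'⟩
      · exact ih h
      · exact (ih h).tail h'
  · intro h
    induction h with
    | refl => exact ⟨0, rfl⟩
    | tail _ h ih =>
      obtain ⟨t, ih⟩ := ih
      exact ⟨t + 1, ball_succ_of_rel ih h⟩

theorem exists_mem_sphere (h : v ∈ ball E r t) : ∃ s ≤ t, v ∈ sphere E r s := by
  classical
  have h' : ∃ t, v ∈ ball E r t := ⟨t, h⟩
  exact ⟨Nat.find h', Nat.find_min' _ h, Nat.find_spec h', fun s => Nat.find_min h'⟩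

theorem mem_sphere_succ_iff : v ∈ sphere E r (t + 1) ↔ v ∈ ball E r (t + 1) ∧ v ∉ ball E r t := by
  refine and_congr_right fun _ => ⟨fun h => h t (Nat.lt_succ_self t), fun h s hs hv => h ?_⟩
  exact ball_mono (Nat.lt_succ_iff.1 hs) hv

theorem exists_mem_sphere_of_rel [Std.Symm E] (hv : v ∈ sphere E r t) (h : E v u) :
    ∃ s, u ∈ sphere E r s ∧ s ≤ t + 1 ∧ t ≤ s + 1 := by
  obtain ⟨s, hs, hu⟩ := exists_mem_sphere (ball_succ_of_rel hv.1 h)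
  refine ⟨s, hu, hs, Nat.not_lt.1 fun h' => hv.2 _ h' (ball_succ_of_rel hu.1 (symm_of E h))⟩

theorem ball_subset (hE : ∀ u v, E u v → v ∈ S) (hr : r ∈ S) : ball E r t ⊆ S := by
  induction t with
  | zero => exact Set.singleton_subset_iff.2 hr
  | succ t ih =>
    rintro v (h | ⟨u, _, h⟩)
    · exact ih h
    · exact hE u v h

/-- In a relation on a set with at most `n` elements, everything that can be reached at all can be
reached in `n` steps. -/
theorem ball_subset_ball_of_ncard_le (hE : ∀ u v, E u v → v ∈ S) (hS : S.Finite) (hr : r ∈ S)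
    {n : ℕ} (hn : S.ncard ≤ n) (t : ℕ) : ball E r t ⊆ ball E r n := by
  have hfin : ∀ t, (ball E r t).Finite := fun t => hS.subset (ball_subset hE hr)
  have h₁ : (ball E r n).ncard = (ball E r (max n t)).ncard := by
    have hb : ∀ t, (ball E r t).ncard ≤ n := fun t =>
      (Set.ncard_le_ncard (ball_subset hE hr) hS).trans hn
    have hm : Monotone fun t => (ball E r t).ncard := fun s t h =>
      Set.ncard_le_ncard (ball_mono h) (hfin t)
    have hst : ∀ t, (ball E r t).ncard = (ball E r (t + 1)).ncard →
        (ball E r (t + 1)).ncard = (ball E r (t + 2)).ncard := by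
      intro t h
      have h₂ := Set.eq_of_subset_of_ncard_le (ball_mono (E := E) (r := r) (Nat.le_succ t)) h.ge
        (hfin _)
      have h₃ : ball E r (t + 2) = ball E r (t + 1) := by
        refine subset_antisymm ?_ (ball_mono (Nat.le_succ _))
        rintro v (hv | ⟨u, hu, hv⟩)
        · exact hv
        · rw [← h₂] at hu
          exact ball_succ_of_rel hu hv
      rw [h₃]
    exact (Nat.stabilises_of_monotone hm hb hst (le_max_left n t)).symm
  rw [Set.eq_of_subset_of_ncard_le (ball_mono (le_max_left n t)) h₁.ge (hfin _)]
  exact ball_mono (le_max_right n t)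

end Balls

/-! ### Solutions of local constraints -/

section Solutions

variable {V : Type*}

/-- By recursion on `t`, `s` is a candidate for the part of a solution of constraints `sat` that
lies close to the sphere of radius `t` around `r`: the constraints in this sphere are satisfied,
and `s` agrees with such a candidate for the preceding sphere. The candidates are restricted to a
family `F` of sets. -/
def IsPartialSolution (E : V → V → Prop) (sat : V → Set V → Prop) (F : Set (Set V)) (r : V) :
    ℕ → Set V → Prop
  | 0, s => sat r s
  | t + 1, s => ∃ s' ∈ F, IsPartialSolution E sat F r t s' ∧
      (∀ v, v ∈ sphere E r t ∨ v ∈ sphere E r (t + 1) → (v ∈ s ↔ v ∈ s')) ∧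
      ∀ v ∈ sphere E r (t + 1), sat v s

variable {E : V → V → Prop} {sat : V → Set V → Prop} {F : Set (Set V)} {r : V}

/-- A candidate for the sphere of radius `t` extends to a solution of all constraints in the ball:
the new constraints do not involve elements of the ball that are not in the last two spheres. -/
theorem IsPartialSolution.exists_solution [Std.Symm E]
    (hsat : ∀ v s s', (∀ u, u = v ∨ E v u → (u ∈ s ↔ u ∈ s')) → sat v s → sat v s')
    {t : ℕ} {s : Set V} (h : IsPartialSolution E sat F r t s) :
    ∃ y, (∀ v ∈ ball E r t, sat v y) ∧
      ∀ v, v ∈ sphere E r t ∨ v ∈ sphere E r (t + 1) → (v ∈ y ↔ v ∈ s) := by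
  induction t generalizing s with
  | zero => exact ⟨s, fun v hv => hv ▸ h, fun _ _ => Iff.rfl⟩
  | succ t ih =>
    obtain ⟨s', -, hs', hss', hs⟩ := h
    obtain ⟨y', hy', hys'⟩ := ih hs'
    let y : Set V := {v | v ∈ ball E r (t + 1) ∧ v ∈ y' ∨ v ∉ ball E r (t + 1) ∧ v ∈ s}
    have hyin : ∀ v ∈ ball E r (t + 1), (v ∈ y ↔ v ∈ y') := fun v hv => by simp [y, hv]
    have hyout : ∀ v ∉ ball E r (t + 1), (v ∈ y ↔ v ∈ s) := fun v hv => by simp [y, hv]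
    have hys : ∀ v, v ∈ sphere E r t ∨ v ∈ sphere E r (t + 1) → (v ∈ y ↔ v ∈ s) := by
      intro v hv
      rw [hyin v, hys' v hv, hss' v hv]
      exact hv.elim (fun h => ball_mono (Nat.le_succ t) h.1) And.left
    refine ⟨y, fun v hv => ?_, fun v hv => hv.elim (fun h => hys v (.inr h)) fun h => ?_⟩
    · by_cases hv' : v ∈ ball E r t
      · refine hsat v y' y (fun u hu => (hyin u ?_).symm) (hy' v hv')
        rcases hu with rfl | hu
        · exact hv
        · exact ball_succ_of_rel hv' hu
      · have hv'' := mem_sphere_succ_iff.2 ⟨hv, hv'⟩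
        refine hsat v s y (fun u hu => ?_) (hs v hv'')
        by_cases hu' : u ∈ ball E r (t + 1)
        · refine (hys u ?_).symm
          rcases hu with rfl | hu
          · exact .inr hv''
          · obtain ⟨i, hi, h₁, h₂⟩ := exists_mem_sphere_of_rel hv'' hu
            have h₃ : i ≤ t + 1 := Nat.not_lt.1 fun h => hi.2 _ h hu'
            obtain rfl | rfl : i = t ∨ i = t + 1 := by omega
            · exact .inl hi
            · exact .inr hi
        · exact (hyout u hu').symm
    · exact hyout v (mem_sphere_succ_iff.1 h).2

/-- The sphere of radius `t` around `r` together with the preceding and the following one. -/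
def nearSphere (E : V → V → Prop) (r : V) (t : ℕ) : Set V :=
  {v | ∃ i, v ∈ sphere E r i ∧ i ≤ t + 1 ∧ t ≤ i + 1}

theorem mem_nearSphere_of_rel [Std.Symm E] {u v : V} {t : ℕ} (hv : v ∈ sphere E r t)
    (hu : u = v ∨ E v u) : u ∈ nearSphere E r t := by
  rcases hu with rfl | hu
  · exact ⟨t, hv, by omega, by omega⟩
  · exact exists_mem_sphere_of_rel hv hu

theorem isPartialSolution_of_solution [Std.Symm E]
    (hsat : ∀ v s s', (∀ u, u = v ∨ E v u → (u ∈ s ↔ u ∈ s')) → sat v s → sat v s') {y : Set V}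
    (hF : ∀ t, ∃ s ∈ F, ∀ v ∈ nearSphere E r t, (v ∈ s ↔ v ∈ y))
    (hy : ∀ t, ∀ v ∈ ball E r t, sat v y) (t : ℕ) {s : Set V}
    (hs : ∀ v ∈ nearSphere E r t, (v ∈ s ↔ v ∈ y)) : IsPartialSolution E sat F r t s := by
  have key : ∀ (t : ℕ) (s : Set V), (∀ v ∈ nearSphere E r t, (v ∈ s ↔ v ∈ y)) →
      ∀ v ∈ sphere E r t, sat v s :=
    fun t s hs v hv =>
      hsat v y _ (fun u hu => (hs u (mem_nearSphere_of_rel hv hu)).symm) (hy t v hv.1)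
  induction t generalizing s with
  | zero => exact key 0 s hs r ⟨rfl, by simp⟩
  | succ t ih =>
    obtain ⟨s', hs'F, hs'⟩ := hF t
    refine ⟨s', hs'F, ih hs', fun v hv => ?_, key _ s hs⟩
    have h : v ∈ nearSphere E r t ∧ v ∈ nearSphere E r (t + 1) :=
      hv.elim (fun h => ⟨⟨t, h, by omega, by omega⟩, ⟨t, h, by omega, by omega⟩⟩)
        fun h => ⟨⟨t + 1, h, by omega, by omega⟩, ⟨t + 1, h, by omega, by omega⟩⟩
    exact (hs v h.2).trans (hs' v h.1).symm

/-- Local constraints have a common solution if and only if, for every `r`, there is a candidate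
for the part of a solution close to a sphere around `r` of sufficiently large radius. The reason is
that on every connected component, the candidates for the spheres around an element of it combine
to a solution. -/
theorem exists_forall_sat_iff [Std.Symm E] {S : Set V} (hE : ∀ u v, E u v → v ∈ S)
    (hS : S.Finite) {n : ℕ} (hn : S.ncard ≤ n)
    (hsat : ∀ v s s', (∀ u, u = v ∨ E v u → (u ∈ s ↔ u ∈ s')) → sat v s → sat v s')
    (hF : ∀ r ∈ S, ∀ (y : Set V) t, ∃ s ∈ F, ∀ v ∈ nearSphere E r t, (v ∈ s ↔ v ∈ y)) :
    (∃ y, ∀ v ∈ S, sat v y) ↔ ∀ r ∈ S, ∃ s ∈ F, IsPartialSolution E sat F r n s := by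
  constructor
  · rintro ⟨y, hy⟩ r hr
    obtain ⟨s, hsF, hs⟩ := hF r hr y n
    exact ⟨s, hsF, isPartialSolution_of_solution hsat (hF r hr y)
      (fun t v hv => hy v (ball_subset hE hr hv)) n hs⟩
  · intro h
    have h₁ : ∀ r, ∃ y, r ∈ S → ∀ v, Relation.ReflTransGen E r v → sat v y := by
      intro r
      by_cases hr : r ∈ S
      · obtain ⟨s, -, hs⟩ := h r hr
        obtain ⟨y, hy, -⟩ := hs.exists_solution hsat
        refine ⟨y, fun _ v hv => hy v ?_⟩
        obtain ⟨t, ht⟩ := exists_mem_ball_iff.2 hv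
        exact ball_subset_ball_of_ncard_le hE hS hr hn t ht
      · exact ⟨∅, fun h => (hr h).elim⟩
    choose y hy using h₁
    have hsymm : ∀ u v, Relation.ReflTransGen E u v → Relation.ReflTransGen E v u := fun u v h => by
      induction h with
      | refl => exact .refl
      | tail _ h ih => exact .head (symm_of E h) ih
    -- The map `ρ` chooses a representative of every connected component.
    have h₂ : ∃ ρ : V → V, (∀ v, Relation.ReflTransGen E (ρ v) v) ∧
        ∀ u v, E u v → ρ u = ρ v := by
      let s : Setoid V := ⟨Relation.ReflTransGen E, fun _ => .refl, hsymm _ _, .trans⟩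
      exact ⟨fun v => (Quotient.mk s v).out, fun v => Quotient.mk_out (s := s) v,
        fun u v h => congrArg Quotient.out (Quotient.sound (s := s) (.single h))⟩
    obtain ⟨ρ, hρ, hρ'⟩ := h₂
    refine ⟨{v | v ∈ y (ρ v)}, fun v hv => hsat v (y (ρ v)) _ (fun u hu => ?_) (hy _ ?_ v (hρ v))⟩
    · rcases hu with rfl | hu
      · rfl
      · rw [hρ' v u hu]
        rfl
    · rcases (hsymm _ _ (hρ v)).cases_tail with h | ⟨u, -, h⟩
      · rwa [← h] at hv
      · exact hE _ _ h

end Solutions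

/-! ### Minors with a vertex cover of size one -/

section Minors

variable {V W : Type*}

/-- For an injective tuple of elements `a j ≠ c` of `S`, all `a j` with `j ∈ J` are adjacent to
elements that can be reached from `c` while avoiding all elements of the tuple. -/
def HasStar (E : V → V → Prop) (S : Set V) {m : ℕ} (J : Set (Fin m)) : Prop :=
  ∃ c ∈ S, ∃ a : Fin m → V, Injective a ∧ (∀ j, a j ∈ S ∧ a j ≠ c) ∧
    ∀ j ∈ J, ∃ t, ∃ u ∈ ball (fun u v => E u v ∧ ∀ j, a j ≠ v) c t, E u (a j)

/-- If there are no stars, then the spheres are small, because the ball inside of a sphere could be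
contracted to the center of a star. -/
theorem ncard_sphere_lt {E : V → V → Prop} {S : Set V} (hE : ∀ u v, E u v → v ∈ S) (hS : S.Finite)
    {m : ℕ} {J : Set (Fin m)} (h : ¬ HasStar E S J) {r : V} (hr : r ∈ S) (t : ℕ) :
    (sphere E r (t + 1)).ncard < m := by
  by_contra! hm
  have hfin : (sphere E r (t + 1)).Finite := hS.subset fun v hv => ball_subset hE hr hv.1
  have : Finite (sphere E r (t + 1)) := hfin
  have := Fintype.ofFinite (sphere E r (t + 1))
  obtain ⟨a⟩ : Nonempty (Fin m ↪ sphere E r (t + 1)) := by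
    refine Embedding.nonempty_of_card_le ?_
    rwa [Fintype.card_fin, ← Nat.card_eq_fintype_card, Nat.card_coe_set_eq]
  refine h ⟨r, hr, fun j => a j, Subtype.val_injective.comp a.injective, fun j => ⟨?_, fun h => ?_⟩,
    fun j _ => ?_⟩
  · exact ball_subset hE hr (a j).2.1
  · exact (a j).2.2 0 (Nat.succ_pos t) h
  · obtain ⟨h₁, h₂⟩ := mem_sphere_succ_iff.1 (a j).2
    obtain ⟨u, hu, hu'⟩ := h₁.resolve_left h₂
    refine ⟨t, u, ?_, hu'⟩
    have : ∀ s ≤ t, ball E r s ⊆ ball (fun u v => E u v ∧ ∀ j, (a j : V) ≠ v) r s := by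
      intro s
      induction s with
      | zero => exact fun _ => subset_rfl
      | succ s ih =>
        rintro hs v (hv | ⟨u, hu, h⟩)
        · exact .inl (ih (by omega) hv)
        · refine .inr ⟨u, ih (by omega) hu, h, fun j hj => ?_⟩
          refine (a j).2.2 (s + 1) (by omega) ?_
          rw [hj]
          exact .inr ⟨u, hu, h⟩
    exact this t le_rfl hu

theorem ncard_nearSphere_le {E : V → V → Prop} {S : Set V} (hE : ∀ u v, E u v → v ∈ S)
    (hS : S.Finite) {m : ℕ} {J : Set (Fin m)} (h : ¬ HasStar E S J) {r : V} (hr : r ∈ S) (t : ℕ) :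
    (nearSphere E r t).ncard ≤ 3 * (m + 1) := by
  have h₁ : ∀ t, (sphere E r t).ncard ≤ m + 1 := fun t => by
    rcases t with _ | t
    · have : sphere E r 0 ⊆ {r} := fun v hv => hv.1
      have := Set.ncard_le_ncard this
      rw [Set.ncard_singleton] at this
      omega
    · have := ncard_sphere_lt hE hS h hr t
      omega
  have h₂ : nearSphere E r t ⊆ sphere E r (t - 1) ∪ sphere E r t ∪ sphere E r (t + 1) := by
    rintro v ⟨i, hi, h₁, h₂⟩
    obtain rfl | rfl | rfl : i = t - 1 ∨ i = t ∨ i = t + 1 := by omega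
    · exact .inl (.inl hi)
    · exact .inl (.inr hi)
    · exact .inr hi
  have h₃ : ∀ t, (sphere E r t).Finite := fun t => hS.subset fun v hv => ball_subset hE hr hv.1
  calc (nearSphere E r t).ncard
      ≤ (sphere E r (t - 1) ∪ sphere E r t ∪ sphere E r (t + 1)).ncard :=
        Set.ncard_le_ncard h₂ (((h₃ _).union (h₃ _)).union (h₃ _))
    _ ≤ (sphere E r (t - 1)).ncard + (sphere E r t).ncard + (sphere E r (t + 1)).ncard :=
        (Set.ncard_union_le _ _).trans (Nat.add_le_add_right (Set.ncard_union_le _ _) _)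
    _ ≤ 3 * (m + 1) := by
        have := h₁ (t - 1)
        have := h₁ t
        have := h₁ (t + 1)
        omega

theorem mem_ball_map_iff {V' : Type*} {E : V → V → Prop} {E' : V' → V' → Prop} {f : V → V'}
    (h : ∀ u v', E' (f u) v' ↔ ∃ v, f v = v' ∧ E u v) {r : V} {v' : V'} {t : ℕ} :
    v' ∈ ball E' (f r) t ↔ ∃ v ∈ ball E r t, f v = v' := by
  induction t generalizing v' with
  | zero => exact ⟨fun h => ⟨r, rfl, h.symm⟩, by rintro ⟨_, rfl, h⟩; exact h.symm⟩
  | succ t ih =>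
    constructor
    · rintro (h' | ⟨u', h', h''⟩)
      · obtain ⟨v, hv, hv'⟩ := ih.1 h'
        exact ⟨v, .inl hv, hv'⟩
      · obtain ⟨u, hu, rfl⟩ := ih.1 h'
        obtain ⟨v, hv, hv'⟩ := (h u v').1 h''
        exact ⟨v, .inr ⟨u, hu, hv'⟩, hv⟩
    · rintro ⟨v, hv | ⟨u, hu, huv⟩, rfl⟩
      · exact .inl (ih.2 ⟨v, hv, rfl⟩)
      · exact .inr ⟨f u, ih.2 ⟨u, hu, rfl⟩, (h u _).2 ⟨v, rfl, huv⟩⟩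

/-- A star may be sought in the image of a relation under an injective map. -/
theorem hasStar_map_iff {V' : Type*} {E : V → V → Prop} {E' : V' → V' → Prop} {f : V → V'}
    (hf : Injective f) (h : ∀ u v', E' (f u) v' ↔ ∃ v, f v = v' ∧ E u v) {m : ℕ}
    {J : Set (Fin m)} : HasStar E' (Set.range f) J ↔ HasStar E Set.univ J := by
  have hball : ∀ (a : Fin m → V) (c : V) t v', v' ∈
      ball (fun u v => E' u v ∧ ∀ j, f (a j) ≠ v) (f c) t ↔
        ∃ v ∈ ball (fun u v => E u v ∧ ∀ j, a j ≠ v) c t, f v = v' := fun a c t v' => by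
    refine mem_ball_map_iff fun u v' => ?_
    rw [h]
    constructor
    · rintro ⟨⟨v, rfl, h₁⟩, h₂⟩
      exact ⟨v, rfl, h₁, fun j hj => h₂ j (congrArg f hj)⟩
    · rintro ⟨v, rfl, h₁, h₂⟩
      exact ⟨⟨v, rfl, h₁⟩, fun j hj => h₂ j (hf hj)⟩
  constructor
  · rintro ⟨_, ⟨c, rfl⟩, b, hb, hbc, hbJ⟩
    choose a ha using fun j => (hbc j).1
    obtain rfl : (fun j => f (a j)) = b := funext ha
    refine ⟨c, trivial, a, fun i j hij => hb (congrArg f hij), fun j => ⟨trivial, fun h => ?_⟩,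
      fun j hj => ?_⟩
    · exact (hbc j).2 (congrArg f h)
    · obtain ⟨t, _, hu, huj⟩ := hbJ j hj
      obtain ⟨u, hu₁, rfl⟩ := (hball a c t _).1 hu
      obtain ⟨v, hv, hv'⟩ := (h _ _).1 huj
      exact ⟨t, u, hu₁, hf hv ▸ hv'⟩
  · rintro ⟨c, -, a, ha, hac, haJ⟩
    refine ⟨f c, ⟨c, rfl⟩, fun j => f (a j), hf.comp ha, fun j => ⟨⟨_, rfl⟩, hf.ne (hac j).2⟩,
      fun j hj => ?_⟩
    obtain ⟨t, u, hu, huj⟩ := haJ j hj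
    exact ⟨t, f u, (hball a c t _).2 ⟨u, hu, rfl⟩, (h _ _).2 ⟨_, rfl, huj⟩⟩

/-- If all edges of `X` are incident to `w₀`, then `X` is a minor of `G` if and only if `G` contains
a star whose center is a connected set of vertices, and as many further vertices as there are
isolated vertices of `X`: the branch sets of the vertices other than `w₀` can be shrunk to single
vertices. -/
theorem isMinorOf_iff_hasStar {X : SimpleGraph W} {G : SimpleGraph V} {w₀ : W}
    (hX : ∀ v w, X.Adj v w → v = w₀ ∨ w = w₀) {m : ℕ} (e : Fin m ≃ {w // w ≠ w₀}) :
    IsMinorOf X G ↔ HasStar G.Adj Set.univ {j | X.Adj w₀ (e j)} := by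
  constructor
  · rintro ⟨H, φ, hφ, hφX⟩
    have hne : ∀ w, ∃ v, φ v = w := fun w => by
      obtain ⟨⟨v, hv⟩⟩ := (hφ w).nonempty
      exact ⟨v, hv⟩
    obtain ⟨c, hc⟩ := hne w₀
    have h₁ : ∀ j, ∃ v, φ v = e j ∧ (X.Adj w₀ (e j) → ∃ u, φ u = w₀ ∧ H.coe.Adj u v) := by
      intro j
      by_cases h : X.Adj w₀ (e j)
      · obtain ⟨u, v, hu, hv, huv⟩ := (hφX _ _ (e j).2.symm).1 h
        exact ⟨v, hv, fun _ => ⟨u, hu, huv⟩⟩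
      · obtain ⟨v, hv⟩ := hne (e j)
        exact ⟨v, hv, fun h' => (h h').elim⟩
    choose a ha ha' using h₁
    have hinj : Injective a := fun i j hij => by
      have := ha i
      rw [hij, ha j] at this
      exact e.injective (Subtype.ext this.symm)
    refine ⟨c, trivial, fun j => a j, Subtype.val_injective.comp hinj, fun j => ⟨trivial, ?_⟩, ?_⟩
    · intro h
      have h := Subtype.val_injective h
      apply (e j).2
      rw [← ha j, h, hc]
    · intro j hj
      obtain ⟨u, hu, huv⟩ := ha' j hj
      have h₂ := (SimpleGraph.reachable_iff_reflTransGen _ _).1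
        ((hφ w₀).preconnected ⟨c, hc⟩ ⟨u, hu⟩)
      -- The branch set of `w₀` is connected and avoids the leaves, which lie in other branch sets.
      have h₃ : Relation.ReflTransGen (fun u v => G.Adj u v ∧ ∀ j, (a j : V) ≠ v) c u := by
        refine Relation.ReflTransGen.lift (fun v : φ ⁻¹' {w₀} => v.1.1)
          (fun x y hxy => ⟨H.adj_sub hxy, fun i hi => ?_⟩) _ _ h₂
        have hi := Subtype.val_injective hi
        apply (e i).2
        rw [← ha i, hi]
        exact y.2
      obtain ⟨t, ht⟩ := exists_mem_ball_iff.2 h₃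
      exact ⟨t, u, ht, H.adj_sub huv⟩
  · rintro ⟨c, -, a, ha, hac, haJ⟩
    let C : Set V := {v | Relation.ReflTransGen (fun u v => G.Adj u v ∧ ∀ j, a j ≠ v) c v}
    have haC : ∀ j, a j ∉ C := fun j hj => by
      rcases Relation.ReflTransGen.cases_tail hj with h | ⟨u, -, h⟩
      · exact (hac j).2 h
      · exact h.2 j rfl
    -- The edges of `H` are those within the center and from the center to the leaves of the star.
    let H : G.Subgraph :=
      { verts := C ∪ Set.range a
        Adj u v := G.Adj u v ∧ (u ∈ C ∧ v ∈ C ∨ u ∈ C ∧ (∃ j, X.Adj w₀ (e j) ∧ a j = v) ∨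
          v ∈ C ∧ (∃ j, X.Adj w₀ (e j) ∧ a j = u))
        adj_sub := And.left
        edge_vert := by
          rintro u v ⟨-, h | h | ⟨-, j, -, h⟩⟩
          · exact .inl h.1
          · exact .inl h.1
          · exact .inr ⟨j, h⟩
        symm := ⟨fun u v h => ⟨h.1.symm,
          h.2.imp And.symm Or.symm⟩⟩ }
    classical
    let φ : H.verts → W := fun v => if h : ∃ j, a j = v then e h.choose else w₀
    have hφC : ∀ v : H.verts, φ v = w₀ ↔ v.1 ∈ C := by
      intro v
      by_cases h : ∃ j, a j = v
      · simp only [φ, dif_pos h]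
        exact iff_of_false (e h.choose).2 (h.choose_spec ▸ haC _)
      · simp only [φ, dif_neg h, true_iff]
        exact v.2.resolve_right h
    have hφa : ∀ (v : H.verts) j, φ v = e j ↔ v.1 = a j := by
      intro v j
      by_cases h : ∃ j, a j = v
      · simp only [φ, dif_pos h]
        rw [Subtype.val_injective.eq_iff, e.injective.eq_iff, ← ha.eq_iff, h.choose_spec]
      · simp only [φ, dif_neg h]
        exact iff_of_false (e j).2.symm fun h' => h ⟨j, h'.symm⟩
    have hcases : ∀ w, w = w₀ ∨ ∃ j, w = e j := fun w => by
      by_cases h : w = w₀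
      · exact .inl h
      · exact .inr ⟨e.symm ⟨w, h⟩, by simp⟩
    refine ⟨H, φ, fun w => ?_, fun v w hvw => ?_⟩
    · rcases hcases w with rfl | ⟨j, rfl⟩
      · have hc : c ∈ C := .refl
        let c' : φ ⁻¹' {w} := ⟨⟨c, .inl hc⟩, (hφC _).2 hc⟩
        have h₁ : ∀ v (hv : v ∈ C), (H.coe.induce (φ ⁻¹' {w})).Reachable c'
            ⟨⟨v, .inl hv⟩, (hφC _).2 hv⟩ := by
          intro v hv
          induction hv with
          | refl => exact .refl _
          | tail hu h ih =>
            refine ih.trans (SimpleGraph.Adj.reachable ?_)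
            exact ⟨h.1, .inl ⟨hu, .tail hu h⟩⟩
        have : Nonempty (φ ⁻¹' {w}) := ⟨c'⟩
        refine ⟨fun x y => ?_⟩
        exact (h₁ x.1 ((hφC _).1 x.2)).symm.trans (h₁ y.1 ((hφC _).1 y.2))
      · have hj : φ ⟨a j, .inr ⟨j, rfl⟩⟩ = e j := (hφa _ _).2 rfl
        have : Nonempty (φ ⁻¹' {(e j : W)}) := ⟨⟨_, hj⟩⟩
        refine ⟨fun x y => ?_⟩
        have : x = y := Subtype.ext (Subtype.ext
          (((hφa _ _).1 x.2).trans ((hφa _ _).1 y.2).symm))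
        rw [this]
    · have hcenter : ∀ j, X.Adj w₀ (e j) → ∃ u v, φ u = w₀ ∧ φ v = e j ∧ H.coe.Adj u v := by
        intro j hj
        obtain ⟨t, u, hu, huv⟩ := haJ j hj
        have hu : u ∈ C := exists_mem_ball_iff.1 ⟨t, hu⟩
        exact ⟨⟨u, .inl hu⟩, ⟨a j, .inr ⟨j, rfl⟩⟩, (hφC _).2 hu, (hφa _ _).2 rfl, huv,
          .inr (.inl ⟨hu, j, hj, rfl⟩)⟩
      constructor
      · intro h
        rcases hX v w h with rfl | rfl
        · obtain ⟨j, rfl⟩ := (hcases w).resolve_left hvw.symm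
          exact hcenter j h
        · obtain ⟨j, rfl⟩ := (hcases v).resolve_left hvw
          obtain ⟨u, v, hu, hv, huv⟩ := hcenter j h.symm
          exact ⟨v, u, hv, hu, huv.symm⟩
      · rintro ⟨x, y, rfl, rfl, h⟩
        rcases h.2 with h | ⟨h, j, hj, h'⟩ | ⟨h, j, hj, h'⟩
        · exact (hvw (((hφC x).2 h.1).trans ((hφC y).2 h.2).symm)).elim
        · rwa [(hφC x).2 h, (hφa y j).2 h'.symm]
        · rw [(hφC y).2 h, (hφa x j).2 h'.symm]
          exact hj.symm

end Minors

/-! ### Definability of stars and of partial solutions -/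

section

variable {Γ : Type} [Fintype Γ] [DecidableEq Γ] {C : Type} [NatTuple C] {o : ℕ}

namespace Definable

theorem mem_range {k : ℕ} {x : C → ℕ} {a : C → Fin k → ℕ} (hx : IsSelection x := by fun_prop)
    (ha : IsSelection a := by fun_prop) :
    Definable o fun (_ : List Γ) _ c => x c ∈ Set.range (a c) :=
  exists_finite (P := fun j _ _ c => a c j = x c) fun _ => .eq

theorem lt_count (a : Γ) {x : C → ℕ} (hx : IsSelection x := by fun_prop) :
    Definable o fun (w : List Γ) _ c => x c < w.count a :=
  (ex (P := fun w _ c y => w.count a = y ∧ x c < y) (.and (.count a) .lt)).congr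
    fun w _ c _ => by simpa using fun _ => List.count_le_length

end Definable

namespace StageDefinable

theorem ball {E : List Γ → C → ℕ → ℕ → Prop}
    (hE : StageDefinable fun w (d : C × ℕ × ℕ) => E w d.1 d.2.1 d.2.2)
    (hb : ∀ w c u v, E w c u v → u ≤ w.length) :
    StageDefinable fun w (d : C × ℕ × ℕ × ℕ) => d.2.2.2 ∈ ball (E w d.1) d.2.1 d.2.2.1 := by
  have hΦ : Definable (Γ := Γ) (dim (C × ℕ × ℕ × ℕ)) fun w A (d : C × ℕ × ℕ × ℕ) =>
      (d.2.2.1 = 0 ∧ d.2.2.2 = d.2.1) ∨ ∃ t ≤ w.length, t + 1 = d.2.2.1 ∧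
        (A (entries (d.1, d.2.1, t, d.2.2.2)) = true ∨
          ∃ u ≤ w.length, A (entries (d.1, d.2.1, t, u)) = true ∧ E w d.1 u d.2.2.2) :=
    .or (.and .zero .eq) (.ex (.and .succ (.or .oracle (.ex (.and .oracle hE.definable₃)))))
  refine .of_recursion hΦ (fun _ d => d.2.2.1) (fun w d hd => ?_) fun w A ⟨c, r, t, v⟩ hd ih => ?_
  · simp only [bounded_prod, bounded_nat] at hd
    exact hd.2.2.1
  · simp only [bounded_prod, bounded_nat, Prod.forall] at hd ih ⊢
    rcases t with _ | t
    · simp [_root_.ball]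
    · have ih' : ∀ v ≤ w.length, (A (entries (c, r, t, v)) = true ↔ v ∈ _root_.ball (E w c) r t) :=
        fun v hv => ih _ _ _ _ ⟨hd.1, hd.2.1, by omega, hv⟩ (Nat.lt_succ_self t)
      simp only [Nat.add_one_ne_zero, false_and, false_or, Nat.add_right_cancel_iff]
      constructor
      · rintro ⟨_, _, rfl, h | ⟨u, hu, h, h'⟩⟩
        · exact .inl ((ih' v hd.2.2.2).1 h)
        · exact .inr ⟨u, (ih' u hu).1 h, h'⟩
      · rintro (h | ⟨u, hu, h⟩)
        · exact ⟨t, by omega, rfl, .inl ((ih' v hd.2.2.2).2 h)⟩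
        · exact ⟨t, by omega, rfl, .inr ⟨u, hb _ _ _ _ h, (ih' u (hb _ _ _ _ h)).2 hu, h⟩⟩

theorem sphere {E : List Γ → ℕ → ℕ → Prop}
    (hE : StageDefinable fun w (d : ℕ × ℕ) => E w d.1 d.2)
    (hb : ∀ w u v, E w u v → u ≤ w.length) :
    StageDefinable fun w (d : ℕ × ℕ × ℕ) => d.2.2 ∈ sphere (E w) d.1 d.2.1 := by
  have h : StageDefinable fun w (d : ℕ × ℕ × ℕ) => d.2.2 ∈ _root_.ball (E w) d.1 d.2.1 :=
    of_definable ((ball (C := Unit) (E := fun w _ => E w) (of_definable hE.definable₂)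
      fun w _ => hb w).definable (f := fun d => ((), d)))
  have h' : Definable (dim (ℕ × ℕ × ℕ)) fun w _ (d : ℕ × ℕ × ℕ) =>
      d.2.2 ∈ _root_.ball (E w) d.1 d.2.1 ∧
        ∀ s ≤ w.length, s < d.2.1 → ¬ d.2.2 ∈ _root_.ball (E w) d.1 s :=
    .and (h.definable₃ (R := fun w r t v => v ∈ _root_.ball (E w) r t))
      (.all (.imp .lt (.not
        (h.definable₃ (R := fun w r t v => v ∈ _root_.ball (E w) r t)))))
  refine of_definable (h'.congr fun w _ d hd => ?_)
  simp only [bounded_prod, bounded_nat] at hd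
  exact and_congr_right fun _ => ⟨fun h s hs => h s (by omega) hs, fun h s _ => h s⟩

end StageDefinable

theorem Definable.hasStar {E : List Γ → ℕ → ℕ → Prop}
    (hE : StageDefinable fun w (d : ℕ × ℕ) => E w d.1 d.2) {a : Γ}
    (hEa : ∀ w u v, E w u v → u < w.count a ∧ v < w.count a) {m : ℕ} (J : Set (Fin m)) :
    Definable o fun w _ (_ : C) => HasStar (E w) (Set.Iio (w.count a)) J := by
  have hle : ∀ (w : List Γ) v, v < w.count a → v ≤ w.length := fun w v hv =>
    hv.le.trans List.count_le_length
  have hball : StageDefinable fun w (d : (Fin m → ℕ) × ℕ × ℕ × ℕ) =>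
      d.2.2.2 ∈ ball (fun u v => E w u v ∧ ∀ j, d.1 j ≠ v) d.2.1 d.2.2.1 :=
    .ball (E := fun w (b : Fin m → ℕ) u v => E w u v ∧ ∀ j, b j ≠ v)
      (.of_definable (.and hE.definable₂ (.forall_finite fun _ => .not .eq)))
      fun w b u v h => hle w u (hEa w u v h.1).1
  have h : Definable (C := C) o fun w _ _ => ∃ c ≤ w.length, c < w.count a ∧
      ∃ b : Fin m → ℕ, (∀ j, b j ≤ w.length) ∧ (∀ i j, b i = b j → i = j) ∧
        (∀ j, b j < w.count a ∧ b j ≠ c) ∧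
        ∀ j, j ∈ J → ∃ t ≤ w.length, ∃ u ≤ w.length,
          u ∈ ball (fun u v => E w u v ∧ ∀ j, b j ≠ v) c t ∧ E w u (b j) :=
    .ex (.and (.lt_count a) (.exTuple (.and
      (.forall_finite fun _ => .forall_finite fun _ => .imp .eq (.const _))
      (.and (.forall_finite fun _ => .and (.lt_count a) (.not .eq))
        (.forall_finite fun _ => .imp (.const _) (.ex (.ex (.and
          (hball.definable₄ (R := fun w (b : Fin m → ℕ) c t u =>
            u ∈ ball (fun u v => E w u v ∧ ∀ j, b j ≠ v) c t)) hE.definable₂))))))))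
  refine h.congr fun w _ _ _ => ?_
  constructor
  · rintro ⟨c, _, hc, b, _, h₁, h₂, h₃⟩
    refine ⟨c, hc, b, h₁, h₂, fun j hj => ?_⟩
    obtain ⟨t, _, u, _, h₄, h₅⟩ := h₃ j hj
    exact ⟨t, u, h₄, h₅⟩
  · rintro ⟨c, hc, b, h₁, h₂, h₃⟩
    refine ⟨c, hle w c hc, hc, b, fun j => hle w _ (h₂ j).1, h₁, h₂, fun j hj => ?_⟩
    obtain ⟨t, u, h₄, h₅⟩ := h₃ j hj
    -- The radius `t` may exceed `w.length`, but balls do not grow any more beyond that radius.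
    refine ⟨w.length, le_rfl, u, hle w u (hEa w u _ h₅).1, ?_, h₅⟩
    refine ball_subset_ball_of_ncard_le (S := Set.Iio (w.count a)) (fun u v h => (hEa w u v h.1).2)
      (Set.finite_Iio _) hc ?_ t h₄
    rw [← Finset.coe_Iio, Set.ncard_coe_finset, Nat.card_Iio]
    exact List.count_le_length

theorem StageDefinable.isPartialSolution {E : List Γ → ℕ → ℕ → Prop}
    (hE : StageDefinable fun w (d : ℕ × ℕ) => E w d.1 d.2)
    (hb : ∀ w u v, E w u v → u ≤ w.length ∧ v ≤ w.length) {sat : List Γ → ℕ → Set ℕ → Prop} {k : ℕ}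
    (hsat : StageDefinable fun w (d : ℕ × (Fin k → ℕ)) => sat w d.1 (Set.range d.2)) :
    StageDefinable fun w (d : ℕ × ℕ × (Fin k → ℕ)) => IsPartialSolution (E w) (sat w)
      {s | ∃ a : Fin k → ℕ, (∀ j, a j ≤ w.length) ∧ Set.range a = s} d.1 d.2.1
        (Set.range d.2.2) := by
  have hS := StageDefinable.sphere hE fun w u v h => (hb w u v h).1
  have hSle : ∀ w r t v, r ≤ w.length → v ∈ _root_.sphere (E w) r t → v ≤ w.length :=
    fun w r t v hr h => ball_subset (S := Set.Iic w.length) (fun u v h => (hb w u v h).2) hr h.1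
  have hΦ : Definable (Γ := Γ) (dim (ℕ × ℕ × (Fin k → ℕ))) fun w A (d : ℕ × ℕ × (Fin k → ℕ)) =>
      (d.2.1 = 0 ∧ sat w d.1 (Set.range d.2.2)) ∨ ∃ t ≤ w.length, t + 1 = d.2.1 ∧
        ∃ a : Fin k → ℕ, (∀ j, a j ≤ w.length) ∧ A (entries (d.1, t, a)) = true ∧
          (∀ v ≤ w.length, v ∈ _root_.sphere (E w) d.1 t ∨ v ∈ _root_.sphere (E w) d.1 d.2.1 →
            (v ∈ Set.range d.2.2 ↔ v ∈ Set.range a)) ∧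
          ∀ v ≤ w.length, v ∈ _root_.sphere (E w) d.1 d.2.1 → sat w v (Set.range d.2.2) :=
    .or (.and .zero (hsat.definable₂ (R := fun w r (a : Fin k → ℕ) => sat w r (Set.range a))))
      (.ex (.and .succ (.exTuple (.and .oracle (.and
        (.all (.imp (.or (hS.definable₃ (R := fun w r t v => v ∈ _root_.sphere (E w) r t))
          (hS.definable₃ (R := fun w r t v => v ∈ _root_.sphere (E w) r t)))
          (.iff .mem_range .mem_range)))
        (.all (.imp (hS.definable₃ (R := fun w r t v => v ∈ _root_.sphere (E w) r t))
          (hsat.definable₂ (R := fun w r (a : Fin k → ℕ) => sat w r (Set.range a))))))))))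
  refine .of_recursion hΦ (fun _ d => d.2.1) (fun w d hd => ?_) fun w A ⟨r, t, a⟩ hd ih => ?_
  · simp only [bounded_prod, bounded_nat] at hd
    exact hd.2.1
  · simp only [bounded_prod, bounded_nat, bounded_fin, Prod.forall] at hd ih ⊢
    rcases t with _ | t
    · simp [IsPartialSolution]
    · have ih' : ∀ a' : Fin k → ℕ, (∀ j, a' j ≤ w.length) → _ := fun a' ha' =>
        ih r t a' ⟨hd.1, by omega, ha'⟩ (Nat.lt_succ_self t)
      simp only [Nat.add_one_ne_zero, false_and, false_or, Nat.add_right_cancel_iff]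
      constructor
      · rintro ⟨_, _, rfl, a', ha', h₁, h₂, h₃⟩
        refine ⟨_, ⟨a', ha', rfl⟩, (ih' a' ha').1 h₁, fun v hv => h₂ v ?_ hv,
          fun v hv => h₃ v ?_ hv⟩
        · exact hv.elim (hSle w r _ v hd.1) (hSle w r _ v hd.1)
        · exact hSle w r _ v hd.1 hv
      · rintro ⟨_, ⟨a', ha', rfl⟩, h₁, h₂, h₃⟩
        exact ⟨t, by omega, rfl, a', ha', (ih' a' ha').2 h₁, fun v _ => h₂ v, fun v _ => h₃ v⟩

end

/-! ### Descriptions of systems -/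

instance (B : LogicalBasis) : Finite (Token B) := by
  let f : Unit ⊕ Bool ⊕ Unit ⊕ Fin B.numGates ⊕ Unit ⊕ Unit ⊕ Unit → Token B := fun x =>
    match x with
    | .inl _ => .vertex
    | .inr (.inl b) => .adj b
    | .inr (.inr (.inl _)) => .var
    | .inr (.inr (.inr (.inl g))) => .gate g
    | .inr (.inr (.inr (.inr (.inl _)))) => .ref
    | .inr (.inr (.inr (.inr (.inr (.inl _))))) => .out
    | .inr (.inr (.inr (.inr (.inr (.inr _))))) => .one
  refine Finite.of_surjective f fun a => ?_
  cases a with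
  | vertex => exact ⟨.inl (), rfl⟩
  | adj b => exact ⟨.inr (.inl b), rfl⟩
  | var => exact ⟨.inr (.inr (.inl ())), rfl⟩
  | gate g => exact ⟨.inr (.inr (.inr (.inl g))), rfl⟩
  | ref => exact ⟨.inr (.inr (.inr (.inr (.inl ())))), rfl⟩
  | out => exact ⟨.inr (.inr (.inr (.inr (.inr (.inl ()))))), rfl⟩
  | one => exact ⟨.inr (.inr (.inr (.inr (.inr (.inr ()))))), rfl⟩

noncomputable instance (B : LogicalBasis) : Fintype (Token B) := Fintype.ofFinite _

noncomputable instance (B : LogicalBasis) : DecidableEq (Token B) := Classical.decEq _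

/-- A way to describe boolean functions of the elements of a set of vertices by strings. -/
structure CodeScheme (B : LogicalBasis) where
  /-- the descriptions of functions -/
  Code : {n : ℕ} → Set (Fin n) → Type
  /-- the string for a description -/
  encode : {n : ℕ} → {A : Set (Fin n)} → Code A → List (Token B)
  /-- the function that is described -/
  eval : {n : ℕ} → {A : Set (Fin n)} → (A → Bool) → Code A → Bool
  vertex_notMem : ∀ {n : ℕ} {A : Set (Fin n)} (c : Code A), .vertex ∉ encode c
  eval_eq : ∀ {n : ℕ} {A : Set (Fin n)} (c c' : Code A), encode c = encode c' →
    ∀ x, eval x c = eval x c'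

namespace CodeScheme

variable {B : LogicalBasis} (𝒞 : CodeScheme B)

/-- The string for a system with the graph `G` and the functions described by `c`. -/
noncomputable def systemEncode {n : ℕ} (G : SimpleGraph (Fin n))
    (c : (i : Fin n) → 𝒞.Code (closedNbhd G i)) : List (Token B) :=
  (List.ofFn fun i => .vertex :: (encodeRow G i ++ 𝒞.encode (c i))).flatten

/-- The fixed-point existence problem for systems in which the functions are described by the
codes of `𝒞`. -/
def language (𝒢 : GraphClass) : Language (Token B) :=
  {w | ∃ (n : ℕ) (G : SimpleGraph (Fin n)) (c : (i : Fin n) → 𝒞.Code (closedNbhd G i)),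
    𝒞.systemEncode G c = w ∧ G ∈ 𝒢 n ∧ ∃ x : Fin n → Bool, ∀ i, 𝒞.eval (fun j => x j) (c i) = x i}

/-- The entry in row `i` and column `j` of the adjacency matrix in `w` is `1`. -/
def WordAdj (w : List (Token B)) (i j : ℕ) : Prop :=
  i < w.count .vertex ∧ j < w.count .vertex ∧
    ∃ p, IsBlockStart .vertex w i p ∧ w[p + 1 + j]? = some (.adj true)

/-- The vertices on which the function of the vertex `v` may depend. -/
def wordNbhd (w : List (Token B)) (v : ℕ) : Set (Fin (w.count .vertex)) :=
  {j | j.1 = v ∨ WordAdj w v j}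

open Classical in
/-- The characteristic function of a set of numbers, as a configuration of the vertices in `A`. -/
noncomputable def indicator {n : ℕ} (A : Set (Fin n)) (s : Set ℕ) (j : A) : Bool :=
  decide (j.1.1 ∈ s)

theorem indicator_eq_true_iff {n : ℕ} {A : Set (Fin n)} {s : Set ℕ} {j : A} :
    indicator A s j = true ↔ j.1.1 ∈ s := by
  simp [indicator]

/-- The segment of `w` from `p` to `q` describes a function for the vertex `v` whose value for the
configuration `s` is `true` if `β = 0`, and `false` if `β ≠ 0`. (The truth value is given by a
number in order that this is a relation between positions and sets of positions.) -/
def IsCode (w : List (Token B)) (v : ℕ) (s : Set ℕ) (p q β : ℕ) : Prop :=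
  ∃ c : 𝒞.Code (wordNbhd w v), IsSegment w p q (𝒞.encode c) ∧
    (𝒞.eval (indicator _ s) c = true ↔ β = 0)

/-- The block of the vertex `v` contains a description of a function whose value for the
configuration `s` is given by `β`, as in `CodeScheme.IsCode`. -/
def IsVertexCode (w : List (Token B)) (v : ℕ) (s : Set ℕ) (β : ℕ) : Prop :=
  ∃ p q, IsBlockStart .vertex w v p ∧ IsBlockStart .vertex w (v + 1) q ∧
    𝒞.IsCode w v s (p + 1 + w.count .vertex) q β

/-- The configuration `s` is a fixed point of the function described for the vertex `v`. -/
def IsFixedAt (w : List (Token B)) (v : ℕ) (s : Set ℕ) : Prop :=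
  v < w.count .vertex ∧ ∃ β ≤ w.length, 𝒞.IsVertexCode w v s β ∧ (v ∈ s ↔ β = 0)

/-- The string `w` describes a system. (That the block of a vertex contains the description of a
function is expressed by its having a value for the empty configuration, the range of the empty
tuple.) -/
def IsValid (w : List (Token B)) : Prop :=
  IsBlockStart .vertex w 0 0 ∧
    ∀ i < w.count .vertex, ¬ WordAdj w i i ∧
      (∀ j < w.count .vertex, WordAdj w i j → WordAdj w j i) ∧
      (∃ p, IsBlockStart .vertex w i p ∧ ∀ j < w.count .vertex, ∃ b,
        w[p + 1 + j]? = some (.adj b)) ∧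
      ∃ (a : Fin 0 → ℕ), ∃ β ≤ w.length, 𝒞.IsVertexCode w i (Set.range a) β

variable {𝒞} {w : List (Token B)}

theorem WordAdj.lt {i j : ℕ} (h : WordAdj w i j) : i < w.count .vertex ∧ j < w.count .vertex :=
  ⟨h.1, h.2.1⟩

theorem vertex_notMem_row_append {n : ℕ} (G : SimpleGraph (Fin n))
    (c : (i : Fin n) → 𝒞.Code (closedNbhd G i)) (i : Fin n) :
    .vertex ∉ encodeRow G i ++ 𝒞.encode (c i) := by
  simp [encodeRow, List.mem_ofFn, 𝒞.vertex_notMem]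

theorem count_systemEncode {n : ℕ} {G : SimpleGraph (Fin n)}
    {c : (i : Fin n) → 𝒞.Code (closedNbhd G i)} (h : 𝒞.systemEncode G c = w) :
    w.count .vertex = n :=
  (flatten_ofFn_blocks (vertex_notMem_row_append G c) h).1

section Encoding

variable {G : SimpleGraph (Fin (w.count .vertex))}
  {c : (i : Fin (w.count .vertex)) → 𝒞.Code (closedNbhd G i)}

theorem exists_blocks (h : 𝒞.systemEncode G c = w) : IsBlockStart .vertex w 0 0 ∧
    ∀ i : Fin (w.count .vertex), ∃ p q, IsBlockStart .vertex w i p ∧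
      IsBlockStart .vertex w (i + 1) q ∧
        IsSegment w (p + 1) (p + 1 + w.count .vertex) (encodeRow G i) ∧
          IsSegment w (p + 1 + w.count .vertex) q (𝒞.encode (c i)) := by
  obtain ⟨-, h₀, h⟩ := flatten_ofFn_blocks (vertex_notMem_row_append G c) h
  refine ⟨h₀, fun i => ?_⟩
  obtain ⟨p, q, hp, hq, h₁, h₂⟩ := h i
  obtain ⟨m, hm, h₂⟩ := IsSegment.append_iff.1 h₂
  have := hm.length_eq
  rw [encodeRow, List.length_ofFn] at this
  subst this
  exact ⟨p, q, hp, hq, hm, h₂⟩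

theorem wordAdj_iff (h : 𝒞.systemEncode G c = w) {i j : ℕ} :
    WordAdj w i j ↔ ∃ hi hj, G.Adj ⟨i, hi⟩ ⟨j, hj⟩ := by
  rw [WordAdj, ← exists_prop]
  refine exists_congr fun hi => ?_
  rw [← exists_prop]
  refine exists_congr fun hj => ?_
  obtain ⟨p, q, hp, hq, hrow, -⟩ := (exists_blocks h).2 ⟨i, hi⟩
  have := (IsSegment.ofFn_iff.1 hrow).2 ⟨j, hj⟩
  simp only at this
  constructor
  · rintro ⟨p', hp', h'⟩
    rw [hp'.unique hp, this] at h'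
    simpa using h'
  · exact fun h' => ⟨p, hp, by simpa [h'] using this⟩

theorem wordNbhd_eq (h : 𝒞.systemEncode G c = w) (i : Fin (w.count .vertex)) :
    wordNbhd w i = closedNbhd G i := by
  ext j
  simp [wordNbhd, closedNbhd, wordAdj_iff h, Fin.ext_iff]

theorem isCode_iff (h : 𝒞.systemEncode G c = w) (i : Fin (w.count .vertex)) (s : Set ℕ)
    (p q β : ℕ) : 𝒞.IsCode w i s p q β ↔ ∃ c : 𝒞.Code (closedNbhd G i),
      IsSegment w p q (𝒞.encode c) ∧ (𝒞.eval (indicator _ s) c = true ↔ β = 0) := by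
  rw [IsCode, wordNbhd_eq h]

theorem isVertexCode_iff (h : 𝒞.systemEncode G c = w) (i : Fin (w.count .vertex)) (s : Set ℕ)
    (β : ℕ) : 𝒞.IsVertexCode w i s β ↔ (𝒞.eval (indicator _ s) (c i) = true ↔ β = 0) := by
  obtain ⟨p, q, hp, hq, -, hc⟩ := (exists_blocks h).2 i
  rw [IsVertexCode]
  simp only [isCode_iff h]
  constructor
  · rintro ⟨p', q', hp', hq', c', hc', hβ⟩
    rw [hp'.unique hp, hq'.unique hq] at hc'
    rwa [𝒞.eval_eq _ _ (hc.unique hc')]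
  · exact fun hβ => ⟨p, q, hp, hq, c i, hc, hβ⟩

theorem isFixedAt_iff (h : 𝒞.systemEncode G c = w) (i : Fin (w.count .vertex)) (s : Set ℕ) :
    𝒞.IsFixedAt w i s ↔ (𝒞.eval (indicator _ s) (c i) = true ↔ i.1 ∈ s) := by
  simp only [IsFixedAt, i.2, true_and, isVertexCode_iff h]
  constructor
  · rintro ⟨β, _, h₁, h₂⟩
    exact h₁.trans h₂.symm
  · intro h
    by_cases hi : i.1 ∈ s
    · exact ⟨0, by omega, by simp [h, hi]⟩
    · exact ⟨1, (Nat.succ_le_of_lt (i.pos)).trans List.count_le_length, by simp [h, hi]⟩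

theorem isValid_of_systemEncode (h : 𝒞.systemEncode G c = w) : 𝒞.IsValid w := by
  refine ⟨(exists_blocks h).1, fun i hi => ⟨?_, fun j hj => ?_, ?_, fun j => j.elim0, ?_⟩⟩
  · simp [wordAdj_iff h]
  · rw [wordAdj_iff h, wordAdj_iff h]
    rintro ⟨_, _, h⟩
    exact ⟨_, _, h.symm⟩
  · obtain ⟨p, q, hp, hq, hrow, -⟩ := (exists_blocks h).2 ⟨i, hi⟩
    exact ⟨p, hp, fun j hj => ⟨_, (IsSegment.ofFn_iff.1 hrow).2 ⟨j, hj⟩⟩⟩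
  · have := isVertexCode_iff h ⟨i, hi⟩ (Set.range fun j : Fin 0 => j.elim0)
    by_cases h' : 𝒞.eval (indicator _ (Set.range fun j : Fin 0 => j.elim0)) (c ⟨i, hi⟩) = true
    · exact ⟨0, by omega, (this 0).2 (iff_of_true h' rfl)⟩
    · exact ⟨1, (Nat.succ_le_of_lt (Nat.zero_lt_of_lt hi)).trans List.count_le_length,
        (this 1).2 (iff_of_false h' one_ne_zero)⟩

end Encoding

theorem IsValid.exists_systemEncode (h : 𝒞.IsValid w) :
    ∃ (G : SimpleGraph (Fin (w.count .vertex)))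
      (c : (i : Fin (w.count .vertex)) → 𝒞.Code (closedNbhd G i)), 𝒞.systemEncode G c = w := by
  obtain ⟨h₀, h⟩ := h
  let G : SimpleGraph (Fin (w.count .vertex)) :=
    { Adj := fun i j => WordAdj w i j
      symm := ⟨fun i j => (h i i.2).2.1 j j.2⟩
      loopless := ⟨fun i => (h i i.2).1⟩ }
  have hG : ∀ i : Fin (w.count .vertex), wordNbhd w i = closedNbhd G i := fun i => by
    ext j
    simp [wordNbhd, closedNbhd, G, Fin.ext_iff]
  have hc : ∀ i : Fin (w.count .vertex), ∃ c : 𝒞.Code (closedNbhd G i), ∃ p q,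
      IsBlockStart .vertex w i p ∧ IsBlockStart .vertex w (i + 1) q ∧
        IsSegment w (p + 1 + w.count .vertex) q (𝒞.encode c) := by
    intro i
    obtain ⟨a, β, -, p, q, hp, hq, c, hc, -⟩ := (h i i.2).2.2.2
    rw [← hG]
    exact ⟨c, p, q, hp, hq, hc⟩
  choose c p q hp hq hc using hc
  refine ⟨G, c, flatten_ofFn_of_blocks _ h₀ fun i => ⟨p i, q i, hp i, hq i, ?_⟩⟩
  obtain ⟨p', hp', hrow⟩ := (h i i.2).2.2.1
  obtain rfl := hp'.unique (hp i)
  refine ⟨hp'.2.resolve_left ?_, IsSegment.append_iff.2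
    ⟨_, IsSegment.ofFn_iff.2 ⟨rfl, fun j => ?_⟩, hc i⟩⟩
  · intro h
    have := hp'.1
    rw [h, List.take_length] at this
    exact i.2.ne' this
  · obtain ⟨b, hb⟩ := hrow j j.2
    classical
    rw [hb]
    congr 2
    rw [eq_comm, Bool.eq_iff_iff, decide_eq_true_iff]
    constructor
    · rintro ⟨-, -, p', hp', h'⟩
      rw [hp'.unique (hp i), hb] at h'
      simpa using h'
    · exact fun h' => ⟨i.2, j.2, _, hp', by rw [hb, h']⟩

end CodeScheme

/-! ### Definability of the fixed-point existence problem -/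

namespace CodeScheme

variable {B : LogicalBasis} {𝒞 : CodeScheme B} {w : List (Token B)}

theorem stageDefinable_wordAdj :
    StageDefinable fun w (d : ℕ × ℕ) => WordAdj (B := B) w d.1 d.2 := by
  have h : Definable (dim (ℕ × ℕ)) fun (w : List (Token B)) _ (d : ℕ × ℕ) =>
      d.1 < w.count .vertex ∧ d.2 < w.count .vertex ∧ ∃ p ≤ w.length, IsBlockStart .vertex w d.1 p ∧
        ∃ u ≤ w.length, p + 1 = u ∧ ∃ v ≤ w.length, u + d.2 = v ∧ w[v]? = some (.adj true) :=
    .and (.lt_count _) (.and (.lt_count _) (.ex (.and (.isBlockStart _)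
      (.ex (.and .succ (.ex (.and .add (.letter _))))))))
  refine .of_definable (h.congr fun w _ d _ => ?_)
  refine and_congr_right fun _ => and_congr_right fun _ => ?_
  constructor
  · rintro ⟨p, -, hp, _, -, rfl, _, -, rfl, h⟩
    exact ⟨p, hp, h⟩
  · rintro ⟨p, hp, h⟩
    have := (List.getElem?_eq_some_iff.1 h).1
    exact ⟨p, hp.le_length, hp, _, by omega, rfl, _, this.le, rfl, h⟩

/-- For configurations that are given by tuples, it is definable whether a segment describes a
function with a certain value. -/
def HasDefinableCodes (𝒞 : CodeScheme B) : Prop :=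
  ∀ k, StageDefinable fun (w : List (Token B)) (d : ℕ × (Fin k → ℕ) × ℕ × ℕ × ℕ) =>
    𝒞.IsCode w d.1 (Set.range d.2.1) d.2.2.1 d.2.2.2.1 d.2.2.2.2

theorem HasDefinableCodes.isVertexCode (h𝒞 : 𝒞.HasDefinableCodes) (k : ℕ) :
    StageDefinable fun (w : List (Token B)) (d : ℕ × (Fin k → ℕ) × ℕ) =>
      𝒞.IsVertexCode w d.1 (Set.range d.2.1) d.2.2 := by
  have h : Definable (dim (ℕ × (Fin k → ℕ) × ℕ)) fun (w : List (Token B)) _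
      (d : ℕ × (Fin k → ℕ) × ℕ) => ∃ p ≤ w.length, ∃ q ≤ w.length, IsBlockStart .vertex w d.1 p ∧
        (∃ v ≤ w.length, d.1 + 1 = v ∧ IsBlockStart .vertex w v q) ∧
          ∃ n ≤ w.length, w.count .vertex = n ∧ ∃ z ≤ w.length, p + 1 = z ∧
            ∃ m ≤ w.length, z + n = m ∧ 𝒞.IsCode w d.1 (Set.range d.2.1) m q d.2.2 :=
    .ex (.ex (.and (.isBlockStart _) (.and (.ex (.and .succ (.isBlockStart _)))
      (.ex (.and (.count _) (.ex (.and .succ (.ex (.and .add ((h𝒞 k).definable₅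
        (R := fun w v (a : Fin k → ℕ) p q β => 𝒞.IsCode w v (Set.range a) p q β)))))))))))
  refine .of_definable (h.congr fun w _ d _ => ?_)
  constructor
  · rintro ⟨p, -, q, -, hp, ⟨_, -, rfl, hq⟩, _, -, rfl, _, -, rfl, _, -, rfl, h⟩
    exact ⟨p, q, hp, hq, h⟩
  · rintro ⟨p, q, hp, hq, h⟩
    have hd : d.1 + 1 ≤ w.length := by
      rw [← hq.1]
      exact List.count_le_length.trans (List.length_take_le' _ _)
    have hm : p + 1 + w.count .vertex ≤ w.length := by
      obtain ⟨c, hc, -⟩ := h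
      exact hc.le.trans hq.le_length
    exact ⟨p, hp.le_length, q, hq.le_length, hp, ⟨_, hd, rfl, hq⟩, _, List.count_le_length, rfl,
      _, by omega, rfl, _, hm, rfl, h⟩

theorem HasDefinableCodes.isFixedAt (h𝒞 : 𝒞.HasDefinableCodes) (k : ℕ) :
    StageDefinable fun (w : List (Token B)) (d : ℕ × (Fin k → ℕ)) =>
      𝒞.IsFixedAt w d.1 (Set.range d.2) :=
  .of_definable (.and (.lt_count _) (.ex (.and ((h𝒞.isVertexCode k).definable₃
    (R := fun w v (a : Fin k → ℕ) β => 𝒞.IsVertexCode w v (Set.range a) β))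
    (.iff .mem_range .zero))))

theorem HasDefinableCodes.isValid (h𝒞 : 𝒞.HasDefinableCodes) :
    Definable 0 fun w _ (_ : Unit) => 𝒞.IsValid w := by
  have h : Definable (C := Unit) 0 fun (w : List (Token B)) _ _ =>
      (∃ z ≤ w.length, z = 0 ∧ IsBlockStart .vertex w z z) ∧
        ∀ i ≤ w.length, i < w.count .vertex → ¬ WordAdj w i i ∧
          (∀ j ≤ w.length, j < w.count .vertex → WordAdj w i j → WordAdj w j i) ∧
          (∃ p ≤ w.length, IsBlockStart .vertex w i p ∧ ∀ j ≤ w.length, j < w.count .vertex →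
            ∃ z ≤ w.length, p + 1 = z ∧ ∃ m ≤ w.length, z + j = m ∧
              ∃ b, w[m]? = some (.adj b)) ∧
          ∃ (a : Fin 0 → ℕ), (∀ j, a j ≤ w.length) ∧
            ∃ β ≤ w.length, 𝒞.IsVertexCode w i (Set.range a) β :=
    .and (.ex (.and .zero (.isBlockStart _))) (.all (.imp (.lt_count _)
      (.and (.not stageDefinable_wordAdj.definable₂) (.and (.all (.imp (.lt_count _)
        (.imp stageDefinable_wordAdj.definable₂ stageDefinable_wordAdj.definable₂)))
        (.and (.ex (.and (.isBlockStart _) (.all (.imp (.lt_count _) (.ex (.and .succ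
          (.ex (.and .add (.exists_finite fun _ => .letter _)))))))))
          (.exTuple (.ex ((h𝒞.isVertexCode 0).definable₃
            (R := fun w v (a : Fin 0 → ℕ) β => 𝒞.IsVertexCode w v (Set.range a) β)))))))))
  refine h.congr fun w _ _ _ => ?_
  have hle : ∀ i, i < w.count .vertex → i ≤ w.length := fun i hi =>
    hi.le.trans List.count_le_length
  constructor
  · rintro ⟨⟨_, -, rfl, h₀⟩, h⟩
    refine ⟨h₀, fun i hi => ?_⟩
    obtain ⟨h₁, h₂, ⟨p, -, hp, h₃⟩, a, -, h₄⟩ := h i (hle i hi) hi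
    refine ⟨h₁, fun j hj => h₂ j (hle j hj) hj, ⟨p, hp, fun j hj => ?_⟩, a, h₄⟩
    obtain ⟨_, -, rfl, _, -, rfl, h⟩ := h₃ j (hle j hj) hj
    exact h
  · rintro ⟨h₀, h⟩
    refine ⟨⟨0, Nat.zero_le _, rfl, h₀⟩, fun i _ hi => ?_⟩
    obtain ⟨h₁, h₂, ⟨p, hp, h₃⟩, a, h₄⟩ := h i hi
    refine ⟨h₁, fun j _ hj => h₂ j hj, ⟨p, hp.le_length, hp, fun j _ hj => ?_⟩, a,
      fun j => j.elim0, h₄⟩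
    obtain ⟨b, hb⟩ := h₃ j hj
    have := (List.getElem?_eq_some_iff.1 hb).1
    exact ⟨_, by omega, rfl, _, this.le, rfl, b, hb⟩

theorem IsFixedAt.congr {v : ℕ} {s s' : Set ℕ} (h : ∀ u, u = v ∨ WordAdj w v u → (u ∈ s ↔ u ∈ s'))
    (hs : 𝒞.IsFixedAt w v s) : 𝒞.IsFixedAt w v s' := by
  have : indicator (wordNbhd w v) s = indicator (wordNbhd w v) s' := by
    ext j
    rw [Bool.eq_iff_iff, indicator_eq_true_iff, indicator_eq_true_iff]
    exact h j.1 j.2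
  simpa only [IsFixedAt, IsVertexCode, IsCode, this, h v (.inl rfl)] using hs

theorem exists_fixedPoint_iff {G : SimpleGraph (Fin (w.count .vertex))}
    {c : (i : Fin (w.count .vertex)) → 𝒞.Code (closedNbhd G i)} (h : 𝒞.systemEncode G c = w) :
    (∃ x : Fin (w.count .vertex) → Bool, ∀ i, 𝒞.eval (fun j => x j) (c i) = x i) ↔
      ∃ y, ∀ v ∈ Set.range (Fin.val : Fin (w.count .vertex) → ℕ), 𝒞.IsFixedAt w v y := by
  classical
  simp only [Set.forall_mem_range, isFixedAt_iff h]
  constructor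
  · rintro ⟨x, hx⟩
    have h₁ : ∀ i : Fin (w.count .vertex), i.1 ∈ {v | ∃ hv, x ⟨v, hv⟩ = true} ↔ x i = true :=
      fun i => ⟨fun ⟨_, h⟩ => h, fun h => ⟨i.2, h⟩⟩
    refine ⟨{v | ∃ hv, x ⟨v, hv⟩ = true}, fun i => ?_⟩
    rw [h₁, ← hx i]
    congr! 3 with j
    rw [Bool.eq_iff_iff, indicator_eq_true_iff]
    exact h₁ j
  · rintro ⟨y, hy⟩
    refine ⟨fun i => decide (i.1 ∈ y), fun i => ?_⟩
    rw [Bool.eq_iff_iff, decide_eq_true_iff, ← hy i]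
    congr!

/-- A finite set of numbers less than `N` is given by a tuple whose remaining entries are `N`. -/
theorem _root_.Set.exists_range_tuple_eq {s : Set ℕ} {N k : ℕ} (hs : ∀ v ∈ s, v < N)
    (hk : s.ncard ≤ k) :
    ∃ a : Fin k → ℕ, (∀ j, a j ≤ N) ∧ ∀ v < N, (v ∈ Set.range a ↔ v ∈ s) := by
  have hfin : s.Finite := (Set.finite_Iio N).subset hs
  let l := hfin.toFinset.toList
  have hl : ∀ v, v ∈ l ↔ v ∈ s := by simp [l]
  have hlen : l.length ≤ k := by
    rwa [Finset.length_toList, ← Set.ncard_eq_toFinset_card s hfin]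
  refine ⟨fun j => l.getD j N, fun j => ?_, fun v hv => ⟨?_, fun h => ?_⟩⟩
  · beta_reduce
    by_cases hj : j < l.length
    · rw [List.getD_eq_getElem _ _ hj]
      exact (hs _ ((hl _).1 (List.getElem_mem hj))).le
    · rw [List.getD_eq_default _ _ (not_lt.1 hj)]
  · rintro ⟨j, rfl⟩
    by_cases hj : j < l.length
    · simp only [List.getD_eq_getElem _ _ hj]
      exact (hl _).1 (List.getElem_mem hj)
    · simp only [List.getD_eq_default _ _ (not_lt.1 hj)] at hv
      exact (lt_irrefl _ hv).elim
  · obtain ⟨j, hj, rfl⟩ := List.mem_iff_getElem.1 ((hl v).2 h)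
    exact ⟨⟨j, hj.trans_le hlen⟩, List.getD_eq_getElem _ _ hj⟩

/-- If functions are described by codes whose values are definable, then fixed-point existence can
be decided in polynomial time for graphs without a given minor that has a vertex cover of size
one. -/
theorem HasDefinableCodes.decidableInPolyTime (h𝒞 : 𝒞.HasDefinableCodes) {W : Type*} [Finite W]
    {X : SimpleGraph W} (hX : ∃ U : Set W, U.ncard = 1 ∧ X.IsVertexCover U) :
    DecidableInPolyTime (𝒞.language (Forb X)) := by
  obtain ⟨U, hU, hXU⟩ := hX
  obtain ⟨w₀, rfl⟩ := Set.ncard_eq_one.1 hU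
  have hX : ∀ v w, X.Adj v w → v = w₀ ∨ w = w₀ := fun v w h => hXU h
  let m := Nat.card {w // w ≠ w₀}
  let e : Fin m ≃ {w // w ≠ w₀} := (Finite.equivFin _).symm
  let J : Set (Fin m) := {j | X.Adj w₀ (e j)}
  -- A bound for the size of three consecutive spheres.
  let k := 3 * (m + 1)
  have hE : ∀ (w : List (Token B)) u v, WordAdj w u v → u ≤ w.length ∧ v ≤ w.length :=
    fun w u v h => ⟨h.1.le.trans List.count_le_length, h.2.1.le.trans List.count_le_length⟩
  -- The radius `w.length` is sufficiently large, because there are at most `w.length` vertices.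
  have hdef : Definable (C := Unit) 0 fun (w : List (Token B)) _ _ => 𝒞.IsValid w ∧
      ¬ HasStar (WordAdj w) (Set.Iio (w.count .vertex)) J ∧
        ∀ r ≤ w.length, r < w.count .vertex → ∃ t ≤ w.length, t = w.length ∧
          ∃ a : Fin k → ℕ, (∀ j, a j ≤ w.length) ∧ IsPartialSolution (WordAdj w) (𝒞.IsFixedAt w)
            {s | ∃ a : Fin k → ℕ, (∀ j, a j ≤ w.length) ∧ Set.range a = s} r t (Set.range a) :=
    .and h𝒞.isValid (.and (.not (.hasStar stageDefinable_wordAdj (fun w u v h => h.lt) J))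
      (.all (.imp (.lt_count _) (.ex (.and .length (.exTuple
        ((StageDefinable.isPartialSolution stageDefinable_wordAdj hE (h𝒞.isFixedAt k)).definable₃
          (R := fun w r t (a : Fin k → ℕ) => IsPartialSolution (WordAdj w) (𝒞.IsFixedAt w)
            {s | ∃ a : Fin k → ℕ, (∀ j, a j ≤ w.length) ∧ Set.range a = s} r t
              (Set.range a)))))))))
  refine (hdef.congr fun w _ _ _ => ?_).decidableInPolyTime
  have key : ∀ (G : SimpleGraph (Fin (w.count .vertex)))
      (c : (i : Fin (w.count .vertex)) → 𝒞.Code (closedNbhd G i)), 𝒞.systemEncode G c = w →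
      ((¬ HasStar (WordAdj w) (Set.Iio (w.count .vertex)) J ∧
        ∀ r ≤ w.length, r < w.count .vertex → ∃ t ≤ w.length, t = w.length ∧
          ∃ a : Fin k → ℕ, (∀ j, a j ≤ w.length) ∧ IsPartialSolution (WordAdj w) (𝒞.IsFixedAt w)
            {s | ∃ a : Fin k → ℕ, (∀ j, a j ≤ w.length) ∧ Set.range a = s} r t (Set.range a)) ↔
      G ∈ Forb X (w.count .vertex) ∧
        ∃ x : Fin (w.count .vertex) → Bool, ∀ i, 𝒞.eval (fun j => x j) (c i) = x i) := by
    intro G c h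
    have hrange : (Set.Iio (w.count .vertex)) =
        Set.range (Fin.val : Fin (w.count .vertex) → ℕ) := by simp
    have hsupp : ∀ u v, WordAdj w u v → v ∈ (Set.Iio (w.count .vertex)) := fun u v h => h.lt.2
    have hstar : HasStar (WordAdj w) (Set.Iio (w.count .vertex)) J ↔ IsMinorOf X G := by
      rw [isMinorOf_iff_hasStar hX e, hrange]
      refine hasStar_map_iff Fin.val_injective fun u v' => ?_
      rw [wordAdj_iff h]
      exact ⟨fun ⟨_, hv, h⟩ => ⟨⟨v', hv⟩, rfl, h⟩, by rintro ⟨v, rfl, h⟩; exact ⟨u.2, v.2, h⟩⟩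
    change (_ ∧ _) ↔ (¬ IsMinorOf X G ∧ _)
    rw [← hstar]
    refine and_congr_right fun hstar => ?_
    have : Std.Symm (WordAdj w) := ⟨fun u v h' => by
      rw [wordAdj_iff h] at h' ⊢
      obtain ⟨_, _, h'⟩ := h'
      exact ⟨_, _, h'.symm⟩⟩
    have hcard : (Set.Iio (w.count .vertex)).ncard ≤ w.length := by
      rw [← Finset.coe_Iio, Set.ncard_coe_finset, Nat.card_Iio]
      exact List.count_le_length
    rw [exists_fixedPoint_iff h, ← hrange, exists_forall_sat_iff hsupp (Set.finite_Iio _) hcard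
      (fun v s s' => IsFixedAt.congr) (F := {s | ∃ a : Fin k → ℕ, (∀ j, a j ≤ w.length) ∧
        Set.range a = s})]
    · constructor
      · intro h r hr
        obtain ⟨_, -, rfl, a, ha, h⟩ := h r (hr.le.trans List.count_le_length) hr
        exact ⟨_, ⟨a, ha, rfl⟩, h⟩
      · intro h r _ hr
        obtain ⟨_, ⟨a, ha, rfl⟩, h⟩ := h r hr
        exact ⟨_, le_rfl, rfl, a, ha, h⟩
    · intro r hr y t
      have hlt : ∀ v ∈ nearSphere (WordAdj w) r t, v < w.length := by
        rintro v ⟨i, hi, -⟩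
        have : v ∈ Set.Iio (w.count .vertex) := ball_subset hsupp hr hi.1
        exact lt_of_lt_of_le this List.count_le_length
      have hfin : (nearSphere (WordAdj w) r t).Finite := (Set.finite_Iio w.length).subset hlt
      obtain ⟨a, ha, ha'⟩ := Set.exists_range_tuple_eq (k := k)
        (fun v (hv : v ∈ y ∩ nearSphere (WordAdj w) r t) => hlt v hv.2)
        ((Set.ncard_le_ncard Set.inter_subset_right hfin).trans
          (ncard_nearSphere_le hsupp (Set.finite_Iio _) hstar hr t))
      exact ⟨_, ⟨a, ha, rfl⟩, fun v hv => by simp [ha' v (hlt v hv), hv]⟩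
  constructor
  · rintro ⟨hw, h⟩
    obtain ⟨G, c, hGc⟩ := hw.exists_systemEncode
    exact ⟨_, G, c, hGc, (key G c hGc).1 h⟩
  · rintro ⟨n, G, c, hGc, h⟩
    obtain rfl : w.count .vertex = n := count_systemEncode hGc
    exact ⟨isValid_of_systemEncode hGc, (key G c hGc).2 h⟩

end CodeScheme

/-! ### Unique readability -/

section Readability

variable {B : LogicalBasis}

/-- A unary number at the end of a word cannot be continued by the first letter of `t`. -/
def EndsUnary (t : List (Token B)) : Prop := t.head? ≠ some .one

theorem encodeUnary_append_inj {a b : ℕ} {t t' : List (Token B)} (ht : EndsUnary t)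
    (ht' : EndsUnary t') (h : encodeUnary a ++ t = encodeUnary b ++ t') : a = b ∧ t = t' := by
  induction a generalizing b with
  | zero =>
    rcases b with _ | b
    · exact ⟨rfl, h⟩
    · refine (ht ?_).elim
      change t = _ at h
      rw [h]
      rfl
  | succ a ih =>
    rcases b with _ | b
    · refine (ht' ?_).elim
      change _ = t' at h
      rw [← h]
      rfl
    · have := ih (b := b) (List.cons.inj h).2
      exact ⟨congrArg _ this.1, this.2⟩

theorem flatten_ofFn_append_inj {n : ℕ} {f f' : Fin n → List (Token B)} {t t' : List (Token B)}
    (h : ∀ i s s', EndsUnary s → EndsUnary s' → f i ++ s = f' i ++ s' → f i = f' i)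
    (hf : ∀ i s, EndsUnary (f i ++ s)) (hf' : ∀ i s, EndsUnary (f' i ++ s)) (ht : EndsUnary t)
    (ht' : EndsUnary t') (htt' : (List.ofFn f).flatten ++ t = (List.ofFn f').flatten ++ t') :
    (∀ i, f i = f' i) ∧ t = t' := by
  induction n with
  | zero => exact ⟨fun i => i.elim0, by simpa using htt'⟩
  | succ n ih =>
    have hends : ∀ (n : ℕ) (f : Fin n → List (Token B)) (t : List (Token B)), EndsUnary t →
        (∀ i s, EndsUnary (f i ++ s)) → EndsUnary ((List.ofFn f).flatten ++ t) := by
      intro n f t ht hf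
      rcases n with _ | n
      · simpa using ht
      · rw [List.ofFn_succ, List.flatten_cons, List.append_assoc]
        exact hf _ _
    simp only [List.ofFn_succ, List.flatten_cons, List.append_assoc] at htt'
    have h₀ := h 0 _ _ (hends n _ t ht fun i => hf i.succ) (hends n _ t' ht' fun i => hf' i.succ)
      htt'
    rw [h₀] at htt'
    have := ih (fun i => h i.succ) (fun i => hf i.succ) (fun i => hf' i.succ)
      (List.append_cancel_left htt')
    exact ⟨Fin.cases h₀ this.1, this.2⟩

theorem BoolFormula.endsUnary_encode {n : ℕ} {A : Set (Fin n)} (φ : BoolFormula B A)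
    (t : List (Token B)) : EndsUnary (φ.encode ++ t) := by
  cases φ <;> simp [EndsUnary, encode]

theorem BoolFormula.encode_append_inj {n : ℕ} {A : Set (Fin n)} {φ ψ : BoolFormula B A}
    {t t' : List (Token B)} (ht : EndsUnary t) (ht' : EndsUnary t')
    (h : φ.encode ++ t = ψ.encode ++ t') : φ = ψ := by
  induction φ generalizing ψ t t' with
  | var v =>
    cases ψ with
    | var u =>
      have := (encodeUnary_append_inj ht ht' (List.cons.inj h).2).1
      rw [Subtype.ext (Fin.ext this)]
    | gate g args => simp [encode] at h
  | gate g args ih =>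
    cases ψ with
    | var u => simp [encode] at h
    | gate g' args' =>
      obtain ⟨h₁, h₂⟩ := List.cons.inj h
      cases h₁
      have := (flatten_ofFn_append_inj (fun i s s' hs hs' h => congrArg _ (ih i hs hs' h))
        (fun i s => (args i).endsUnary_encode s) (fun i s => (args' i).endsUnary_encode s)
        ht ht' h₂).1
      congr
      funext i
      exact ih i (t := []) (t' := []) (by simp [EndsUnary]) (by simp [EndsUnary])
        (by rw [List.append_nil, List.append_nil, this i])

theorem BoolFormula.vertex_notMem_encode {n : ℕ} {A : Set (Fin n)} (φ : BoolFormula B A) :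
    .vertex ∉ φ.encode := by
  induction φ with
  | var v => simp [encode, encodeUnary]
  | gate g args ih => simpa [encode, List.mem_ofFn] using ih

end Readability

/-! ### Formulas -/

section Formulas

variable {B : LogicalBasis}

open CodeScheme

/-- Functions described by formulas. -/
def formulaScheme (B : LogicalBasis) : CodeScheme B where
  Code A := BoolFormula B A
  encode φ := φ.encode
  eval x φ := φ.eval x
  vertex_notMem φ := φ.vertex_notMem_encode
  eval_eq φ ψ h x := by
    rw [BoolFormula.encode_append_inj (φ := φ) (ψ := ψ) (t := []) (t' := []) (by simp [EndsUnary])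
      (by simp [EndsUnary]) (by rw [h])]

theorem fpeFormula_eq (B : LogicalBasis) (𝒢 : GraphClass) :
    FPEFormula B 𝒢 = (formulaScheme B).language 𝒢 := by
  ext w
  constructor
  · rintro ⟨n, S, hS, hG, x, hx⟩
    refine ⟨n, S.graph, S.formula, hS, hG, x, fun i => ?_⟩
    have := congrFun hx i
    simp only [BooleanDynamicalSystem.globalTransition, BooleanDynamicalSystem.activity,
      Set.mem_univ, if_true] at this
    exact this
  · rintro ⟨n, G, c, hc, hG, x, hx⟩
    refine ⟨n, ⟨G, c⟩, hc, hG, x, funext fun i => ?_⟩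
    simp only [BooleanDynamicalSystem.globalTransition, BooleanDynamicalSystem.activity,
      Set.mem_univ, if_true]
    exact hx i

theorem mem_wordNbhd_iff {w : List (Token B)} {v j : ℕ} :
    (∃ u : wordNbhd w v, u.1.1 = j) ↔ j < w.count .vertex ∧ (j = v ∨ WordAdj w v j) := by
  constructor
  · rintro ⟨⟨u, hu⟩, rfl⟩
    exact ⟨u.2, hu⟩
  · rintro ⟨h, h'⟩
    exact ⟨⟨⟨j, h⟩, h'⟩, rfl⟩

/-- The recursion for the values of formulas: the arguments of a gate are read from consecutive
segments. -/
theorem isCode_formulaScheme_iff {w : List (Token B)} {v : ℕ} {s : Set ℕ} {p q β : ℕ} :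
    (formulaScheme B).IsCode w v s p q β ↔
      (w[p]? = some .var ∧ ∃ j, (∃ u : wordNbhd w v, u.1.1 = j) ∧
        IsSegment w (p + 1) q (List.replicate j .one) ∧ (j ∈ s ↔ β = 0)) ∨
      ∃ g, w[p]? = some (.gate g) ∧ ∃ b : Fin (B.arity g) → Bool, (B.eval g b = true ↔ β = 0) ∧
        ∃ σ : Fin (B.arity g + 1) → ℕ, σ 0 = p + 1 ∧ σ (Fin.last _) = q ∧
          ∀ i, ∃ β' ≤ 1, (b i = true ↔ β' = 0) ∧
            (formulaScheme B).IsCode w v s (σ i.castSucc) (σ i.succ) β' := by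
  constructor
  · rintro ⟨φ, h, h'⟩
    cases φ with
    | var u => exact .inl ⟨h.1, u.1, ⟨u, rfl⟩, h.2, indicator_eq_true_iff.symm.trans h'⟩
    | gate g args =>
      obtain ⟨σ, h₁, h₂, h₃⟩ := IsSegment.flatten_ofFn_iff.1 h.2
      refine .inr ⟨g, h.1, fun i => (args i).eval (indicator _ s), h', σ, h₁, h₂, fun i => ?_⟩
      by_cases hi : (args i).eval (indicator _ s) = true
      · exact ⟨0, by omega, by simp [hi], args i, h₃ i, by simpa [formulaScheme] using hi⟩
      · exact ⟨1, le_rfl, by simp [hi], args i, h₃ i, by simpa [formulaScheme] using hi⟩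
  · rintro (⟨h, _, ⟨u, rfl⟩, h₁, h₂⟩ | ⟨g, h, b, hb, σ, h₀, h₁, h₂⟩)
    · exact ⟨.var u, ⟨h, h₁⟩, indicator_eq_true_iff.trans h₂⟩
    · choose β' _ hb' args hargs hargs' using h₂
      refine ⟨.gate g args, ⟨h, IsSegment.flatten_ofFn_iff.2 ⟨σ, h₀, h₁, hargs⟩⟩, ?_⟩
      rw [← hb]
      have : (fun i => (args i).eval (indicator _ s)) = b := funext fun i => by
        rw [Bool.eq_iff_iff, hb']
        exact hargs' i
      rw [← this]
      rfl

theorem hasDefinableCodes_formulaScheme : (formulaScheme B).HasDefinableCodes := by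
  intro k
  -- The inequalities make sure that the segments of the arguments are shorter than the whole
  -- segment, whatever the relation `A` is.
  have hΦ : Definable (dim (ℕ × (Fin k → ℕ) × ℕ × ℕ × ℕ)) fun (w : List (Token B)) A
      (d : ℕ × (Fin k → ℕ) × ℕ × ℕ × ℕ) =>
      (w[d.2.2.1]? = some .var ∧ ∃ j ≤ w.length,
        (j < w.count .vertex ∧ (j = d.1 ∨ WordAdj w d.1 j)) ∧
        (∃ u ≤ w.length, d.2.2.1 + 1 = u ∧ IsSegment w u d.2.2.2.1 (List.replicate j .one)) ∧
          (j ∈ Set.range d.2.1 ↔ d.2.2.2.2 = 0)) ∨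
      ∃ g, w[d.2.2.1]? = some (.gate g) ∧ ∃ b : Fin (B.arity g) → Bool,
        (B.eval g b = true ↔ d.2.2.2.2 = 0) ∧ ∃ σ : Fin (B.arity g + 1) → ℕ,
          (∀ j, σ j ≤ w.length) ∧ d.2.2.1 + 1 = σ 0 ∧ σ (Fin.last _) = d.2.2.2.1 ∧
            σ 0 ≤ d.2.2.2.1 ∧ ∀ i : Fin (B.arity g), σ 0 ≤ σ i.castSucc ∧ σ i.succ ≤ d.2.2.2.1 ∧
              ∃ β ≤ w.length, (b i = true ↔ β = 0) ∧
                A (entries (d.1, d.2.1, σ i.castSucc, σ i.succ, β)) = true :=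
    .or (.and (.letter _) (.ex (.and (.and (.lt_count _) (.or .eq
        stageDefinable_wordAdj.definable₂))
        (.and (.ex (.and .succ (.isSegment_replicate _))) (.iff .mem_range .zero)))))
      (.exists_finite fun g => .and (.letter _) (.exists_finite fun b => .and
        (.iff (.const _) .zero) (.exTuple (.and .succ (.and .eq (.and .le
          (.forall_finite fun i => .and .le (.and .le
            (.ex (.and (.iff (.const _) .zero) .oracle))))))))))
  refine .of_recursion hΦ (fun _ d => d.2.2.2.1 - d.2.2.1) (fun w d hd => ?_)
    fun w A ⟨v, a, p, q, β⟩ hd ih => ?_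
  · simp only [bounded_prod, bounded_nat] at hd
    omega
  simp only [bounded_prod, bounded_nat, bounded_fin, Prod.forall] at hd ih
  rw [isCode_formulaScheme_iff]
  refine or_congr (and_congr_right fun h => ?_) (exists_congr fun g => and_congr_right fun h =>
    exists_congr fun b => and_congr_right fun _ => exists_congr fun σ => ?_)
  · have hp := (List.getElem?_eq_some_iff.1 h).1
    simp only [mem_wordNbhd_iff]
    constructor
    · rintro ⟨j, -, hj, ⟨_, -, rfl, h₁⟩, h₂⟩
      exact ⟨j, hj, h₁, h₂⟩
    · rintro ⟨j, hj, h₁, h₂⟩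
      exact ⟨j, hj.1.le.trans List.count_le_length, hj, ⟨_, hp, rfl, h₁⟩, h₂⟩
  · have hp := (List.getElem?_eq_some_iff.1 h).1
    have ih' : ∀ p' q' β', p + 1 ≤ p' → p + 1 ≤ q → q' ≤ q → p' ≤ w.length → β' ≤ w.length →
        (A (entries (v, a, p', q', β')) = true ↔
          (formulaScheme B).IsCode w v (Set.range a) p' q' β') := fun p' q' β' h₁ h₂ h₃ h₄ h₅ =>
      ih v a p' q' β' ⟨hd.1, hd.2.1, h₄, h₃.trans hd.2.2.2.1, h₅⟩ (by omega)
    constructor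
    · rintro ⟨hσ, h₁, h₂, h₃, h₄⟩
      refine ⟨h₁.symm, h₂, fun i => ?_⟩
      obtain ⟨h₅, h₆, β', hβ', hb, hA⟩ := h₄ i
      rw [ih' _ _ _ (h₁ ▸ h₅) (h₁ ▸ h₃) h₆ (hσ _) hβ'] at hA
      by_cases h0 : β' = 0
      · exact ⟨0, by omega, by simpa [h0] using hb, h0 ▸ hA⟩
      · obtain ⟨φ, h₇, h₈⟩ := hA
        exact ⟨1, le_rfl, by simpa [h0] using hb, φ, h₇, by simpa [h0] using h₈⟩
    · rintro ⟨h₁, h₂, h₃⟩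
      have hmono : Monotone σ := Fin.monotone_iff_le_succ.2 fun i => by
        obtain ⟨_, _, _, _, h, _⟩ := h₃ i
        exact h.le
      have hle : ∀ i, σ i ≤ q := fun i => (hmono (Fin.le_last i)).trans h₂.le
      refine ⟨fun j => (hle j).trans hd.2.2.2.1, h₁.symm, h₂, hle 0, fun i =>
        ⟨hmono (Fin.zero_le _), hle _, ?_⟩⟩
      obtain ⟨β', hβ', hb, hc⟩ := h₃ i
      refine ⟨β', by omega, hb, (ih' _ _ _ ?_ (h₁ ▸ hle 0) (hle _) ((hle _).trans hd.2.2.2.1)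
        (by omega)).2 hc⟩
      rw [← h₁]
      exact hmono (Fin.zero_le _)

end Formulas

/-! ### Circuits as lists of nodes -/

section Circuits

variable {B : LogicalBasis}

open CodeScheme

/-- A node of a circuit in which variables and other nodes are referred to by numbers. -/
inductive RawNode (B : LogicalBasis) : Type
  | input (j : ℕ) : RawNode B
  | gate (g : Fin B.numGates) (args : Fin (B.arity g) → ℕ) : RawNode B

namespace RawNode

/-- Notation of a node. -/
def encode : RawNode B → List (Token B)
  | input j => .var :: encodeUnary j
  | gate g args => .gate g :: (List.ofFn fun a => .ref :: encodeUnary (args a)).flatten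

/-- The variables and nodes to which the node number `k` refers are in `V` and smaller than `k`,
respectively. -/
def IsValid (V : Set ℕ) (k : ℕ) : RawNode B → Prop
  | input j => j ∈ V
  | gate _ args => ∀ a, args a < k

open Classical in
/-- The value of a node, given a configuration and the values of the preceding nodes. -/
noncomputable def value (s : Set ℕ) (vals : List Bool) : RawNode B → Bool
  | input j => decide (j ∈ s)
  | gate g args => B.eval g fun a => vals.getD (args a) false

/-- The values of a list of nodes. -/
noncomputable def values (s : Set ℕ) (l : List (RawNode B)) : List Bool :=
  l.foldl (fun vals x => vals ++ [x.value s vals]) []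

variable {s : Set ℕ} {l l' : List (RawNode B)} {x : RawNode B}

theorem values_concat : values s (l ++ [x]) = values s l ++ [x.value s (values s l)] := by
  simp [values]

theorem length_values : (values s l).length = l.length := by
  induction l using List.reverseRecOn with
  | nil => rfl
  | append_singleton l x ih => simp [values_concat, ih]

theorem values_prefix (h : l <+: l') : values s l <+: values s l' := by
  obtain ⟨t, rfl⟩ := h
  induction t using List.reverseRecOn with
  | nil => simp
  | append_singleton t x ih =>
    rw [← List.append_assoc, values_concat]
    exact ih.trans (List.prefix_append _ _)

theorem getD_values_of_prefix (h : l <+: l') {k : ℕ} (hk : k < l.length) :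
    (values s l').getD k false = (values s l).getD k false := by
  obtain ⟨t, ht⟩ := values_prefix (s := s) h
  rw [← ht, List.getD_append]
  rwa [length_values]

/-- The node number `k` is computed from the values of the preceding nodes. -/
theorem getD_values (l : List (RawNode B)) {k : ℕ} (hk : k < l.length) :
    (values s l).getD k false = l[k].value s (values s (l.take k)) := by
  have h : l.take (k + 1) <+: l := List.take_prefix _ _
  rw [getD_values_of_prefix h (by simp; omega), List.take_succ_eq_append_getElem hk, values_concat,
    List.getD_append_right _ _ _ _ (by simp [length_values])]
  simp [length_values, hk.le]

/-- All nodes of a list are valid. -/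
def AllValid (V : Set ℕ) (l : List (RawNode B)) : Prop :=
  ∀ (k : ℕ) (x : RawNode B), l[k]? = some x → x.IsValid V k

theorem allValid_concat_iff {V : Set ℕ} :
    AllValid V (l ++ [x]) ↔ AllValid V l ∧ x.IsValid V l.length := by
  constructor
  · refine fun h => ⟨fun k y hy => h k y ?_, h _ _ (by simp)⟩
    rwa [List.getElem?_append_left (List.getElem?_eq_some_iff.1 hy).1]
  · rintro ⟨h, hx⟩ k y hy
    rcases lt_trichotomy k l.length with hk | rfl | hk
    · exact h k y (by rwa [List.getElem?_append_left hk] at hy)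
    · simp only [List.getElem?_concat_length, Option.some.injEq] at hy
      exact hy ▸ hx
    · rw [List.getElem?_eq_none (by simp; omega)] at hy
      simp at hy

theorem AllValid.of_prefix {V : Set ℕ} (h : AllValid V l') (hl : l <+: l') : AllValid V l := by
  obtain ⟨t, rfl⟩ := hl
  refine fun k y hy => h k y ?_
  rwa [List.getElem?_append_left (List.getElem?_eq_some_iff.1 hy).1]

theorem endsUnary_encode (x : RawNode B) (t : List (Token B)) : EndsUnary (x.encode ++ t) := by
  cases x <;> simp [EndsUnary, encode]

theorem encode_append_inj {y : RawNode B} {t t' : List (Token B)} (ht : EndsUnary t)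
    (ht' : EndsUnary t') (h : x.encode ++ t = y.encode ++ t') : x = y ∧ t = t' := by
  cases x with
  | input i =>
    cases y with
    | input j =>
      have := encodeUnary_append_inj ht ht' (List.cons.inj h).2
      exact ⟨congrArg _ this.1, this.2⟩
    | gate g args => simp [encode] at h
  | gate g args =>
    cases y with
    | input j => simp [encode] at h
    | gate g' args' =>
      obtain ⟨h₁, h₂⟩ := List.cons.inj h
      cases h₁
      have key : ∀ i (s s' : List (Token B)), EndsUnary s → EndsUnary s' →
          (.ref :: encodeUnary (args i)) ++ s = (.ref :: encodeUnary (args' i)) ++ s' →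
          args i = args' i := fun i s s' hs hs' h =>
        (encodeUnary_append_inj hs hs' (List.cons.inj h).2).1
      have := flatten_ofFn_append_inj (fun i s s' hs hs' h => by rw [key i s s' hs hs' h])
        (fun i s => by simp [EndsUnary]) (fun i s => by simp [EndsUnary]) ht ht' h₂
      refine ⟨?_, this.2⟩
      congr
      funext i
      exact key i [] [] (by simp [EndsUnary]) (by simp [EndsUnary]) (by rw [this.1 i])

theorem endsUnary_flatMap_encode {t : List (Token B)} (ht : EndsUnary t) :
    EndsUnary (l.flatMap encode ++ t) := by
  cases l with
  | nil => exact ht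
  | cons x l =>
    rw [List.flatMap_cons, List.append_assoc]
    exact x.endsUnary_encode _

/-- Of two lists of nodes that can be read from the same word, one is a prefix of the other. -/
theorem flatMap_encode_append_inj {t t' : List (Token B)} (ht : EndsUnary t) (ht' : EndsUnary t')
    (hl : l.length ≤ l'.length) (h : l.flatMap encode ++ t = l'.flatMap encode ++ t') :
    ∃ l'', l' = l ++ l'' ∧ t = l''.flatMap encode ++ t' := by
  induction l generalizing l' with
  | nil => exact ⟨l', rfl, h⟩
  | cons x l ih =>
    cases l' with
    | nil => simp at hl
    | cons y l' =>
      rw [List.flatMap_cons, List.flatMap_cons, List.append_assoc, List.append_assoc] at h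
      obtain ⟨rfl, h'⟩ := encode_append_inj (endsUnary_flatMap_encode ht)
        (endsUnary_flatMap_encode ht') h
      obtain ⟨l'', rfl, ht⟩ := ih (Nat.le_of_succ_le_succ hl) h'
      exact ⟨l'', rfl, ht⟩

end RawNode

namespace CircuitNode

variable {n : ℕ} {A : Set (Fin n)}

/-- A node without the information that it is valid. -/
def toRaw {k : ℕ} : CircuitNode B A k → RawNode B
  | input v => .input v.1
  | gate g args => .gate g fun a => args a

theorem encode_toRaw {k : ℕ} (x : CircuitNode B A k) : x.toRaw.encode = x.encode := by
  cases x <;> rfl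

theorem isValid_toRaw {k : ℕ} (x : CircuitNode B A k) :
    x.toRaw.IsValid {j | ∃ u : A, u.1.1 = j} k := by
  cases x with
  | input v => exact ⟨v, rfl⟩
  | gate g args => exact fun a => (args a).2

theorem exists_toRaw_eq {k : ℕ} {x : RawNode B} (h : x.IsValid {j | ∃ u : A, u.1.1 = j} k) :
    ∃ y : CircuitNode B A k, y.toRaw = x := by
  cases x with
  | input j =>
    obtain ⟨u, rfl⟩ := h
    exact ⟨.input u, rfl⟩
  | gate g args => exact ⟨.gate g fun a => ⟨args a, h a⟩, rfl⟩

end CircuitNode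

namespace BoolCircuit

variable {n : ℕ} {A : Set (Fin n)}

/-- The list of the nodes of a circuit. -/
def rawNodes (C : BoolCircuit B A) : List (RawNode B) := List.ofFn fun k => (C.node k).toRaw

theorem length_rawNodes (C : BoolCircuit B A) : C.rawNodes.length = C.size := by simp [rawNodes]

theorem allValid_rawNodes (C : BoolCircuit B A) :
    RawNode.AllValid {j | ∃ u : A, u.1.1 = j} C.rawNodes := by
  intro k x hx
  obtain ⟨hk, rfl⟩ := List.getElem?_eq_some_iff.1 hx
  simp only [rawNodes, List.getElem_ofFn]
  exact (C.node _).isValid_toRaw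

theorem encode_eq (C : BoolCircuit B A) :
    C.encode = C.rawNodes.flatMap RawNode.encode ++ .out :: encodeUnary C.output := by
  simp [encode, rawNodes, List.flatMap, List.map_ofFn, comp_def, CircuitNode.encode_toRaw]

theorem value_eq (C : BoolCircuit B A) (s : Set ℕ) (k : Fin C.size) :
    (RawNode.values s C.rawNodes).getD k false = C.value (indicator A s) k := by
  obtain ⟨k, hk⟩ := k
  induction k using Nat.strong_induction_on with
  | _ k ih =>
    have hk' : k < C.rawNodes.length := by rwa [length_rawNodes]
    rw [RawNode.getD_values _ hk', value]
    simp only [rawNodes, List.getElem_ofFn]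
    cases h : C.node ⟨k, hk⟩ with
    | input v => simp [CircuitNode.toRaw, RawNode.value, indicator]
    | gate g args =>
      simp only [CircuitNode.toRaw, RawNode.value]
      congr 1
      funext a
      rw [← ih (args a) (args a).2]
      exact (RawNode.getD_values_of_prefix (List.take_prefix _ _)
        (by simpa using (args a).2.trans hk)).symm

theorem exists_rawNodes_eq {l : List (RawNode B)}
    (h : RawNode.AllValid {j | ∃ u : A, u.1.1 = j} l) {k : ℕ} (hk : k < l.length) :
    ∃ C : BoolCircuit B A, C.rawNodes = l ∧ C.output.1 = k := by
  choose node hnode using fun k : Fin l.length =>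
    CircuitNode.exists_toRaw_eq (h k l[k] (by simp))
  refine ⟨⟨l.length, node, ⟨k, hk⟩⟩, ?_, rfl⟩
  simp only [rawNodes, hnode]
  exact List.ofFn_getElem

theorem eval_eq_of_encode_eq {C C' : BoolCircuit B A} (h : C.encode = C'.encode) (x : A → Bool) :
    C.eval x = C'.eval x := by
  wlog hC : C.rawNodes.length ≤ C'.rawNodes.length generalizing C C'
  · exact (this h.symm (by omega)).symm
  obtain ⟨s, rfl⟩ : ∃ s, x = indicator A s := by
    refine ⟨{v | ∃ u : A, u.1.1 = v ∧ x u = true}, funext fun u => ?_⟩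
    rw [Bool.eq_iff_iff, indicator_eq_true_iff]
    refine ⟨fun h => ⟨u, rfl, h⟩, ?_⟩
    rintro ⟨u', h, h'⟩
    rwa [← Subtype.ext (Fin.ext h)]
  rw [encode_eq, encode_eq] at h
  obtain ⟨l, hl, ho⟩ := RawNode.flatMap_encode_append_inj (by simp [EndsUnary])
    (by simp [EndsUnary]) hC h
  cases l with
  | nil =>
    have ho : C.output.1 = C'.output.1 := by simpa [encodeUnary] using congrArg List.length ho
    rw [eval, eval, ← value_eq, ← value_eq, hl, ho, List.append_nil]
  | cons y l => cases y <;> simp [RawNode.encode] at ho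

theorem vertex_notMem_encode (C : BoolCircuit B A) : .vertex ∉ C.encode := by
  have h : ∀ k (x : CircuitNode B A k), Token.vertex ∉ x.encode := fun k x => by
    cases x <;> simp [CircuitNode.encode, encodeUnary, List.mem_ofFn]
  simp [encode, List.mem_ofFn, h, encodeUnary]

end BoolCircuit

/-- Functions described by circuits. -/
def circuitScheme (B : LogicalBasis) : CodeScheme B where
  Code A := BoolCircuit B A
  encode C := C.encode
  eval x C := C.eval x
  vertex_notMem C := C.vertex_notMem_encode
  eval_eq _ _ h x := BoolCircuit.eval_eq_of_encode_eq h x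

theorem fpeCircuit_eq (B : LogicalBasis) (𝒢 : GraphClass) :
    FPECircuit B 𝒢 = (circuitScheme B).language 𝒢 := by
  ext w
  constructor
  · rintro ⟨n, S, hS, hG, x, hx⟩
    refine ⟨n, S.graph, S.circuit, hS, hG, x, fun i => ?_⟩
    have := congrFun hx i
    simp only [BooleanDynamicalSystem.globalTransition, BooleanDynamicalSystem.activity,
      Set.mem_univ, if_true] at this
    exact this
  · rintro ⟨n, G, c, hc, hG, x, hx⟩
    refine ⟨n, ⟨G, c⟩, hc, hG, x, funext fun i => ?_⟩
    simp only [BooleanDynamicalSystem.globalTransition, BooleanDynamicalSystem.activity,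
      Set.mem_univ, if_true]
    exact hx i

/-! ### Values of circuits by recursion -/

/-- The segment of `w` from `p` to `q` is a list of `k + 1` valid nodes such that the last one has
the value `true` if `β = 0`, and `false` if `β ≠ 0`. The condition on the next letter makes sure
that a number at the end of the last node is read completely. -/
def IsNodeList (w : List (Token B)) (V s : Set ℕ) (p q k β : ℕ) : Prop :=
  ¬ w[q]? = some .one ∧ ∃ l : List (RawNode B), l.length = k + 1 ∧ RawNode.AllValid V l ∧
    IsSegment w p q (l.flatMap RawNode.encode) ∧
      ((RawNode.values s l).getD k false = true ↔ β = 0)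

section NodeLists

variable {w : List (Token B)} {V s : Set ℕ} {p q k β : ℕ}

/-- The numbers of the vertices on which the function of the vertex `v` may depend. -/
def wordVars (w : List (Token B)) (v : ℕ) : Set ℕ := {j | ∃ u : wordNbhd w v, u.1.1 = j}

theorem endsUnary_drop_iff : EndsUnary (w.drop q) ↔ ¬ w[q]? = some .one := by
  rw [EndsUnary, List.head?_drop]

theorem exists_le_iff_eq_zero {N : ℕ} (hN : 0 < N) (b : Bool) : ∃ β ≤ N, (b = true ↔ β = 0) := by
  cases b
  · exact ⟨1, hN, by simp⟩
  · exact ⟨0, hN.le, by simp⟩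

theorem length_pos_of_getElem?_eq_some {a : Token B} (h : w[p]? = some a) : 0 < w.length :=
  Nat.zero_lt_of_lt (List.getElem?_eq_some_iff.1 h).1

theorem IsSegment.flatMap_encode_split {l l' : List (RawNode B)}
    (h : IsSegment w p q ((l ++ l').flatMap RawNode.encode)) (hq : ¬ w[q]? = some .one) :
    ∃ m, IsSegment w p m (l.flatMap RawNode.encode) ∧
      IsSegment w m q (l'.flatMap RawNode.encode) ∧ ¬ w[m]? = some .one := by
  rw [List.flatMap_append, IsSegment.append_iff] at h
  obtain ⟨m, h₁, h₂⟩ := h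
  refine ⟨m, h₁, h₂, ?_⟩
  rw [← endsUnary_drop_iff] at hq ⊢
  rw [h₂.drop_eq]
  exact RawNode.endsUnary_flatMap_encode hq

/-- Every node of a list is the last one of a list that begins at the same position. -/
theorem exists_isNodeList {l : List (RawNode B)} (hl : RawNode.AllValid V l)
    (h : IsSegment w p q (l.flatMap RawNode.encode)) (hq : ¬ w[q]? = some .one)
    (hk : k < l.length) (hβ : (RawNode.values s l).getD k false = true ↔ β = 0) :
    ∃ m ≤ q, IsNodeList w V s p m k β := by
  rw [← List.take_append_drop (k + 1) l] at h
  obtain ⟨m, h₁, h₂, hm⟩ := h.flatMap_encode_split hq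
  have hl' : l.take (k + 1) <+: l := List.take_prefix _ _
  refine ⟨m, h₂.le, hm, _, by simp; omega, hl.of_prefix hl', h₁, ?_⟩
  rwa [← RawNode.getD_values_of_prefix hl' (by simp; omega)]

/-- By unique readability, the value of a node does not depend on the list in which it is found. -/
theorem IsNodeList.getD_values_eq_true_iff {m : ℕ} (hm : IsNodeList w V s p m k β)
    {l : List (RawNode B)} (h : IsSegment w p q (l.flatMap RawNode.encode))
    (hq : ¬ w[q]? = some .one) (hk : k < l.length) :
    (RawNode.values s l).getD k false = true ↔ β = 0 := by
  obtain ⟨hm, l', hl', -, h', hβ⟩ := hm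
  obtain ⟨l'', rfl, -⟩ := RawNode.flatMap_encode_append_inj (endsUnary_drop_iff.2 hm)
    (endsUnary_drop_iff.2 hq) (by omega) (h'.drop_eq.symm.trans h.drop_eq)
  rwa [RawNode.getD_values_of_prefix (List.prefix_append _ _) (by omega)]

theorem IsNodeList.lt (h : IsNodeList w V s p q k β) : k < q := by
  obtain ⟨-, l, hl, -, h, -⟩ := h
  have h₁ : l.length ≤ (l.flatMap RawNode.encode).length := by
    rw [List.length_flatMap]
    refine (List.length_map (as := l) _).symm.le.trans (List.length_le_sum_of_one_le _ ?_)
    simp only [List.mem_map]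
    rintro _ ⟨x, -, rfl⟩
    cases x <;> simp [RawNode.encode]
  have := h.length_eq
  omega

/-- The recursion for the values of nodes: a list of nodes consists of a shorter list and a last
node, whose arguments have values that are given by shorter lists as well. -/
theorem isNodeList_iff : IsNodeList w V s p q k β ↔ ¬ w[q]? = some .one ∧ ∃ m,
    (k = 0 ∧ m = p ∨ ∃ k', k' + 1 = k ∧ ∃ β' ≤ w.length, IsNodeList w V s p m k' β') ∧
    ((w[m]? = some .var ∧ ∃ j ∈ V, IsSegment w (m + 1) q (List.replicate j .one) ∧
        (j ∈ s ↔ β = 0)) ∨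
      ∃ g, w[m]? = some (.gate g) ∧ ∃ b : Fin (B.arity g) → Bool, (B.eval g b = true ↔ β = 0) ∧
        ∃ σ : Fin (B.arity g + 1) → ℕ, σ 0 = m + 1 ∧ σ (Fin.last _) = q ∧
          ∀ i, w[σ i.castSucc]? = some .ref ∧ ∃ r < k,
            IsSegment w (σ i.castSucc + 1) (σ i.succ) (List.replicate r .one) ∧
              ∃ m' ≤ w.length, ∃ β' ≤ w.length, (b i = true ↔ β' = 0) ∧
                IsNodeList w V s p m' r β') := by
  refine and_congr_right fun hq => ?_
  constructor
  · rintro ⟨l, hlk', hl', h, hβ⟩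
    obtain ⟨l, x, rfl⟩ : ∃ l' x, l = l' ++ [x] := by
      rcases List.eq_nil_or_concat l with rfl | ⟨l', x, h⟩
      · simp at hlk'
      · exact ⟨l', x, by rw [h, List.concat_eq_append]⟩
    have hlk : l.length = k := by simpa using hlk'
    obtain ⟨hl, hx⟩ := RawNode.allValid_concat_iff.1 hl'
    rw [RawNode.values_concat,
      List.getD_append_right _ _ _ _ (by simp [RawNode.length_values, hlk])] at hβ
    simp only [RawNode.length_values, hlk, Nat.sub_self, List.getD_cons_zero] at hβ
    obtain ⟨m, h₁, h₂, hm⟩ := h.flatMap_encode_split hq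
    rw [List.flatMap_singleton] at h₂
    have hN : 0 < w.length := by
      cases x <;> exact length_pos_of_getElem?_eq_some h₂.1
    refine ⟨m, ?_, ?_⟩
    · rcases k with _ | k
      · rw [List.length_eq_zero_iff] at hlk
        subst hlk
        exact .inl ⟨rfl, h₁.symm⟩
      · obtain ⟨β', hβ', hβ''⟩ := exists_le_iff_eq_zero hN ((RawNode.values s l).getD k false)
        exact .inr ⟨k, rfl, β', hβ', hm, l, hlk, hl, h₁, hβ''⟩
    · cases x with
      | input j =>
        refine .inl ⟨h₂.1, j, hx, h₂.2, ?_⟩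
        rw [← hβ]
        simp [RawNode.value]
      | gate g args =>
        obtain ⟨σ, h₃, h₄, h₅⟩ := IsSegment.flatten_ofFn_iff.1 h₂.2
        refine .inr ⟨g, h₂.1, _, hβ, σ, h₃, h₄, fun i => ⟨(h₅ i).1, args i, hlk ▸ hx i,
          (h₅ i).2, ?_⟩⟩
        obtain ⟨β', hβ', hβ''⟩ :=
          exists_le_iff_eq_zero hN ((RawNode.values s l).getD (args i) false)
        obtain ⟨m', hm', h₆⟩ := exists_isNodeList hl h₁ hm (hx i) hβ''
        exact ⟨m', hm'.trans (List.getElem?_eq_some_iff.1 h₂.1).1.le, β', hβ', hβ'', h₆⟩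
  · rintro ⟨m, hm, hlast⟩
    have hm1 : ¬ w[m]? = some .one := by
      rcases hlast with ⟨h, _⟩ | ⟨g, h, _⟩ <;> simp [h]
    obtain ⟨l, hlk, hl, h₁⟩ : ∃ l : List (RawNode B), l.length = k ∧ RawNode.AllValid V l ∧
        IsSegment w p m (l.flatMap RawNode.encode) := by
      rcases hm with ⟨rfl, rfl⟩ | ⟨k', rfl, β', -, -, l, hlk, hl, h₁, -⟩
      · exact ⟨[], rfl, by simp [RawNode.AllValid], rfl⟩
      · exact ⟨l, hlk, hl, h₁⟩
    have key : ∀ x : RawNode B, x.IsValid V k → IsSegment w m q x.encode →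
        (x.value s (RawNode.values s l) = true ↔ β = 0) → ∃ l : List (RawNode B),
          l.length = k + 1 ∧ RawNode.AllValid V l ∧
            IsSegment w p q (l.flatMap RawNode.encode) ∧
              ((RawNode.values s l).getD k false = true ↔ β = 0) := by
      intro x hx h hβ
      refine ⟨l ++ [x], by simp [hlk], RawNode.allValid_concat_iff.2 ⟨hl, hlk ▸ hx⟩, ?_, ?_⟩
      · rw [List.flatMap_append, List.flatMap_singleton, IsSegment.append_iff]
        exact ⟨m, h₁, h⟩
      · rw [RawNode.values_concat,
          List.getD_append_right _ _ _ _ (by simp [RawNode.length_values, hlk])]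
        simpa [RawNode.length_values, hlk] using hβ
    rcases hlast with ⟨h, j, hj, h₂, hβ⟩ | ⟨g, h, b, hb, σ, h₀, hlast, h₂⟩
    · exact key (.input j) hj ⟨h, h₂⟩ (by rw [← hβ]; simp [RawNode.value])
    · choose h₃ r hr h₄ m' _ β' _ hb' h₅ using h₂
      refine key (.gate g r) hr ⟨h, IsSegment.flatten_ofFn_iff.2
        ⟨σ, h₀, hlast, fun i => ⟨h₃ i, h₄ i⟩⟩⟩ ?_
      rw [← hb]
      have : (fun a => (RawNode.values s l).getD (r a) false) = b := funext fun a => by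
        rw [Bool.eq_iff_iff, hb', (h₅ a).getD_values_eq_true_iff h₁ hm1 (hlk ▸ hr a)]
      rw [← this]
      rfl

theorem isCode_circuitScheme_iff {v : ℕ} : (circuitScheme B).IsCode w v s p q β ↔
    ∃ m k, (∃ β' ≤ w.length, IsNodeList w (wordVars w v) s p m k β') ∧
      w[m]? = some .out ∧ ∃ r ≤ k, IsSegment w (m + 1) q (List.replicate r .one) ∧
        ∃ m' ≤ w.length, IsNodeList w (wordVars w v) s p m' r β := by
  constructor
  · rintro ⟨C, h, hβ⟩
    change IsSegment w p q C.encode at h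
    change C.value (indicator _ s) C.output = true ↔ β = 0 at hβ
    rw [C.encode_eq, IsSegment.append_iff] at h
    obtain ⟨m, h₁, h₂, h₃⟩ := h
    have hm : ¬ w[m]? = some .one := by simp [h₂]
    have hC := C.output.2
    have hN := length_pos_of_getElem?_eq_some h₂
    obtain ⟨β', hβ', hβ''⟩ :=
      exists_le_iff_eq_zero hN ((RawNode.values s C.rawNodes).getD (C.size - 1) false)
    refine ⟨m, C.size - 1, ⟨β', hβ', hm, C.rawNodes, by rw [C.length_rawNodes]; omega,
      C.allValid_rawNodes, h₁, hβ''⟩, h₂, C.output, by omega, h₃, ?_⟩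
    rw [← C.value_eq] at hβ
    obtain ⟨m', hm', h₄⟩ :=
      exists_isNodeList C.allValid_rawNodes h₁ hm (by rwa [C.length_rawNodes]) hβ
    exact ⟨m', hm'.trans (List.getElem?_eq_some_iff.1 h₂).1.le, h₄⟩
  · rintro ⟨m, k, ⟨β', -, -, l, hlk, hl, h₁, -⟩, hm, r, hr, h₂, m', -, h₃⟩
    obtain ⟨C, hC, hCr⟩ := BoolCircuit.exists_rawNodes_eq hl (k := r) (by omega)
    refine ⟨C, ?_, ?_⟩
    · change IsSegment w p q C.encode
      rw [C.encode_eq, IsSegment.append_iff, hC, hCr]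
      exact ⟨m, h₁, hm, h₂⟩
    · have := h₃.getD_values_eq_true_iff h₁ (by simp [hm]) (by omega)
      rw [← this, ← hC, ← hCr, C.value_eq]
      rfl

end NodeLists

theorem stageDefinable_isNodeList (k : ℕ) :
    StageDefinable fun (w : List (Token B)) (d : (ℕ × (Fin k → ℕ)) × ℕ × ℕ × ℕ × ℕ) =>
      IsNodeList w (wordVars w d.1.1) (Set.range d.1.2) d.2.1 d.2.2.1 d.2.2.2.1 d.2.2.2.2 := by
  have hΦ : Definable (dim ((ℕ × (Fin k → ℕ)) × ℕ × ℕ × ℕ × ℕ)) fun (w : List (Token B)) A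
      (d : (ℕ × (Fin k → ℕ)) × ℕ × ℕ × ℕ × ℕ) =>
      ¬ w[d.2.2.1]? = some .one ∧ ∃ m ≤ w.length,
        (d.2.2.2.1 = 0 ∧ m = d.2.1 ∨ ∃ n ≤ w.length, n + 1 = d.2.2.2.1 ∧ ∃ β ≤ w.length,
          A (entries (d.1, d.2.1, m, n, β)) = true) ∧
        ((w[m]? = some .var ∧ ∃ j ≤ w.length,
          (j < w.count .vertex ∧ (j = d.1.1 ∨ WordAdj w d.1.1 j)) ∧
          (∃ u ≤ w.length, m + 1 = u ∧ IsSegment w u d.2.2.1 (List.replicate j .one)) ∧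
            (j ∈ Set.range d.1.2 ↔ d.2.2.2.2 = 0)) ∨
        ∃ g, w[m]? = some (.gate g) ∧ ∃ b : Fin (B.arity g) → Bool,
          (B.eval g b = true ↔ d.2.2.2.2 = 0) ∧ ∃ σ : Fin (B.arity g + 1) → ℕ,
            (∀ j, σ j ≤ w.length) ∧ m + 1 = σ 0 ∧ σ (Fin.last _) = d.2.2.1 ∧
              ∀ i : Fin (B.arity g), w[σ i.castSucc]? = some .ref ∧ ∃ r ≤ w.length,
                r < d.2.2.2.1 ∧ (∃ u ≤ w.length, σ i.castSucc + 1 = u ∧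
                  IsSegment w u (σ i.succ) (List.replicate r .one)) ∧
                ∃ m' ≤ w.length, ∃ β ≤ w.length, (b i = true ↔ β = 0) ∧
                  A (entries (d.1, d.2.1, m', r, β)) = true) :=
    .and (.not (.letter _)) (.ex (.and (.or (.and .zero .eq) (.ex (.and .succ (.ex .oracle))))
      (.or (.and (.letter _) (.ex (.and (.and (.lt_count _) (.or .eq
        stageDefinable_wordAdj.definable₂))
        (.and (.ex (.and .succ (.isSegment_replicate _))) (.iff .mem_range .zero)))))
      (.exists_finite fun g => .and (.letter _) (.exists_finite fun b => .and
        (.iff (.const _) .zero) (.exTuple (.and .succ (.and .eq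
          (.forall_finite fun i => .and (.letter _) (.ex (.and .lt (.and
            (.ex (.and .succ (.isSegment_replicate _)))
            (.ex (.ex (.and (.iff (.const _) .zero) .oracle)))))))))))))))
  refine .of_recursion hΦ (fun _ d => d.2.2.2.1) (fun w d hd => ?_)
    fun w A ⟨⟨v, a⟩, p, q, n, β⟩ hd ih => ?_
  · simp only [bounded_prod, bounded_nat] at hd
    exact hd.2.2.2.1
  simp only [bounded_prod, bounded_nat, bounded_fin, Prod.forall] at hd ih
  have ih' : ∀ m n' β', m ≤ w.length → n' < n → β' ≤ w.length →
      (A (entries ((v, a), p, m, n', β')) = true ↔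
        IsNodeList w (wordVars w v) (Set.range a) p m n' β') := fun m n' β' h₁ h₂ h₃ =>
    ih v a p m n' β' ⟨hd.1, hd.2.1, h₁, by omega, h₃⟩ h₂
  rw [isNodeList_iff]
  dsimp only
  refine and_congr_right fun _ => exists_congr fun m => ?_
  have hvars : ∀ j, j ∈ wordVars w v ↔ j < w.count .vertex ∧ (j = v ∨ WordAdj w v j) :=
    fun _ => mem_wordNbhd_iff
  constructor
  · rintro ⟨hm, h₁, h₂⟩
    refine ⟨h₁.imp_right ?_, h₂.imp ?_ ?_⟩
    · rintro ⟨n', _, hn, β', hβ', hA⟩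
      exact ⟨n', hn, β', hβ', (ih' m n' β' hm (by omega) hβ').1 hA⟩
    · rintro ⟨h, j, _, hj, ⟨_, _, rfl, h₃⟩, h₄⟩
      exact ⟨h, j, (hvars j).2 hj, h₃, h₄⟩
    · rintro ⟨g, h, b, hb, σ, hσ, h₃, h₄, h₅⟩
      refine ⟨g, h, b, hb, σ, h₃.symm, h₄, fun i => ?_⟩
      obtain ⟨h₆, r, _, hr, ⟨_, _, rfl, h₇⟩, m', hm', β', hβ', hbβ, hA⟩ := h₅ i
      exact ⟨h₆, r, hr, h₇, m', hm', β', hβ', hbβ, (ih' m' r β' hm' hr hβ').1 hA⟩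
  · rintro ⟨h₁, h₂⟩
    have hm : m < w.length := by
      rcases h₂ with ⟨h, _⟩ | ⟨g, h, _⟩ <;> exact (List.getElem?_eq_some_iff.1 h).1
    refine ⟨hm.le, h₁.imp_right ?_, h₂.imp ?_ ?_⟩
    · rintro ⟨n', hn, β', hβ', hA⟩
      exact ⟨n', by omega, hn, β', hβ', (ih' m n' β' hm.le (by omega) hβ').2 hA⟩
    · rintro ⟨h, j, hj, h₃, h₄⟩
      rw [hvars] at hj
      exact ⟨h, j, hj.1.le.trans List.count_le_length, hj, ⟨_, hm, rfl, h₃⟩, h₄⟩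
    · rintro ⟨g, h, b, hb, σ, h₃, h₄, h₅⟩
      have hlt : ∀ i : Fin (B.arity g), σ i.castSucc < w.length := fun i =>
        (List.getElem?_eq_some_iff.1 (h₅ i).1).1
      refine ⟨g, h, b, hb, σ, Fin.lastCases (h₄ ▸ hd.2.2.1) fun i => (hlt i).le, h₃.symm, h₄,
        fun i => ?_⟩
      obtain ⟨h₆, r, hr, h₇, m', hm', β', hβ', hbβ, hA⟩ := h₅ i
      exact ⟨h₆, r, by omega, hr, ⟨_, hlt i, rfl, h₇⟩, m', hm', β', hβ', hbβ,
        (ih' m' r β' hm' hr hβ').2 hA⟩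

theorem hasDefinableCodes_circuitScheme : (circuitScheme B).HasDefinableCodes := by
  intro k
  -- The pair `(d.1, d.2.1)` of the vertex and the configuration is kept together, as it is the
  -- first component of the tuples in `stageDefinable_isNodeList`.
  have h : Definable (dim (ℕ × (Fin k → ℕ) × ℕ × ℕ × ℕ)) fun (w : List (Token B)) _
      (d : ℕ × (Fin k → ℕ) × ℕ × ℕ × ℕ) =>
      ∃ m ≤ w.length, ∃ n ≤ w.length, (∃ β ≤ w.length,
        IsNodeList w (wordVars w (d.1, d.2.1).1) (Set.range (d.1, d.2.1).2) d.2.2.1 m n β) ∧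
        w[m]? = some .out ∧
          ∃ r ≤ w.length, r ≤ n ∧
            (∃ u ≤ w.length, m + 1 = u ∧ IsSegment w u d.2.2.2.1 (List.replicate r .one)) ∧
            ∃ m' ≤ w.length,
              IsNodeList w (wordVars w (d.1, d.2.1).1) (Set.range (d.1, d.2.1).2) d.2.2.1 m' r
                d.2.2.2.2 :=
    .ex (.ex (.and (.ex ((stageDefinable_isNodeList k).definable₅
      (R := fun w (a : ℕ × (Fin k → ℕ)) p q n β =>
        IsNodeList w (wordVars w a.1) (Set.range a.2) p q n β)))
      (.and (.letter _) (.ex (.and .le (.and (.ex (.and .succ (.isSegment_replicate _)))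
        (.ex ((stageDefinable_isNodeList k).definable₅
          (R := fun w (a : ℕ × (Fin k → ℕ)) p q n β =>
            IsNodeList w (wordVars w a.1) (Set.range a.2) p q n β)))))))))
  refine .of_definable (h.congr fun w _ d hd => ?_)
  simp only [bounded_prod, bounded_nat] at hd
  rw [isCode_circuitScheme_iff]
  refine exists_congr fun m => ?_
  constructor
  · rintro ⟨_, n, _, h₁, h₂, r, _, hr, ⟨_, _, rfl, h₃⟩, m', hm', h₄⟩
    exact ⟨n, h₁, h₂, r, hr, h₃, m', hm', h₄⟩
  · rintro ⟨n, h₁, h₂, r, hr, h₃, m', hm', h₄⟩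
    have hm := (List.getElem?_eq_some_iff.1 h₂).1
    have hn : n ≤ w.length := by
      obtain ⟨β, -, h₁⟩ := h₁
      exact h₁.lt.le.trans hm.le
    exact ⟨hm.le, n, hn, h₁, h₂, r, hr.trans hn, hr, ⟨_, hm, rfl, h₃⟩, m', hm', h₄⟩

end Circuits

/-! ### Polynomial-time decidability -/

theorem theorem7 (B : LogicalBasis) {W : Type*} [Finite W] (X : SimpleGraph W)
    (hX : ∃ U : Set W, U.ncard = 1 ∧ X.IsVertexCover U) :
    DecidableInPolyTime (FPEFormula B (Forb X)) ∧
      DecidableInPolyTime (FPECircuit B (Forb X)) := by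
  rw [fpeFormula_eq, fpeCircuit_eq]
  exact ⟨hasDefinableCodes_formulaScheme.decidableInPolyTime hX,
    hasDefinableCodes_circuitScheme.decidableInPolyTime hX⟩
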